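/- Let $M$ be a compact smooth Riemannian manifold without boundary, with volume measure $dx$, gradient $\nabla$, divergence $\mathrm{div}$ and Hessian $\nabla^2$. Let $\mathcal P_+(M)$ be the set of smooth strictly positive probability densities on $M$. Let $\mathcal D\supseteq\mathcal P_+(M)$ be an open set of smooth real functions on $M$ and let $\mathcal F\colon\mathcal D\to\mathbb R$ be a smooth functional with smooth $L^2$ first variation $\delta\mathcal F\colon\mathcal D\to C^\infty(M)$, that is, $\frac{d}{d\varepsilon}\big|_{\varepsilon=0}\mathcal F(\rho+\varepsilon h)=\int\delta\mathcal F(\rho)\,h\,dx$ for all $h\in C^\infty(M)$; here smooth means that smooth finite-dimensional families in $\mathcal D$ are mapped to smooth families. Let $\delta^2\mathcal F(\rho)$ be the second variation: the operator $h\mapsto\frac{d}{d\varepsilon}\big|_{\varepsilon=0}\delta\mathcal F(\rho+\varepsilon h)$, with (possibly distributional) kernel $\delta^2\mathcal F(\rho)(x,y)$. Assume that $\delta\mathcal F$ is injective on $\mathcal D$, with inverse $(\delta\mathcal F)^{-1}$ on its range, and that $\mathcal F$ is $a$-homogeneous: there are $a>0$ and $b\in\mathbb R$ with $\mathcal F(\rho)=a^{-1}\int\delta\mathcal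 F(\rho)\,\rho\,dx+b$ for all $\rho\in\mathcal P_+(M)$. Let $J\subseteq\mathbb R$ be an open set of times and let $(\rho_t,S_t)_{t\in J}$, with $\rho_t\in\mathcal P_+(M)$, $S_t\in C^\infty(M)$, both smooth in $(t,x)$, solve the Hamiltonian flow $$\partial_t\rho_t=\partial_S\mathcal H(\rho_t,S_t),\qquad \partial_tS_t=-\partial_\rho\mathcal H(\rho_t,S_t),\qquad \mathcal H(\rho,S)=\tfrac12\int|\nabla S|^2\rho\,dx-\tfrac12\int|\nabla\delta\mathcal F(\rho)|^2\rho\,dx,$$ where $\partial_\rho,\partial_S$ are $L^2$ first variations. Let $\eta_t,\eta^*_t\in\mathcal D$ be the variables given by the generalized Hopf--Cole transformation $$\delta\mathcal F(\rho_t)=\delta\mathcal F(\eta_t)+\delta\mathcal F(\eta^*_t),\qquad S_t=\delta\mathcal F(\eta_t)-\delta\mathcal F(\eta^*_t),\qquad t\in J,$$ and define the split energies $$\mathcal G(\eta,\eta^*)=a^{-1}\int(\delta\mathcal F)^{-1}\big(\delta\mathcal F(\eta)+\delta\mathcal F(\eta^*)\big)\,\delta\mathcal F(\eta)\,dx+\frac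 b2,\qquad \mathcal G^*(\eta,\eta^*)=a^{-1}\int(\delta\mathcal F)^{-1}\big(\delta\mathcal F(\eta)+\delta\mathcal F(\eta^*)\big)\,\delta\mathcal F(\eta^*)\,dx+\frac b2 .$$ For $\rho\in\mathcal P_+(M)$ and $\Phi\in C^\infty(M)$ put $V_\Phi=-\mathrm{div}(\rho\nabla\Phi)$, and let $\mathrm{Hess}_W\mathcal F(\rho)$ be the Wasserstein Hessian, the symmetric bilinear form on these tangent vectors with $$\mathrm{Hess}_W\mathcal F(\rho)(V_\Phi,V_\Phi)=\iint\nabla_x\nabla_y\delta^2\mathcal F(\rho)(x,y)\,\nabla\Phi(x)\,\nabla\Phi(y)\,\rho(x)\rho(y)\,dx\,dy+\int\nabla^2\delta\mathcal F(\rho)(\nabla\Phi,\nabla\Phi)\,\rho\,dx,$$ where derivatives of the kernel are taken in the sense of distributions. Then $t\mapsto\mathcal G(\eta_t,\eta^*_t)$ and $t\mapsto\mathcal G^*(\eta_t,\eta^*_t)$ are twice differentiable on $J$, and for all $t\in J$ $$\frac{d^2}{dt^2}\mathcal G(\eta_t,\eta^*_t)=2\,\mathrm{Hess}_W\mathcal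 F(\rho_t)\big(V_{\delta\mathcal F(\eta_t)},V_{\delta\mathcal F(\eta_t)}\big),\qquad \frac{d^2}{dt^2}\mathcal G^*(\eta_t,\eta^*_t)=2\,\mathrm{Hess}_W\mathcal F(\rho_t)\big(V_{\delta\mathcal F(\eta^*_t)},V_{\delta\mathcal F(\eta^*_t)}\big),$$ with $V$ taken at $\rho=\rho_t$. -/

import Mathlib

open MeasureTheory Bundle Set
open scoped Manifold ContDiff

noncomputable section

namespace HopfCole

/-! ### Riemannian calculus on a compact manifold, in charts -/

section Geometry

variable (n : ℕ) {M : Type*} [TopologicalSpace M]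
  [ChartedSpace (EuclideanSpace ℝ (Fin n)) M]

/-- Smooth real functions on `M`. -/
def IsSmooth (f : M → ℝ) : Prop :=
  ContMDiff (𝓡 n) 𝓘(ℝ, ℝ) ∞ f

/-- A family of functions `c p : M → ℝ`, `p ∈ U`, which is jointly smooth in `(p, x) ∈ U × M`. -/
def IsSmoothFamily {P : Type*} [NormedAddCommGroup P] [NormedSpace ℝ P]
    (U : Set P) (c : P → M → ℝ) : Prop :=
  ContMDiffOn (𝓘(ℝ, P).prod (𝓡 n)) 𝓘(ℝ, ℝ) ∞ (fun q : P × M => c q.1 q.2) (U ×ˢ univ)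

/-- The partial derivative `∂_i f` in `ℝⁿ`. -/
def coordDeriv {n : ℕ} (i : Fin n) (f : EuclideanSpace ℝ (Fin n) → ℝ)
    (u : EuclideanSpace ℝ (Fin n)) : ℝ :=
  fderiv ℝ f u (EuclideanSpace.single i 1)

/-- The components `v ^ i` of a tangent vector at `y` in the chart around `x₀`. -/
def coord (x₀ : M) (y : M) (v : TangentSpace (𝓡 n) y) (i : Fin n) : ℝ :=
  let w : EuclideanSpace ℝ (Fin n) :=
    mfderiv (𝓡 n) 𝓘(ℝ, EuclideanSpace ℝ (Fin n)) (extChartAt (𝓡 n) x₀) y v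
  w i

/-- The coordinate vector field `∂/∂u_i` of the chart around `x₀`, at the point with
coordinates `u`. -/
def coordVector (x₀ : M) (u : EuclideanSpace ℝ (Fin n)) (i : Fin n) :
    TangentSpace (𝓡 n) ((extChartAt (𝓡 n) x₀).symm u) :=
  mfderiv 𝓘(ℝ, EuclideanSpace ℝ (Fin n)) (𝓡 n) (extChartAt (𝓡 n) x₀).symm u
    (EuclideanSpace.single i (1 : ℝ) : EuclideanSpace ℝ (Fin n))

instance instFiniteDimensionalTangentSpace (x : M) :
    FiniteDimensional ℝ (TangentSpace (𝓡 n) x) :=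
  inferInstanceAs (FiniteDimensional ℝ (EuclideanSpace ℝ (Fin n)))

variable [RiemannianBundle (fun x : M => TangentSpace (𝓡 n) x)]

/-- The metric coefficients `g_ij` in the chart around `x₀`. -/
def metricMatrix (x₀ : M) (u : EuclideanSpace ℝ (Fin n)) : Matrix (Fin n) (Fin n) ℝ :=
  Matrix.of fun i j => inner ℝ (coordVector n x₀ u i) (coordVector n x₀ u j)

/-- The Riemannian volume density `√(det g)` in the chart around `x₀`. -/
def volumeDensity (x₀ : M) (u : EuclideanSpace ℝ (Fin n)) : ℝ :=
  Real.sqrt (metricMatrix n x₀ u).det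

/-- The Riemannian volume of the domain of the chart around `x₀`: the image under the inverse
chart of `√(det g) du`. -/
def chartVolume [MeasurableSpace M] (x₀ : M) : Measure M :=
  (((volume : Measure (EuclideanSpace ℝ (Fin n))).restrict (extChartAt (𝓡 n) x₀).target).withDensity
    (fun u => ENNReal.ofReal (volumeDensity n x₀ u))).map (extChartAt (𝓡 n) x₀).symm

variable (M) in
/-- The Riemannian volume measure of `M`. The measures `chartVolume n x₀` agree on overlaps of
charts, so that their supremum is the measure which restricts to each of them. -/
def riemannianVolume [MeasurableSpace M] : Measure M :=
  ⨆ x₀ : M, chartVolume n x₀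

/-- The Riemannian gradient: `⟪∇f, v⟫ = df v`. -/
def gradient (f : M → ℝ) (x : M) : TangentSpace (𝓡 n) x :=
  (InnerProductSpace.toDual ℝ (TangentSpace (𝓡 n) x)).symm (mfderiv (𝓡 n) 𝓘(ℝ, ℝ) f x)

/-- The Riemannian divergence of a vector field:
`div X = (det g)^(-1/2) ∑ i, ∂_i ((det g)^(1/2) X^i)`, computed at `x` in the chart around `x`. -/
def divergence (X : ∀ x : M, TangentSpace (𝓡 n) x) (x : M) : ℝ :=
  (volumeDensity n x (extChartAt (𝓡 n) x x))⁻¹ *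
    ∑ i : Fin n, coordDeriv i
      (fun u => volumeDensity n x u *
        coord n x ((extChartAt (𝓡 n) x).symm u) (X ((extChartAt (𝓡 n) x).symm u)) i)
      (extChartAt (𝓡 n) x x)

/-- The Christoffel symbols `Γ^k_ij` of the Levi-Civita connection in the chart around `x₀`. -/
def christoffel (x₀ : M) (u : EuclideanSpace ℝ (Fin n)) (k i j : Fin n) : ℝ :=
  (1 / 2) * ∑ l : Fin n, ((metricMatrix n x₀ u)⁻¹ k l) *
    (coordDeriv i (fun w => metricMatrix n x₀ w j l) u
      + coordDeriv j (fun w => metricMatrix n x₀ w i l) u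
      - coordDeriv l (fun w => metricMatrix n x₀ w i j) u)

/-- The Riemannian Hessian `∇²f (v, w) = ∑ i j, (∂_i ∂_j f - ∑ k, Γ^k_ij ∂_k f) v^i w^j`,
computed at `x` in the chart around `x`. -/
def hessian (f : M → ℝ) (x : M) (v w : TangentSpace (𝓡 n) x) : ℝ :=
  ∑ i : Fin n, ∑ j : Fin n,
    (coordDeriv i (coordDeriv j (f ∘ (extChartAt (𝓡 n) x).symm)) (extChartAt (𝓡 n) x x)
      - ∑ k : Fin n, christoffel n x (extChartAt (𝓡 n) x x) k i j *
          coordDeriv k (f ∘ (extChartAt (𝓡 n) x).symm) (extChartAt (𝓡 n) x x))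
    * coord n x x v i * coord n x x w j

end Geometry

/-! ### Functionals of functions on `M` and their variations -/

section Functionals

variable (n : ℕ) {M : Type*} [TopologicalSpace M] [MeasurableSpace M]
  [ChartedSpace (EuclideanSpace ℝ (Fin n)) M]
  [RiemannianBundle (fun x : M => TangentSpace (𝓡 n) x)]

variable (M) in
/-- The smooth and strictly positive probability densities on `M`. -/
def positiveDensities : Set (M → ℝ) :=
  {ρ | IsSmooth n ρ ∧ (∀ x, 0 < ρ x) ∧ ∫ x, ρ x ∂(riemannianVolume n M) = 1}

/-- The smooth function `g` is the first variation (`L²` gradient) of `F` at `ρ`: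
`d/dε F(ρ + ε h) = ∫ g h` at `ε = 0`, for each smooth `h`. -/
def HasFirstVariationAt (F : (M → ℝ) → ℝ) (g ρ : M → ℝ) : Prop :=
  IsSmooth n g ∧ ∀ h : M → ℝ, IsSmooth n h →
    HasDerivAt (fun ε : ℝ => F (ρ + ε • h)) (∫ x, g x * h x ∂(riemannianVolume n M)) 0

open Classical in
/-- The first variation `δF(ρ)` (zero if there is none). -/
def firstVariation (F : (M → ℝ) → ℝ) (ρ : M → ℝ) : M → ℝ :=
  if h : ∃ g, HasFirstVariationAt n F g ρ then h.choose else 0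

/-- The second variation `δ²F(ρ)` as an operator:
`(δ²F(ρ) h)(x) = d/dε δF(ρ + ε h)(x)` at `ε = 0`, that is, `∫ δ²F(ρ)(x, y) h(y) dy`. -/
def secondVariation (F : (M → ℝ) → ℝ) (ρ h : M → ℝ) (x : M) : ℝ :=
  deriv (fun ε : ℝ => firstVariation n F (ρ + ε • h) x) 0

/-- `D` is an open set of smooth functions on `M`: for each smooth finite-dimensional family of
smooth functions, the parameters of those that lie in `D` form an open set. -/
def IsSmoothlyOpen (D : Set (M → ℝ)) : Prop :=
  (∀ ρ ∈ D, IsSmooth n ρ) ∧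
  ∀ (P : Type) [NormedAddCommGroup P] [NormedSpace ℝ P] [FiniteDimensional ℝ P]
    (U : Set P) (c : P → M → ℝ), IsOpen U → IsSmoothFamily n U c → IsOpen {p ∈ U | c p ∈ D}

/-- `F` is a smooth functional on the open set `D` of smooth functions: it has a first variation
at each point of `D`, and both `F` and `δF` map smooth finite-dimensional families in `D` to
smooth families (of numbers, respectively of functions). -/
structure IsSmoothFunctional (F : (M → ℝ) → ℝ) (D : Set (M → ℝ)) : Prop where
  isOpen : IsSmoothlyOpen n D
  exists_firstVariation : ∀ ρ ∈ D, ∃ g, HasFirstVariationAt n F g ρ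
  smooth : ∀ (P : Type) [NormedAddCommGroup P] [NormedSpace ℝ P] [FiniteDimensional ℝ P]
    (U : Set P) (c : P → M → ℝ), IsOpen U → IsSmoothFamily n U c → (∀ p ∈ U, c p ∈ D) →
      ContDiffOn ℝ ∞ (fun p => F (c p)) U
  smooth_firstVariation :
    ∀ (P : Type) [NormedAddCommGroup P] [NormedSpace ℝ P] [FiniteDimensional ℝ P]
    (U : Set P) (c : P → M → ℝ), IsOpen U → IsSmoothFamily n U c → (∀ p ∈ U, c p ∈ D) →
      IsSmoothFamily n U (fun p => firstVariation n F (c p))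

/-- `F` is `a`-homogeneous with constant `b`: `F(ρ) = a⁻¹ ∫ δF(ρ) ρ + b` for all smooth
positive probability densities. -/
def IsHomogeneousFunctional (F : (M → ℝ) → ℝ) (a b : ℝ) : Prop :=
  0 < a ∧ ∀ ρ ∈ positiveDensities n M,
    F ρ = a⁻¹ * (∫ x, firstVariation n F ρ x * ρ x ∂(riemannianVolume n M)) + b

/-! ### The Wasserstein Hessian -/

/-- The tangent vector `V_Φ = -div(ρ ∇Φ)` at the density `ρ`. -/
def wassersteinVector (ρ Φ : M → ℝ) (x : M) : ℝ :=
  -divergence n (fun y => ρ y • gradient n Φ y) x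

open Classical in
/-- The cotangent vector of the tangent vector `V`: a smooth `Φ` with `V_Φ = V`, unique up to a
locally constant function (zero if there is none). -/
def wassersteinPotential (ρ V : M → ℝ) : M → ℝ :=
  if h : ∃ Φ : M → ℝ, IsSmooth n Φ ∧ wassersteinVector n ρ Φ = V then h.choose else 0

/-- The Hessian of `F` in the density manifold. With `V = V_Φ` and `W = V_Ψ` it is
`∬ ∇_x ∇_y δ²F(ρ)(x, y) ∇Φ(x) ∇Ψ(y) ρ(x) ρ(y) dx dy + ∫ ∇²δF(ρ)(∇Φ, ∇Ψ) ρ dx`.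
The kernel `δ²F(ρ)(x, y)` may be a distribution: its `y`-derivative is taken in the sense of
distributions, `∫ ∇_y δ²F(ρ)(x, y) ∇Ψ(y) ρ(y) dy = (δ²F(ρ) (-div(ρ ∇Ψ)))(x)`. -/
def wassersteinHessian (F : (M → ℝ) → ℝ) (ρ V W : M → ℝ) : ℝ :=
  let Φ := wassersteinPotential n ρ V
  let Ψ := wassersteinPotential n ρ W
  (∫ x, inner ℝ (gradient n (secondVariation n F ρ (wassersteinVector n ρ Ψ)) x)
      (gradient n Φ x) * ρ x ∂(riemannianVolume n M))
  + ∫ x, hessian n (firstVariation n F ρ) x (gradient n Φ x) (gradient n Ψ x) * ρ x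
      ∂(riemannianVolume n M)

/-! ### The Hamiltonian flow, the Hopf-Cole transformation and the split energies -/

/-- `H(ρ, S) = 1/2 ∫ |∇S|² ρ - 1/2 ∫ |∇δF(ρ)|² ρ`. -/
def hamiltonian (F : (M → ℝ) → ℝ) (ρ S : M → ℝ) : ℝ :=
  (1 / 2) * (∫ x, ‖gradient n S x‖ ^ 2 * ρ x ∂(riemannianVolume n M))
  - (1 / 2) * ∫ x, ‖gradient n (firstVariation n F ρ) x‖ ^ 2 * ρ x ∂(riemannianVolume n M)

/-- `(ρ, S)` is a smooth solution on the time set `J` of the Hamiltonian flow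
`∂_t ρ = ∂_S H(ρ, S)`, `∂_t S = -∂_ρ H(ρ, S)`, with `ρ` a smooth positive probability density
at each time; the partial derivatives of `H` are `L²` first variations. -/
structure IsHamiltonianFlow (F : (M → ℝ) → ℝ) (J : Set ℝ) (ρ S : ℝ → M → ℝ) : Prop where
  smooth_density : IsSmoothFamily n J ρ
  smooth_potential : IsSmoothFamily n J S
  density : ∀ t ∈ J, ρ t ∈ positiveDensities n M
  density_eq : ∀ t ∈ J, HasFirstVariationAt n (fun S' => hamiltonian n F (ρ t) S')
    (fun x => deriv (fun s => ρ s x) t) (S t)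
  potential_eq : ∀ t ∈ J, HasFirstVariationAt n (fun ρ' => hamiltonian n F ρ' (S t))
    (fun x => -deriv (fun s => S s x) t) (ρ t)

/-- `(ρ, S)` is the generalized Hopf-Cole transform of `(η, η')`. -/
def IsHopfCole (F : (M → ℝ) → ℝ) (η η' ρ S : M → ℝ) : Prop :=
  firstVariation n F ρ = firstVariation n F η + firstVariation n F η' ∧
  S = firstVariation n F η - firstVariation n F η'

/-- The density `(δF)⁻¹(δF(η) + δF(η'))`, for the inverse of `δF` on `D`. -/
def hopfColeDensity (F : (M → ℝ) → ℝ) (D : Set (M → ℝ)) (η η' : M → ℝ) : M → ℝ :=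
  Function.invFunOn (firstVariation n F) D (firstVariation n F η + firstVariation n F η')

/-- The split energy `G(η, η') = a⁻¹ ∫ (δF)⁻¹(δF(η) + δF(η')) δF(η) dx + b / 2`. -/
def splitEnergy (F : (M → ℝ) → ℝ) (D : Set (M → ℝ)) (a b : ℝ) (η η' : M → ℝ) : ℝ :=
  a⁻¹ * (∫ x, hopfColeDensity n F D η η' x * firstVariation n F η x ∂(riemannianVolume n M))
    + b / 2

/-- The split energy `G*(η, η') = a⁻¹ ∫ (δF)⁻¹(δF(η) + δF(η')) δF(η') dx + b / 2`. -/
def splitEnergyStar (F : (M → ℝ) → ℝ) (D : Set (M → ℝ)) (a b : ℝ) (η η' : M → ℝ) : ℝ :=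
  a⁻¹ * (∫ x, hopfColeDensity n F D η η' x * firstVariation n F η' x ∂(riemannianVolume n M))
    + b / 2

end Functionals

end HopfCole

end

open HopfCole

/-! Write `g = δF(ρ)`, `Q h = δ²F(ρ) h`, `V_Φ = -div(ρ ∇Φ)` and `Γ(f, h) = ⟪∇f, ∇h⟫`. Injectivity of
`δF` turns the Hopf-Cole density back into `ρ`, and the Hopf-Cole relations give `δF(η) = (g + S)/2`
and `δF(η') = (g - S)/2`. Both energies are therefore `a⁻¹ ∫ ρ f + b/2` with `f = (g + σ S)/2`, and
the two signs `σ = ±1` are treated at once.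

Integration by parts and the symmetry of `Q` put the flow in the explicit form `∂_t ρ = V_S`, `∂_t S
= -Γ(S,S)/2 + Γ(g,g)/2 + Q V_g`, and the chain rule gives `∂_t g = Q V_S`. Differentiating the
homogeneity relation in a mean-zero direction `h` gives `∫ (Q h) ρ = (a - 1) ∫ g h`
(`pairing_secondVariation_density`). With it, the first derivative of the energy becomes `∫ Γ(g,S) ρ
/ 2 + (σ/2) ∫ Γ(g,g) ρ + (σ/(4a)) ∫ (Γ(S,S) - Γ(g,g)) ρ`. The last integral is twice the conserved
Hamiltonian, so `a` disappears from the second derivative.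

On the other side, the Bochner-type identity `∇²g(∇f,∇f) = Γ(Γ(g,f),f) - Γ(Γ(f,f),g)/2`
(`hessian_gradient_gradient`) and integration by parts (`integral_mul_wassersteinVector`) rewrite
the Wasserstein Hessian as `∫ (Q V_f) V_f + ∫ Γ(g,f) V_f - ∫ Γ(f,f) V_g / 2`. Both sides are then
combinations of `L²` pairings of `Q V_g`, `Q V_S`, `Γ(g,g)`, `Γ(g,S)`, `Γ(S,S)` with `V_g` and
`V_S`; they agree because `Q` is symmetric and `σ² = 1`.

Two foundations have to be supplied. Geometry is given by chart formulas, so the volume must be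
glued from the charts and the divergence shown to be chart-independent. Smoothness of `F` is known
only along finite-dimensional families, so linearity and symmetry of `δ²F` and the chain rule for
`δF` are each obtained from a suitable two-parameter family. -/

set_option linter.unusedSectionVars false

noncomputable section

namespace HopfCole

/-! ### Smoothness of functions and families, read in charts. -/

section Charts

variable {n : ℕ} {M : Type*} [TopologicalSpace M]
  [ChartedSpace (EuclideanSpace ℝ (Fin n)) M] [IsManifold (𝓡 n) ∞ M]
  {P : Type*} [NormedAddCommGroup P] [NormedSpace ℝ P]

theorem isSmoothFamily_iff {U : Set P} {c : P → M → ℝ} (hU : IsOpen U) :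
    IsSmoothFamily n U c ↔ ∀ x₀ : M, ContDiffOn ℝ ∞
      (fun q : P × EuclideanSpace ℝ (Fin n) => c q.1 ((extChartAt (𝓡 n) x₀).symm q.2))
      (U ×ˢ (extChartAt (𝓡 n) x₀).target) := by
  constructor
  · intro h x₀
    rw [← contMDiffOn_iff_contDiffOn]
    have h1 : ContMDiffOn 𝓘(ℝ, P × EuclideanSpace ℝ (Fin n)) (𝓘(ℝ, P).prod (𝓡 n)) ∞
        (fun q : P × EuclideanSpace ℝ (Fin n) => (q.1, (extChartAt (𝓡 n) x₀).symm q.2))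
        (U ×ˢ (extChartAt (𝓡 n) x₀).target) := by
      refine ContMDiffOn.prodMk contDiff_fst.contMDiff.contMDiffOn ?_
      exact (contMDiffOn_extChartAt_symm x₀).comp contDiff_snd.contMDiff.contMDiffOn
        (fun q hq => hq.2)
    exact ContMDiffOn.comp h h1 (fun q hq => ⟨hq.1, mem_univ _⟩)
  · rintro h ⟨p, x⟩ ⟨hp, -⟩
    have h1 : ContMDiffAt (𝓘(ℝ, P).prod (𝓡 n)) 𝓘(ℝ, P × EuclideanSpace ℝ (Fin n)) ∞
        (fun q : P × M => (q.1, extChartAt (𝓡 n) x q.2)) (p, x) := by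
      refine ContMDiffAt.prodMk_space contMDiffAt_fst ?_
      exact (contMDiffAt_extChartAt (x := x)).comp (p, x) contMDiffAt_snd
    have hopen : IsOpen (U ×ˢ (extChartAt (𝓡 n) x).target) := hU.prod (isOpen_extChartAt_target x)
    have h2 := ((h x).contDiffAt (x := (p, extChartAt (𝓡 n) x x))
      (hopen.mem_nhds ⟨hp, mem_extChartAt_target x⟩)).contMDiffAt
    have h3 := ContMDiffAt.comp (p, x) h2 h1
    refine (h3.congr_of_eventuallyEq ?_).contMDiffWithinAt
    have : ∀ᶠ q : P × M in nhds (p, x), q.2 ∈ (extChartAt (𝓡 n) x).source :=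
      continuousAt_snd.eventually (extChartAt_source_mem_nhds x)
    filter_upwards [this] with q hq
    simp only [Function.comp_apply, (extChartAt (𝓡 n) x).left_inv hq]

theorem isSmooth_iff {f : M → ℝ} : IsSmooth n f ↔ ∀ x₀ : M, ContDiffOn ℝ ∞
      (f ∘ (extChartAt (𝓡 n) x₀).symm) (extChartAt (𝓡 n) x₀).target := by
  constructor
  · intro h x₀
    rw [← contMDiffOn_iff_contDiffOn]
    exact h.comp_contMDiffOn (contMDiffOn_extChartAt_symm x₀)
  · intro h x
    have h2 := ((h x).contDiffAt (x := extChartAt (𝓡 n) x x)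
      ((isOpen_extChartAt_target x).mem_nhds (mem_extChartAt_target x))).contMDiffAt
    refine (ContMDiffAt.comp x h2 (contMDiffAt_extChartAt (x := x))).congr_of_eventuallyEq ?_
    filter_upwards [extChartAt_source_mem_nhds (I := 𝓡 n) x] with y hy
    simp only [Function.comp_apply, (extChartAt (𝓡 n) x).left_inv hy]

end Charts

/-! ### Coordinate vector fields and metric coefficients. -/

section Metric

variable {n : ℕ} {M : Type*} [TopologicalSpace M]
  [ChartedSpace (EuclideanSpace ℝ (Fin n)) M] [IsManifold (𝓡 n) ∞ M]

theorem mdifferentiableAt_extChartAt_symm {x₀ : M} {u : EuclideanSpace ℝ (Fin n)}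
    (hu : u ∈ (extChartAt (𝓡 n) x₀).target) :
    MDifferentiableAt 𝓘(ℝ, EuclideanSpace ℝ (Fin n)) (𝓡 n) (extChartAt (𝓡 n) x₀).symm u :=
  ((contMDiffOn_extChartAt_symm (n := ∞) x₀).contMDiffAt
    ((isOpen_extChartAt_target x₀).mem_nhds hu)).mdifferentiableAt (by simp)

theorem mfderiv_extChartAt_mfderiv_symm {x₀ : M} {u : EuclideanSpace ℝ (Fin n)}
    (hu : u ∈ (extChartAt (𝓡 n) x₀).target) (w : EuclideanSpace ℝ (Fin n)) :
    mfderiv (𝓡 n) 𝓘(ℝ, EuclideanSpace ℝ (Fin n)) (extChartAt (𝓡 n) x₀)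
      ((extChartAt (𝓡 n) x₀).symm u)
      (mfderiv 𝓘(ℝ, EuclideanSpace ℝ (Fin n)) (𝓡 n) (extChartAt (𝓡 n) x₀).symm u w) = w := by
  have : IsManifold (𝓡 n) 1 M := .of_le (n := ∞) (by simp)
  have h := mfderiv_extChartAt_comp_mfderivWithin_extChartAt_symm (I := 𝓡 n) hu
  simp only [modelWithCornersSelf_coe, range_id, mfderivWithin_univ] at h
  exact DFunLike.congr_fun h w

theorem mfderiv_symm_mfderiv_extChartAt {x₀ : M} {u : EuclideanSpace ℝ (Fin n)}
    (hu : u ∈ (extChartAt (𝓡 n) x₀).target)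
    (v : TangentSpace (𝓡 n) ((extChartAt (𝓡 n) x₀).symm u)) :
    (mfderiv 𝓘(ℝ, EuclideanSpace ℝ (Fin n)) (𝓡 n) (extChartAt (𝓡 n) x₀).symm u
      (mfderiv (𝓡 n) 𝓘(ℝ, EuclideanSpace ℝ (Fin n)) (extChartAt (𝓡 n) x₀)
      ((extChartAt (𝓡 n) x₀).symm u) v)) = v := by
  have : IsManifold (𝓡 n) 1 M := .of_le (n := ∞) (by simp)
  have h := mfderivWithin_extChartAt_symm_comp_mfderiv_extChartAt (I := 𝓡 n) hu
  simp only [modelWithCornersSelf_coe, range_id, mfderivWithin_univ] at h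
  exact DFunLike.congr_fun h v

theorem sum_coord_smul_coordVector {x₀ : M} {u : EuclideanSpace ℝ (Fin n)}
    (hu : u ∈ (extChartAt (𝓡 n) x₀).target)
    (v : TangentSpace (𝓡 n) ((extChartAt (𝓡 n) x₀).symm u)) :
    ∑ i, coord n x₀ _ v i • coordVector n x₀ u i = v := by
  conv_rhs => rw [← mfderiv_symm_mfderiv_extChartAt hu v]
  unfold coord coordVector
  set w : EuclideanSpace ℝ (Fin n) := mfderiv (𝓡 n) 𝓘(ℝ, EuclideanSpace ℝ (Fin n))
    (extChartAt (𝓡 n) x₀) ((extChartAt (𝓡 n) x₀).symm u) v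
  have hw : w = ∑ i, w i • EuclideanSpace.single i (1 : ℝ) := by
    ext j
    simp [Pi.single_apply]
  conv_rhs => rw [hw]
  exact (by
    have := map_sum (mfderiv 𝓘(ℝ, EuclideanSpace ℝ (Fin n)) (𝓡 n) (extChartAt (𝓡 n) x₀).symm u)
      (fun i => w i • (EuclideanSpace.single i (1 : ℝ) : EuclideanSpace ℝ (Fin n))) Finset.univ
    refine Eq.trans ?_ this.symm
    refine Finset.sum_congr rfl fun i _ => ?_
    exact (map_smul (mfderiv 𝓘(ℝ, EuclideanSpace ℝ (Fin n)) (𝓡 n) (extChartAt (𝓡 n) x₀).symm u)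
      (w i) (EuclideanSpace.single i (1 : ℝ) : EuclideanSpace ℝ (Fin n))).symm)

theorem mfderiv_coordVector {f : M → ℝ} {x₀ : M} {u : EuclideanSpace ℝ (Fin n)}
    (hu : u ∈ (extChartAt (𝓡 n) x₀).target)
    (hf : MDifferentiableAt (𝓡 n) 𝓘(ℝ, ℝ) f ((extChartAt (𝓡 n) x₀).symm u)) (i : Fin n) :
    mfderiv (𝓡 n) 𝓘(ℝ, ℝ) f ((extChartAt (𝓡 n) x₀).symm u) (coordVector n x₀ u i) =
      coordDeriv i (f ∘ (extChartAt (𝓡 n) x₀).symm) u := by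
  have h := mfderiv_comp u hf (mdifferentiableAt_extChartAt_symm hu)
  rw [mfderiv_eq_fderiv] at h
  unfold coordDeriv
  rw [h]
  rfl

theorem linearIndependent_coordVector {x₀ : M} {u : EuclideanSpace ℝ (Fin n)}
    (hu : u ∈ (extChartAt (𝓡 n) x₀).target) :
    LinearIndependent ℝ (coordVector n x₀ u) := by
  rw [Fintype.linearIndependent_iff]
  intro g hg j
  have h1 : mfderiv (𝓡 n) 𝓘(ℝ, EuclideanSpace ℝ (Fin n))
    (extChartAt (𝓡 n) x₀) ((extChartAt (𝓡 n) x₀).symm u)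
      (∑ i, g i • coordVector n x₀ u i) = ∑ i, g i • EuclideanSpace.single i (1 : ℝ) := by
    rw [map_sum]
    refine Finset.sum_congr rfl fun i _ => ?_
    rw [map_smul]
    congr 1
    exact mfderiv_extChartAt_mfderiv_symm hu _
  rw [hg, map_zero] at h1
  have h2 := congrArg (fun w : EuclideanSpace ℝ (Fin n) => w j) h1
  have h3 : (0 : ℝ) = g j := by
    refine Eq.trans ?_ (h2.trans ?_)
    · rfl
    · simp [Pi.single_apply]
  exact h3.symm

/-- In the tangent bundle trivialization around `x₀` the coordinate field is a constant section.
This is what makes the metric coefficients smooth. -/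
theorem contMDiffOn_coordVector (x₀ : M) (i : Fin n) :
    ContMDiffOn 𝓘(ℝ, EuclideanSpace ℝ (Fin n)) ((𝓡 n).prod 𝓘(ℝ, EuclideanSpace ℝ (Fin n))) ∞
      (fun u => (TotalSpace.mk' (EuclideanSpace ℝ (Fin n)) ((extChartAt (𝓡 n) x₀).symm u)
        (coordVector n x₀ u i) : TotalSpace (EuclideanSpace ℝ (Fin n)) (TangentSpace (𝓡 n) (M := M))))
      (extChartAt (𝓡 n) x₀).target := by
  have : IsManifold (𝓡 n) 1 M := .of_le (n := ∞) (by simp)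
  set e := trivializationAt (EuclideanSpace ℝ (Fin n)) (TangentSpace (𝓡 n) (M := M)) x₀
  have h1 : ContMDiffOn (𝓡 n) ((𝓡 n).prod 𝓘(ℝ, EuclideanSpace ℝ (Fin n))) ∞
      (fun y => (TotalSpace.mk' (EuclideanSpace ℝ (Fin n)) y
        (e.symmL ℝ y (EuclideanSpace.single i (1 : ℝ))) :
          TotalSpace (EuclideanSpace ℝ (Fin n)) (TangentSpace (𝓡 n) (M := M)))) e.baseSet := by
    rw [e.contMDiffOn_section_baseSet_iff]
    apply (contMDiffOn_const (c := EuclideanSpace.single i (1 : ℝ))).congr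
    intro y hy
    simp [hy]
  have h2 := h1.comp (contMDiffOn_extChartAt_symm (n := ∞) x₀) (fun u hu => by
    have := (extChartAt (𝓡 n) x₀).map_target hu
    rwa [extChartAt_source] at this)
  refine h2.congr fun u hu => ?_
  simp only [Function.comp_apply]
  congr 1
  have hs := (extChartAt (𝓡 n) x₀).map_target hu
  rw [extChartAt_source] at hs
  have := TangentBundle.symmL_trivializationAt (I := 𝓡 n) (x₀ := x₀) hs
  unfold coordVector
  have h3 := DFunLike.congr_fun this (EuclideanSpace.single i (1 : ℝ))
  rw [(extChartAt (𝓡 n) x₀).right_inv hu] at h3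
  simp only [modelWithCornersSelf_coe, range_id, mfderivWithin_univ] at h3
  exact h3.symm

variable [RiemannianBundle (fun x : M => TangentSpace (𝓡 n) x)]

theorem metricMatrix_comm (x₀ : M) (u : EuclideanSpace ℝ (Fin n)) (i j : Fin n) :
    metricMatrix n x₀ u i j = metricMatrix n x₀ u j i := by
  exact real_inner_comm (coordVector n x₀ u j) (coordVector n x₀ u i)

theorem posDef_metricMatrix {x₀ : M} {u : EuclideanSpace ℝ (Fin n)}
    (hu : u ∈ (extChartAt (𝓡 n) x₀).target) : (metricMatrix n x₀ u).PosDef :=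
  Matrix.posDef_gram_of_linearIndependent (𝕜 := ℝ) (linearIndependent_coordVector hu)

theorem contDiffOn_metricMatrix [IsContMDiffRiemannianBundle (𝓡 n) ∞ (EuclideanSpace ℝ (Fin n))
      (fun x : M => TangentSpace (𝓡 n) x)] (x₀ : M) (i j : Fin n) :
    ContDiffOn ℝ ∞ (fun u => metricMatrix n x₀ u i j) (extChartAt (𝓡 n) x₀).target := by
  rw [← contMDiffOn_iff_contDiffOn]
  exact ContMDiffOn.inner_bundle (contMDiffOn_coordVector x₀ i) (contMDiffOn_coordVector x₀ j)

end Metric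

/-! ### Smooth dependence of determinants and inverse matrices. -/

section MatrixSmooth

variable {X : Type*} [NormedAddCommGroup X] [NormedSpace ℝ X] {k : WithTop ℕ∞} {m : Type*}
  [Fintype m] [DecidableEq m]

theorem contDiffOn_matrix_det {A : X → Matrix m m ℝ} {s : Set X}
    (h : ∀ i j, ContDiffOn ℝ k (fun x => A x i j) s) : ContDiffOn ℝ k (fun x => (A x).det) s := by
  simp only [Matrix.det_apply]
  refine ContDiffOn.sum fun σ _ => ?_
  have : ContDiffOn ℝ k (fun x => ∏ i, A x (σ i) i) s := contDiffOn_prod fun i _ => h _ _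
  simp only [Units.smul_def, zsmul_eq_mul]
  exact contDiffOn_const.mul this

theorem contDiffOn_matrix_inv {A : X → Matrix m m ℝ} {s : Set X}
    (h : ∀ i j, ContDiffOn ℝ k (fun x => A x i j) s) (h0 : ∀ x ∈ s, (A x).det ≠ 0) (i j : m) :
    ContDiffOn ℝ k (fun x => (A x)⁻¹ i j) s := by
  simp only [Matrix.inv_def, Ring.inverse_eq_inv', Matrix.smul_apply, smul_eq_mul,
    Matrix.adjugate_apply]
  refine ((contDiffOn_matrix_det h).inv h0).mul (contDiffOn_matrix_det fun a b => ?_)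
  by_cases hab : a = j
  · subst hab
    simpa using contDiffOn_const
  · simpa [Matrix.updateRow_ne hab] using h a b

end MatrixSmooth

/-! ### Volume density and gradients in coordinates. -/

section Gradient

variable {n : ℕ} {M : Type*} [TopologicalSpace M]
  [ChartedSpace (EuclideanSpace ℝ (Fin n)) M] [IsManifold (𝓡 n) ∞ M]
  [RiemannianBundle (fun x : M => TangentSpace (𝓡 n) x)]

theorem volumeDensity_pos {x₀ : M} {u : EuclideanSpace ℝ (Fin n)}
    (hu : u ∈ (extChartAt (𝓡 n) x₀).target) : 0 < volumeDensity n x₀ u :=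
  Real.sqrt_pos.2 (posDef_metricMatrix hu).det_pos

theorem contDiffOn_volumeDensity [IsContMDiffRiemannianBundle (𝓡 n) ∞ (EuclideanSpace ℝ (Fin n))
      (fun x : M => TangentSpace (𝓡 n) x)] (x₀ : M) :
    ContDiffOn ℝ ∞ (volumeDensity n x₀) (extChartAt (𝓡 n) x₀).target :=
  (contDiffOn_matrix_det (contDiffOn_metricMatrix x₀)).sqrt
    fun _ hu => (posDef_metricMatrix hu).det_pos.ne'

theorem contDiffOn_inv_metricMatrix
    [IsContMDiffRiemannianBundle (𝓡 n) ∞ (EuclideanSpace ℝ (Fin n))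
      (fun x : M => TangentSpace (𝓡 n) x)] (x₀ : M) (i j : Fin n) :
    ContDiffOn ℝ ∞ (fun u => (metricMatrix n x₀ u)⁻¹ i j) (extChartAt (𝓡 n) x₀).target :=
  contDiffOn_matrix_inv (contDiffOn_metricMatrix x₀)
    (fun _ hu => (posDef_metricMatrix hu).det_pos.ne') i j

theorem inv_metricMatrix_comm (x₀ : M) (u : EuclideanSpace ℝ (Fin n)) (i j : Fin n) :
    (metricMatrix n x₀ u)⁻¹ i j = (metricMatrix n x₀ u)⁻¹ j i := by
  have h : (metricMatrix n x₀ u).transpose = metricMatrix n x₀ u := by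
    ext i j
    exact metricMatrix_comm x₀ u j i
  have h2 := congrFun (congrFun (Matrix.transpose_nonsing_inv (metricMatrix n x₀ u)) i) j
  rw [h] at h2
  rw [← h2]
  rfl

theorem inner_gradient (f : M → ℝ) (x : M) (v : TangentSpace (𝓡 n) x) :
    inner ℝ (gradient n f x) v = mfderiv (𝓡 n) 𝓘(ℝ, ℝ) f x v := by
  simp only [gradient]
  exact InnerProductSpace.toDual_symm_apply

/-- Pairing the gradient with the coordinate fields gives `∂_j f = ∑ k, g_jk v^k`; inverting the
positive definite matrix `g` solves for the components. -/
theorem coord_gradient {f : M → ℝ} {x₀ : M} {u : EuclideanSpace ℝ (Fin n)}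
    (hu : u ∈ (extChartAt (𝓡 n) x₀).target)
    (hf : MDifferentiableAt (𝓡 n) 𝓘(ℝ, ℝ) f ((extChartAt (𝓡 n) x₀).symm u)) (i : Fin n) :
    coord n x₀ _ (gradient n f ((extChartAt (𝓡 n) x₀).symm u)) i =
      ∑ j, (metricMatrix n x₀ u)⁻¹ i j * coordDeriv j (f ∘ (extChartAt (𝓡 n) x₀).symm) u := by
  set v := gradient n f ((extChartAt (𝓡 n) x₀).symm u) with hv
  have h1 : ∀ j, coordDeriv j (f ∘ (extChartAt (𝓡 n) x₀).symm) u =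
      ∑ k, metricMatrix n x₀ u j k * coord n x₀ _ v k := by
    intro j
    rw [← mfderiv_coordVector hu hf j, ← inner_gradient, ← hv]
    conv_lhs => rw [← sum_coord_smul_coordVector hu v]
    rw [sum_inner]
    refine Finset.sum_congr rfl fun k _ => ?_
    rw [real_inner_smul_left, mul_comm, metricMatrix_comm]
    rfl
  have h2 : (metricMatrix n x₀ u).mulVec (fun k => coord n x₀ _ v k) =
      fun j => coordDeriv j (f ∘ (extChartAt (𝓡 n) x₀).symm) u := by
    ext j
    rw [h1 j]
    rfl
  have h3 : IsUnit (metricMatrix n x₀ u).det := (posDef_metricMatrix hu).det_pos.ne'.isUnit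
  have h4 : (fun k => coord n x₀ _ v k) = (metricMatrix n x₀ u)⁻¹.mulVec
      fun j => coordDeriv j (f ∘ (extChartAt (𝓡 n) x₀).symm) u := by
    rw [← h2, Matrix.mulVec_mulVec, Matrix.nonsing_inv_mul _ h3, Matrix.one_mulVec]
  exact congrFun h4 i

theorem inner_gradient_gradient {f h : M → ℝ} {x₀ : M} {u : EuclideanSpace ℝ (Fin n)}
    (hu : u ∈ (extChartAt (𝓡 n) x₀).target)
    (hf : MDifferentiableAt (𝓡 n) 𝓘(ℝ, ℝ) f ((extChartAt (𝓡 n) x₀).symm u))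
    (hh : MDifferentiableAt (𝓡 n) 𝓘(ℝ, ℝ) h ((extChartAt (𝓡 n) x₀).symm u)) :
    inner ℝ (gradient n f ((extChartAt (𝓡 n) x₀).symm u))
      (gradient n h ((extChartAt (𝓡 n) x₀).symm u)) =
      ∑ i, ∑ j, (metricMatrix n x₀ u)⁻¹ i j * coordDeriv i (f ∘ (extChartAt (𝓡 n) x₀).symm) u *
        coordDeriv j (h ∘ (extChartAt (𝓡 n) x₀).symm) u := by
  rw [← sum_coord_smul_coordVector hu (gradient n h ((extChartAt (𝓡 n) x₀).symm u)), inner_sum]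
  refine Finset.sum_congr rfl fun i _ => ?_
  rw [real_inner_smul_right, inner_gradient, mfderiv_coordVector hu hf, coord_gradient hu hh,
    Finset.sum_mul]
  exact Finset.sum_congr rfl fun j _ => by ring

end Gradient

/-! ### Partial derivatives in `ℝⁿ`, with parameters. -/

section CoordDeriv

variable {n : ℕ} {f g : EuclideanSpace ℝ (Fin n) → ℝ} {u : EuclideanSpace ℝ (Fin n)}

theorem coordDeriv_congr (k : Fin n) (h : f =ᶠ[nhds u] g) : coordDeriv k f u = coordDeriv k g u := by
  simp only [coordDeriv, h.fderiv_eq]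

theorem coordDeriv_mul (k : Fin n) (hf : DifferentiableAt ℝ f u) (hg : DifferentiableAt ℝ g u) :
    coordDeriv k (fun w => f w * g w) u = coordDeriv k f u * g u + f u * coordDeriv k g u := by
  simp only [coordDeriv]
  rw [fderiv_fun_mul hf hg]
  simp
  ring

theorem coordDeriv_sum {ι : Type*} (s : Finset ι) {F : ι → EuclideanSpace ℝ (Fin n) → ℝ}
    (k : Fin n) (hF : ∀ i ∈ s, DifferentiableAt ℝ (F i) u) :
    coordDeriv k (fun w => ∑ i ∈ s, F i w) u = ∑ i ∈ s, coordDeriv k (F i) u := by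
  simp only [coordDeriv]
  rw [fderiv_fun_sum hF]
  simp

theorem contDiffOn_coordDeriv {T : Set (EuclideanSpace ℝ (Fin n))} (hT : IsOpen T)
    (hf : ContDiffOn ℝ ∞ f T) (k : Fin n) : ContDiffOn ℝ ∞ (coordDeriv k f) T :=
  (hf.fderiv_of_isOpen hT (m := ∞) (by simp)).clm_apply contDiffOn_const

theorem coordDeriv_comm {T : Set (EuclideanSpace ℝ (Fin n))} (hT : IsOpen T)
    (hf : ContDiffOn ℝ ∞ f T) (hu : u ∈ T) (i j : Fin n) :
    coordDeriv i (coordDeriv j f) u = coordDeriv j (coordDeriv i f) u := by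
  have h1 : ContDiffAt ℝ ∞ f u := hf.contDiffAt (hT.mem_nhds hu)
  have h2 : DifferentiableAt ℝ (fderiv ℝ f) u :=
    (h1.fderiv_right (m := ∞) (by simp)).differentiableAt (by simp)
  have h3 : ∀ i j : Fin n, coordDeriv i (coordDeriv j f) u =
      fderiv ℝ (fderiv ℝ f) u (EuclideanSpace.single i 1) (EuclideanSpace.single j 1) := by
    intro i j
    unfold coordDeriv
    rw [fderiv_clm_apply h2 (differentiableAt_const _)]
    simp
  rw [h3, h3]
  exact (h1.isSymmSndFDerivAt
    (by rw [minSmoothness_of_isRCLikeNormedField]; exact ENat.LEInfty.out)) _ _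

variable {P : Type*} [NormedAddCommGroup P] [NormedSpace ℝ P]

theorem coordDeriv_slice {c : P × EuclideanSpace ℝ (Fin n) → ℝ} {p : P}
    (hc : DifferentiableAt ℝ c (p, u)) (k : Fin n) :
    coordDeriv k (fun w => c (p, w)) u = fderiv ℝ c (p, u) (0, EuclideanSpace.single k 1) := by
  have h : HasFDerivAt (fun w => c (p, w)) ((fderiv ℝ c (p, u)).comp
      (ContinuousLinearMap.inr ℝ P (EuclideanSpace ℝ (Fin n)))) u :=
    hc.hasFDerivAt.comp u (hasFDerivAt_prodMk_right p u)
  simp only [coordDeriv, h.fderiv]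
  simp

theorem deriv_slice {c : ℝ × EuclideanSpace ℝ (Fin n) → ℝ} {t : ℝ}
    (hc : DifferentiableAt ℝ c (t, u)) :
    HasDerivAt (fun s => c (s, u)) (fderiv ℝ c (t, u) (1, 0)) t := by
  have h : HasFDerivAt (fun s => c (s, u)) ((fderiv ℝ c (t, u)).comp
      (ContinuousLinearMap.inl ℝ ℝ (EuclideanSpace ℝ (Fin n)))) t :=
    hc.hasFDerivAt.comp t (hasFDerivAt_prodMk_left t u)
  have := h.hasDerivAt
  simpa using this

theorem contDiffOn_coordDeriv_slice {U : Set P} {T : Set (EuclideanSpace ℝ (Fin n))}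
    (hU : IsOpen U) (hT : IsOpen T) {c : P × EuclideanSpace ℝ (Fin n) → ℝ}
    (hc : ContDiffOn ℝ ∞ c (U ×ˢ T)) (k : Fin n) :
    ContDiffOn ℝ ∞ (fun q : P × EuclideanSpace ℝ (Fin n) =>
      coordDeriv k (fun w => c (q.1, w)) q.2) (U ×ˢ T) := by
  have h : ContDiffOn ℝ ∞ (fun q => fderiv ℝ c q (0, EuclideanSpace.single k 1)) (U ×ˢ T) :=
    (hc.fderiv_of_isOpen (hU.prod hT) (m := ∞) (by simp)).clm_apply contDiffOn_const
  refine h.congr fun q hq => ?_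
  exact coordDeriv_slice ((hc.contDiffAt ((hU.prod hT).mem_nhds hq)).differentiableAt (by simp)) k

theorem contDiffOn_deriv_slice {U : Set ℝ} {T : Set (EuclideanSpace ℝ (Fin n))}
    (hU : IsOpen U) (hT : IsOpen T) {c : ℝ × EuclideanSpace ℝ (Fin n) → ℝ}
    (hc : ContDiffOn ℝ ∞ c (U ×ˢ T)) :
    ContDiffOn ℝ ∞ (fun q : ℝ × EuclideanSpace ℝ (Fin n) =>
      deriv (fun s => c (s, q.2)) q.1) (U ×ˢ T) := by
  have h : ContDiffOn ℝ ∞ (fun q => fderiv ℝ c q (1, 0)) (U ×ˢ T) :=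
    (hc.fderiv_of_isOpen (hU.prod hT) (m := ∞) (by simp)).clm_apply contDiffOn_const
  refine h.congr fun q hq => ?_
  exact (deriv_slice
    ((hc.contDiffAt ((hU.prod hT).mem_nhds hq)).differentiableAt (by simp))).deriv

/-- Time and space derivatives commute: both orders are the same second derivative of `c` on the
product, evaluated at `(1, 0)` and `(0, e_k)`. -/
theorem hasDerivAt_coordDeriv {U : Set ℝ} {T : Set (EuclideanSpace ℝ (Fin n))}
    (hU : IsOpen U) (hT : IsOpen T) {c : ℝ × EuclideanSpace ℝ (Fin n) → ℝ}
    (hc : ContDiffOn ℝ ∞ c (U ×ˢ T)) {t : ℝ} (ht : t ∈ U) (hu : u ∈ T) (k : Fin n) :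
    HasDerivAt (fun s => coordDeriv k (fun w => c (s, w)) u)
      (coordDeriv k (fun w => deriv (fun s => c (s, w)) t) u) t := by
  have hopen := hU.prod hT
  have hd : ∀ q ∈ U ×ˢ T, DifferentiableAt ℝ c q := fun q hq =>
    (hc.contDiffAt (hopen.mem_nhds hq)).differentiableAt (by simp)
  have h1 : ContDiffAt ℝ ∞ c (t, u) := hc.contDiffAt (hopen.mem_nhds ⟨ht, hu⟩)
  have h2 : DifferentiableAt ℝ (fderiv ℝ c) (t, u) :=
    (h1.fderiv_right (m := ∞) (by simp)).differentiableAt (by simp)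
  have h3 : DifferentiableAt ℝ (fun q => fderiv ℝ c q (0, EuclideanSpace.single k 1)) (t, u) :=
    h2.clm_apply (differentiableAt_const _)
  have h4 : DifferentiableAt ℝ (fun q => fderiv ℝ c q (1, 0)) (t, u) :=
    h2.clm_apply (differentiableAt_const _)
  have e1 : coordDeriv k (fun w => deriv (fun s => c (s, w)) t) u =
      coordDeriv k (fun w => fderiv ℝ c (t, w) (1, 0)) u := by
    apply coordDeriv_congr
    filter_upwards [hT.mem_nhds hu] with w hw
    exact (deriv_slice (hd (t, w) ⟨ht, hw⟩)).deriv
  rw [e1, coordDeriv_slice h4]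
  have h5 := deriv_slice h3
  have e2 : fderiv ℝ (fun q => fderiv ℝ c q (0, EuclideanSpace.single k 1)) (t, u) (1, 0) =
      fderiv ℝ (fun q => fderiv ℝ c q (1, 0)) (t, u) (0, EuclideanSpace.single k 1) := by
    rw [fderiv_clm_apply h2 (differentiableAt_const _), fderiv_clm_apply h2 (differentiableAt_const _)]
    simpa using (h1.isSymmSndFDerivAt
    (by rw [minSmoothness_of_isRCLikeNormedField]; exact ENat.LEInfty.out)) _ _
  rw [e2] at h5
  refine h5.congr_of_eventuallyEq ?_
  filter_upwards [hU.mem_nhds ht] with s hs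
  exact coordDeriv_slice (hd (s, u) ⟨hs, hu⟩) k

end CoordDeriv

/-! ### Algebra and time derivatives of smooth families. -/

section Families

variable {n : ℕ} {M : Type*} [TopologicalSpace M]
  [ChartedSpace (EuclideanSpace ℝ (Fin n)) M]
  {P : Type*} [NormedAddCommGroup P] [NormedSpace ℝ P] {U : Set P} {c d : P → M → ℝ}

theorem IsSmooth.isSmoothFamily {f : M → ℝ} (hf : IsSmooth n f) (U : Set P) :
    IsSmoothFamily n U (fun _ => f) :=
  (ContMDiff.comp hf contMDiff_snd).contMDiffOn

theorem IsSmoothFamily.isSmooth (hc : IsSmoothFamily n U c) {p : P} (hp : p ∈ U) :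
    IsSmooth n (c p) := by
  have h : ContMDiff (𝓡 n) (𝓘(ℝ, P).prod (𝓡 n)) ∞ (fun x : M => (p, x)) :=
    contMDiff_const.prodMk contMDiff_id
  have := ContMDiffOn.comp_contMDiff hc h (fun x => ⟨hp, mem_univ _⟩)
  exact this

theorem IsSmoothFamily.mono (hc : IsSmoothFamily n U c) {V : Set P} (h : V ⊆ U) :
    IsSmoothFamily n V c :=
  ContMDiffOn.mono hc (prod_mono h subset_rfl)

theorem IsSmoothFamily.add (hc : IsSmoothFamily n U c) (hd : IsSmoothFamily n U d) :
    IsSmoothFamily n U (fun p => c p + d p) :=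
  ContMDiffOn.add hc hd

theorem IsSmoothFamily.mul (hc : IsSmoothFamily n U c) (hd : IsSmoothFamily n U d) :
    IsSmoothFamily n U (fun p => c p * d p) :=
  ContMDiffOn.mul hc hd

theorem isSmoothFamily_of_contDiffOn {a : P → ℝ} (ha : ContDiffOn ℝ ∞ a U) :
    IsSmoothFamily n U (fun p (_ : M) => a p) :=
  ContMDiffOn.comp (t := U) ha.contMDiffOn contMDiffOn_fst (fun _ hq => hq.1)

theorem IsSmoothFamily.smul {a : P → ℝ} (ha : ContDiffOn ℝ ∞ a U) (hc : IsSmoothFamily n U c) :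
    IsSmoothFamily n U (fun p => a p • c p) :=
  (isSmoothFamily_of_contDiffOn ha).mul hc

theorem IsSmoothFamily.comp {Q : Type*} [NormedAddCommGroup Q] [NormedSpace ℝ Q] {V : Set Q}
    (hc : IsSmoothFamily n U c) {γ : Q → P} (hγ : ContDiffOn ℝ ∞ γ V) (hm : MapsTo γ V U) :
    IsSmoothFamily n V (fun q => c (γ q)) := by
  have h1 : ContMDiffOn (𝓘(ℝ, Q).prod (𝓡 n)) (𝓘(ℝ, P).prod (𝓡 n)) ∞
      (fun q : Q × M => (γ q.1, q.2)) (V ×ˢ univ) :=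
    (ContMDiffOn.comp (t := V) hγ.contMDiffOn contMDiffOn_fst (fun _ hq => hq.1)).prodMk
      contMDiffOn_snd
  exact ContMDiffOn.comp hc h1 (fun q hq => ⟨hm hq.1, mem_univ _⟩)

theorem IsSmoothFamily.contDiffOn_eval (hc : IsSmoothFamily n U c) (x : M) :
    ContDiffOn ℝ ∞ (fun p => c p x) U := by
  rw [← contMDiffOn_iff_contDiffOn]
  exact ContMDiffOn.comp (g := fun q : P × M => c q.1 q.2) hc
    (contMDiffOn_id.prodMk contMDiffOn_const) (fun p hp => ⟨hp, mem_univ _⟩)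

theorem IsSmoothFamily.continuousOn (hc : IsSmoothFamily n U c) :
    ContinuousOn (fun q : P × M => c q.1 q.2) (U ×ˢ univ) :=
  ContMDiffOn.continuousOn hc

theorem IsSmooth.continuous {f : M → ℝ} (hf : IsSmooth n f) : Continuous f :=
  ContMDiff.continuous hf

theorem IsSmooth.add {f g : M → ℝ} (hf : IsSmooth n f) (hg : IsSmooth n g) : IsSmooth n (f + g) :=
  ContMDiff.add hf hg

theorem IsSmooth.sub {f g : M → ℝ} (hf : IsSmooth n f) (hg : IsSmooth n g) : IsSmooth n (f - g) :=
  ContMDiff.sub hf hg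

theorem IsSmooth.mul {f g : M → ℝ} (hf : IsSmooth n f) (hg : IsSmooth n g) : IsSmooth n (f * g) :=
  ContMDiff.mul hf hg

theorem IsSmooth.smul {f : M → ℝ} (hf : IsSmooth n f) (a : ℝ) : IsSmooth n (a • f) :=
  ContMDiff.mul (contMDiff_const (c := a)) hf

theorem isSmooth_const (a : ℝ) : IsSmooth n (fun _ : M => a) :=
  contMDiff_const

theorem IsSmooth.mdifferentiableAt {f : M → ℝ} (hf : IsSmooth n f) (x : M) :
    MDifferentiableAt (𝓡 n) 𝓘(ℝ, ℝ) f x :=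
  ContMDiff.mdifferentiableAt hf (by simp)

/-- The pointwise partial derivative `∂_t c_t` of a one-parameter family of functions. -/
def familyDeriv (c : ℝ → M → ℝ) (t : ℝ) (x : M) : ℝ := deriv (fun s => c s x) t

theorem IsSmoothFamily.hasDerivAt {U : Set ℝ} {c : ℝ → M → ℝ} (hU : IsOpen U)
    (hc : IsSmoothFamily n U c) {t : ℝ} (ht : t ∈ U) (x : M) :
    HasDerivAt (fun s => c s x) (familyDeriv c t x) t :=
  (((hc.contDiffOn_eval x).contDiffAt (hU.mem_nhds ht)).differentiableAt (by simp)).hasDerivAt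

variable [IsManifold (𝓡 n) ∞ M]

theorem IsSmoothFamily.familyDeriv {U : Set ℝ} {c : ℝ → M → ℝ} (hU : IsOpen U)
    (hc : IsSmoothFamily n U c) : IsSmoothFamily n U (familyDeriv c) := by
  rw [isSmoothFamily_iff hU] at hc ⊢
  exact fun x₀ => contDiffOn_deriv_slice hU (isOpen_extChartAt_target x₀) (hc x₀)

end Families

/-! ### The carré du champ `⟪∇f, ∇h⟫`. -/

section GradInner

variable {n : ℕ} {M : Type*} [TopologicalSpace M]
  [ChartedSpace (EuclideanSpace ℝ (Fin n)) M]
  [RiemannianBundle (fun x : M => TangentSpace (𝓡 n) x)]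

variable (n) in
/-- The pointwise inner product `⟪∇f, ∇h⟫` of two gradients. -/
def gradInner (f h : M → ℝ) (x : M) : ℝ := inner ℝ (gradient n f x) (gradient n h x)

theorem gradInner_comm (f h : M → ℝ) : gradInner n f h = gradInner n h f :=
  funext fun x => real_inner_comm (gradient n h x) (gradient n f x)

theorem gradInner_self_eq (f : M → ℝ) (x : M) : gradInner n f f x = ‖gradient n f x‖ ^ 2 :=
  real_inner_self_eq_norm_sq (gradient n f x)

theorem gradient_add {f h : M → ℝ} (hf : IsSmooth n f) (hh : IsSmooth n h) (x : M) :
    gradient n (f + h) x = gradient n f x + gradient n h x := by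
  unfold gradient
  rw [mfderiv_add (hf.mdifferentiableAt x) (hh.mdifferentiableAt x)]
  exact map_add _ _ _

theorem gradient_smul {f : M → ℝ} (hf : IsSmooth n f) (a : ℝ) (x : M) :
    gradient n (a • f) x = a • gradient n f x := by
  unfold gradient
  rw [const_smul_mfderiv (hf.mdifferentiableAt x)]
  exact map_smulₛₗ (InnerProductSpace.toDual ℝ (TangentSpace (𝓡 n) x)).symm a _

theorem gradInner_add_left {f g h : M → ℝ} (hf : IsSmooth n f) (hg : IsSmooth n g) :
    gradInner n (f + g) h = gradInner n f h + gradInner n g h := by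
  ext x
  simp only [gradInner, gradient_add hf hg, Pi.add_apply]
  exact inner_add_left _ _ _

theorem gradInner_smul_left {f h : M → ℝ} (hf : IsSmooth n f) (a : ℝ) :
    gradInner n (a • f) h = a • gradInner n f h := by
  ext x
  simp only [gradInner, gradient_smul hf, Pi.smul_apply]
  exact real_inner_smul_left _ _ _

theorem gradInner_add_right {f g h : M → ℝ} (hf : IsSmooth n f) (hg : IsSmooth n g) :
    gradInner n h (f + g) = gradInner n h f + gradInner n h g := by
  rw [gradInner_comm, gradInner_add_left hf hg, gradInner_comm f, gradInner_comm g]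

theorem gradInner_smul_right {f h : M → ℝ} (hf : IsSmooth n f) (a : ℝ) :
    gradInner n h (a • f) = a • gradInner n h f := by
  rw [gradInner_comm, gradInner_smul_left hf, gradInner_comm f]

theorem gradInner_const_left (a : ℝ) (h : M → ℝ) : gradInner n (fun _ => a) h = 0 := by
  ext x
  simp only [gradInner]
  have : gradient n (fun _ : M => a) x = 0 := by
    unfold gradient
    rw [mfderiv_const]
    exact map_zero _
  rw [this]
  exact inner_zero_left _

variable [IsManifold (𝓡 n) ∞ M]

theorem gradInner_chart {f h : M → ℝ} (hf : IsSmooth n f) (hh : IsSmooth n h) {x₀ : M}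
    {u : EuclideanSpace ℝ (Fin n)} (hu : u ∈ (extChartAt (𝓡 n) x₀).target) :
    gradInner n f h ((extChartAt (𝓡 n) x₀).symm u) =
      ∑ i, ∑ j, (metricMatrix n x₀ u)⁻¹ i j * coordDeriv i (f ∘ (extChartAt (𝓡 n) x₀).symm) u *
        coordDeriv j (h ∘ (extChartAt (𝓡 n) x₀).symm) u :=
  inner_gradient_gradient hu (hf.mdifferentiableAt _) (hh.mdifferentiableAt _)

variable [IsContMDiffRiemannianBundle (𝓡 n) ∞ (EuclideanSpace ℝ (Fin n))
      (fun x : M => TangentSpace (𝓡 n) x)]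
  {P : Type*} [NormedAddCommGroup P] [NormedSpace ℝ P] {U : Set P} {c d : P → M → ℝ}

theorem IsSmoothFamily.gradInner (hU : IsOpen U) (hc : IsSmoothFamily n U c)
    (hd : IsSmoothFamily n U d) : IsSmoothFamily n U (fun p => gradInner n (c p) (d p)) := by
  rw [isSmoothFamily_iff hU]
  intro x₀
  have hT := isOpen_extChartAt_target (I := 𝓡 n) x₀
  have h1 : ContDiffOn ℝ ∞ (fun q : P × EuclideanSpace ℝ (Fin n) =>
      ∑ i, ∑ j, (metricMatrix n x₀ q.2)⁻¹ i j *
        coordDeriv i (fun w => c q.1 ((extChartAt (𝓡 n) x₀).symm w)) q.2 *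
        coordDeriv j (fun w => d q.1 ((extChartAt (𝓡 n) x₀).symm w)) q.2)
      (U ×ˢ (extChartAt (𝓡 n) x₀).target) := by
    refine ContDiffOn.sum fun i _ => ContDiffOn.sum fun j _ => ?_
    refine ContDiffOn.mul (ContDiffOn.mul ?_ ?_) ?_
    · exact (contDiffOn_inv_metricMatrix x₀ i j).comp contDiff_snd.contDiffOn (fun q hq => hq.2)
    · exact contDiffOn_coordDeriv_slice hU hT ((isSmoothFamily_iff hU).1 hc x₀) i
    · exact contDiffOn_coordDeriv_slice hU hT ((isSmoothFamily_iff hU).1 hd x₀) j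
  exact h1.congr fun q hq => gradInner_chart (hc.isSmooth hq.1) (hd.isSmooth hq.1) hq.2

theorem IsSmooth.gradInner {f h : M → ℝ} (hf : IsSmooth n f) (hh : IsSmooth n h) :
    IsSmooth n (gradInner n f h) :=
  (IsSmoothFamily.gradInner isOpen_univ (hf.isSmoothFamily (univ : Set ℝ))
    (hh.isSmoothFamily univ)).isSmooth (mem_univ 0)

/-- In the fixed chart around `x` only the coordinate partials depend on time, so this is the
product rule together with `hasDerivAt_coordDeriv`. -/
theorem hasDerivAt_gradInner {U : Set ℝ} {c d : ℝ → M → ℝ} (hU : IsOpen U)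
    (hc : IsSmoothFamily n U c) (hd : IsSmoothFamily n U d) {t : ℝ} (ht : t ∈ U) (x : M) :
    HasDerivAt (fun s => HopfCole.gradInner n (c s) (d s) x)
      (HopfCole.gradInner n (familyDeriv c t) (d t) x
        + HopfCole.gradInner n (c t) (familyDeriv d t) x) t := by
  set u := extChartAt (𝓡 n) x x with hu_def
  have hu : u ∈ (extChartAt (𝓡 n) x).target := mem_extChartAt_target x
  have hx : (extChartAt (𝓡 n) x).symm u = x := extChartAt_to_inv x
  have hT := isOpen_extChartAt_target (I := 𝓡 n) x
  have key : ∀ {f h : M → ℝ}, IsSmooth n f → IsSmooth n h → HopfCole.gradInner n f h x =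
      ∑ i, ∑ j, (metricMatrix n x u)⁻¹ i j * coordDeriv i (f ∘ (extChartAt (𝓡 n) x).symm) u *
        coordDeriv j (h ∘ (extChartAt (𝓡 n) x).symm) u := by
    intro f h hf hh
    rw [← gradInner_chart hf hh hu, hx]
  have hc' := (hc.familyDeriv hU).isSmooth ht
  have hd' := (hd.familyDeriv hU).isSmooth ht
  rw [key hc' (hd.isSmooth ht), key (hc.isSmooth ht) hd', ← Finset.sum_add_distrib]
  have h0 : HasDerivAt (fun s => ∑ i, ∑ j, (metricMatrix n x u)⁻¹ i j *
      coordDeriv i (c s ∘ (extChartAt (𝓡 n) x).symm) u *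
        coordDeriv j (d s ∘ (extChartAt (𝓡 n) x).symm) u)
      (∑ i, (∑ j, (metricMatrix n x u)⁻¹ i j *
        coordDeriv i (HopfCole.familyDeriv c t ∘ (extChartAt (𝓡 n) x).symm) u *
        coordDeriv j (d t ∘ (extChartAt (𝓡 n) x).symm) u +
        ∑ j, (metricMatrix n x u)⁻¹ i j *
        coordDeriv i (c t ∘ (extChartAt (𝓡 n) x).symm) u *
        coordDeriv j (HopfCole.familyDeriv d t ∘ (extChartAt (𝓡 n) x).symm) u)) t := by
    refine HasDerivAt.fun_sum fun i _ => ?_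
    rw [← Finset.sum_add_distrib]
    refine HasDerivAt.fun_sum fun j _ => ?_
    have h1 := hasDerivAt_coordDeriv hU hT ((isSmoothFamily_iff hU).1 hc x) ht hu i
    have h2 := hasDerivAt_coordDeriv hU hT ((isSmoothFamily_iff hU).1 hd x) ht hu j
    exact (h1.const_mul _).mul h2
  refine h0.congr_of_eventuallyEq ?_
  filter_upwards [hU.mem_nhds ht] with s hs
  exact key (hc.isSmooth hs) (hd.isSmooth hs)

end GradInner

/-! ### The Hessian in terms of the carré du champ. -/

section Hessian

variable {n : ℕ} {M : Type*} [TopologicalSpace M]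
  [ChartedSpace (EuclideanSpace ℝ (Fin n)) M] [IsManifold (𝓡 n) ∞ M]
  [RiemannianBundle (fun x : M => TangentSpace (𝓡 n) x)]
  [IsContMDiffRiemannianBundle (𝓡 n) ∞ (EuclideanSpace ℝ (Fin n))
      (fun x : M => TangentSpace (𝓡 n) x)]

variable (n) in
/-- The components of the gradient of `f` in the chart around `x₀`. -/
def gradCoord (x₀ : M) (f : M → ℝ) (u : EuclideanSpace ℝ (Fin n)) (i : Fin n) : ℝ :=
  ∑ j, (metricMatrix n x₀ u)⁻¹ i j * coordDeriv j (f ∘ (extChartAt (𝓡 n) x₀).symm) u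

theorem contDiffOn_gradCoord (x₀ : M) {f : M → ℝ} (hf : IsSmooth n f) (i : Fin n) :
    ContDiffOn ℝ ∞ (fun u => gradCoord n x₀ f u i) (extChartAt (𝓡 n) x₀).target :=
  ContDiffOn.sum fun j _ => (contDiffOn_inv_metricMatrix x₀ i j).mul
    (contDiffOn_coordDeriv (isOpen_extChartAt_target x₀) (isSmooth_iff.1 hf x₀) j)

theorem sum_metricMatrix_gradCoord {x₀ : M} {u : EuclideanSpace ℝ (Fin n)}
    (hu : u ∈ (extChartAt (𝓡 n) x₀).target) (f : M → ℝ) (j : Fin n) :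
    ∑ i, metricMatrix n x₀ u j i * gradCoord n x₀ f u i =
      coordDeriv j (f ∘ (extChartAt (𝓡 n) x₀).symm) u := by
  have h3 : IsUnit (metricMatrix n x₀ u).det := (posDef_metricMatrix hu).det_pos.ne'.isUnit
  have h : (metricMatrix n x₀ u).mulVec ((metricMatrix n x₀ u)⁻¹.mulVec
      fun j => coordDeriv j (f ∘ (extChartAt (𝓡 n) x₀).symm) u) =
      fun j => coordDeriv j (f ∘ (extChartAt (𝓡 n) x₀).symm) u := by
    rw [Matrix.mulVec_mulVec, Matrix.mul_nonsing_inv _ h3, Matrix.one_mulVec]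
  exact congrFun h j

theorem gradInner_eq_sum_gradCoord {f h : M → ℝ} (hf : IsSmooth n f) (hh : IsSmooth n h) {x₀ : M}
    {u : EuclideanSpace ℝ (Fin n)} (hu : u ∈ (extChartAt (𝓡 n) x₀).target) :
    gradInner n f h ((extChartAt (𝓡 n) x₀).symm u) =
      ∑ i, coordDeriv i (f ∘ (extChartAt (𝓡 n) x₀).symm) u * gradCoord n x₀ h u i := by
  rw [gradInner_chart hf hh hu]
  refine Finset.sum_congr rfl fun i _ => ?_
  rw [gradCoord, Finset.mul_sum]
  exact Finset.sum_congr rfl fun j _ => by ring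

/-- Product rule for `∑ i, ∂_i f h^i`. Writing `∂_i f = ∑ j, g_ij f^j` in the second group of terms
leaves only derivatives of the metric itself, never of its inverse. -/
theorem coordDeriv_gradInner {f h : M → ℝ} (hf : IsSmooth n f) (hh : IsSmooth n h) {x₀ : M}
    {u : EuclideanSpace ℝ (Fin n)} (hu : u ∈ (extChartAt (𝓡 n) x₀).target) (k : Fin n) :
    coordDeriv k (gradInner n f h ∘ (extChartAt (𝓡 n) x₀).symm) u =
      ∑ i, coordDeriv k (coordDeriv i (f ∘ (extChartAt (𝓡 n) x₀).symm)) u * gradCoord n x₀ h u i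
      + ∑ j, coordDeriv k (coordDeriv j (h ∘ (extChartAt (𝓡 n) x₀).symm)) u * gradCoord n x₀ f u j
      - ∑ j, ∑ i, coordDeriv k (fun w => metricMatrix n x₀ w j i) u *
          gradCoord n x₀ f u j * gradCoord n x₀ h u i := by
  have hT := isOpen_extChartAt_target (I := 𝓡 n) x₀
  have hnhds := hT.mem_nhds hu
  have hdiff : ∀ {g : EuclideanSpace ℝ (Fin n) → ℝ},
      ContDiffOn ℝ ∞ g (extChartAt (𝓡 n) x₀).target → DifferentiableAt ℝ g u :=
    fun hg => (hg.contDiffAt hnhds).differentiableAt (by simp)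
  have hfd : ∀ i, DifferentiableAt ℝ (coordDeriv i (f ∘ (extChartAt (𝓡 n) x₀).symm)) u :=
    fun i => hdiff (contDiffOn_coordDeriv hT (isSmooth_iff.1 hf x₀) i)
  have hgc : ∀ i, DifferentiableAt ℝ (fun w => gradCoord n x₀ h w i) u :=
    fun i => hdiff (contDiffOn_gradCoord x₀ hh i)
  have hG : ∀ i j, DifferentiableAt ℝ (fun w => metricMatrix n x₀ w i j) u :=
    fun i j => hdiff (contDiffOn_metricMatrix x₀ i j)
  have e1 : coordDeriv k (gradInner n f h ∘ (extChartAt (𝓡 n) x₀).symm) u =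
      ∑ i, (coordDeriv k (coordDeriv i (f ∘ (extChartAt (𝓡 n) x₀).symm)) u * gradCoord n x₀ h u i
      + coordDeriv i (f ∘ (extChartAt (𝓡 n) x₀).symm) u *
        coordDeriv k (fun w => gradCoord n x₀ h w i) u) := by
    rw [coordDeriv_congr (g := fun w => ∑ i, coordDeriv i (f ∘ (extChartAt (𝓡 n) x₀).symm) w *
      gradCoord n x₀ h w i) k (by
        filter_upwards [hnhds] with w hw
        exact gradInner_eq_sum_gradCoord hf hh hw)]
    rw [coordDeriv_sum _ _ fun i _ => (hfd i).fun_mul (hgc i)]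
    exact Finset.sum_congr rfl fun i _ => coordDeriv_mul k (hfd i) (hgc i)
  have e2 : ∀ j, ∑ i, metricMatrix n x₀ u j i * coordDeriv k (fun w => gradCoord n x₀ h w i) u =
      coordDeriv k (coordDeriv j (h ∘ (extChartAt (𝓡 n) x₀).symm)) u -
      ∑ i, coordDeriv k (fun w => metricMatrix n x₀ w j i) u * gradCoord n x₀ h u i := by
    intro j
    rw [coordDeriv_congr (f := coordDeriv j (h ∘ (extChartAt (𝓡 n) x₀).symm))
      (g := fun w => ∑ i, metricMatrix n x₀ w j i * gradCoord n x₀ h w i) k (by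
        filter_upwards [hnhds] with w hw
        exact (sum_metricMatrix_gradCoord hw h j).symm)]
    rw [coordDeriv_sum _ _ fun i _ => (hG j i).fun_mul (hgc i), ← Finset.sum_sub_distrib]
    refine Finset.sum_congr rfl fun i _ => ?_
    rw [coordDeriv_mul k (hG j i) (hgc i)]
    ring
  rw [e1, Finset.sum_add_distrib, add_sub_assoc]
  congr 1
  calc ∑ i, coordDeriv i (f ∘ (extChartAt (𝓡 n) x₀).symm) u *
        coordDeriv k (fun w => gradCoord n x₀ h w i) u
      = ∑ i, ∑ j, metricMatrix n x₀ u i j * gradCoord n x₀ f u j *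
        coordDeriv k (fun w => gradCoord n x₀ h w i) u := by
        refine Finset.sum_congr rfl fun i _ => ?_
        rw [← sum_metricMatrix_gradCoord hu f i, Finset.sum_mul]
    _ = ∑ j, gradCoord n x₀ f u j * ∑ i, metricMatrix n x₀ u j i *
          coordDeriv k (fun w => gradCoord n x₀ h w i) u := by
        rw [Finset.sum_comm]
        refine Finset.sum_congr rfl fun j _ => ?_
        rw [Finset.mul_sum]
        refine Finset.sum_congr rfl fun i _ => ?_
        rw [metricMatrix_comm x₀ u i j]
        ring
    _ = _ := by
        rw [← Finset.sum_sub_distrib]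
        refine Finset.sum_congr rfl fun j _ => ?_
        rw [e2, mul_sub, Finset.mul_sum]
        congr 1
        · ring
        · exact Finset.sum_congr rfl fun i _ => by ring

/-- Contracted twice with the same vector, the first two of the three metric derivatives in the
Christoffel symbol coincide after exchanging `i` and `j`; together they cancel the factor `1/2`. -/
theorem sum_sum_sum_christoffel {x₀ : M} {u : EuclideanSpace ℝ (Fin n)} (f : M → ℝ)
    (v : Fin n → ℝ) :
    ∑ i, ∑ j, (∑ k, christoffel n x₀ u k i j *
      coordDeriv k (f ∘ (extChartAt (𝓡 n) x₀).symm) u) * v i * v j =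
    ∑ k, ∑ j, ∑ i, coordDeriv k (fun w => metricMatrix n x₀ w j i) u *
        gradCoord n x₀ f u j * v i * v k
    - (1 / 2) * ∑ k, ∑ j, ∑ i, coordDeriv k (fun w => metricMatrix n x₀ w j i) u *
        v j * v i * gradCoord n x₀ f u k := by
  have h1 : ∀ i j, ∑ k, christoffel n x₀ u k i j *
      coordDeriv k (f ∘ (extChartAt (𝓡 n) x₀).symm) u =
      (1 / 2) * ∑ l, gradCoord n x₀ f u l * (coordDeriv i (fun w => metricMatrix n x₀ w j l) u
      + coordDeriv j (fun w => metricMatrix n x₀ w i l) u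
      - coordDeriv l (fun w => metricMatrix n x₀ w i j) u) := by
    intro i j
    simp only [christoffel, gradCoord, Finset.mul_sum, Finset.sum_mul]
    rw [Finset.sum_comm]
    refine Finset.sum_congr rfl fun l _ => Finset.sum_congr rfl fun k _ => ?_
    rw [inv_metricMatrix_comm x₀ u l k]
    ring
  have hA : ∑ i, ∑ j, ∑ l, gradCoord n x₀ f u l *
      coordDeriv i (fun w => metricMatrix n x₀ w j l) u * v i * v j =
      ∑ k, ∑ j, ∑ i, coordDeriv k (fun w => metricMatrix n x₀ w j i) u *
        gradCoord n x₀ f u j * v i * v k := by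
    refine Finset.sum_congr rfl fun i _ => ?_
    rw [Finset.sum_comm]
    refine Finset.sum_congr rfl fun l _ => Finset.sum_congr rfl fun j _ => ?_
    simp only [metricMatrix_comm x₀ _ l j]
    ring
  have hB : ∑ i, ∑ j, ∑ l, gradCoord n x₀ f u l *
      coordDeriv j (fun w => metricMatrix n x₀ w i l) u * v i * v j =
      ∑ k, ∑ j, ∑ i, coordDeriv k (fun w => metricMatrix n x₀ w j i) u *
        gradCoord n x₀ f u j * v i * v k := by
    rw [Finset.sum_comm, ← hA]
    refine Finset.sum_congr rfl fun i _ => Finset.sum_congr rfl fun j _ =>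
      Finset.sum_congr rfl fun l _ => by ring
  have hC : ∑ i, ∑ j, ∑ l, gradCoord n x₀ f u l *
      coordDeriv l (fun w => metricMatrix n x₀ w i j) u * v i * v j =
      ∑ k, ∑ j, ∑ i, coordDeriv k (fun w => metricMatrix n x₀ w j i) u *
        v j * v i * gradCoord n x₀ f u k := by
    have : ∀ i, ∑ j, ∑ l, gradCoord n x₀ f u l *
      coordDeriv l (fun w => metricMatrix n x₀ w i j) u * v i * v j = ∑ l, ∑ j,
      gradCoord n x₀ f u l * coordDeriv l (fun w => metricMatrix n x₀ w i j) u * v i * v j :=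
      fun i => Finset.sum_comm
    simp only [this]
    rw [Finset.sum_comm]
    refine Finset.sum_congr rfl fun i _ => Finset.sum_congr rfl fun j _ =>
      Finset.sum_congr rfl fun l _ => by ring
  calc _ = (1 / 2) * (∑ i, ∑ j, ∑ l, gradCoord n x₀ f u l *
      coordDeriv i (fun w => metricMatrix n x₀ w j l) u * v i * v j
      + ∑ i, ∑ j, ∑ l, gradCoord n x₀ f u l *
      coordDeriv j (fun w => metricMatrix n x₀ w i l) u * v i * v j
      - ∑ i, ∑ j, ∑ l, gradCoord n x₀ f u l *
      coordDeriv l (fun w => metricMatrix n x₀ w i j) u * v i * v j) := by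
        simp only [h1, ← Finset.sum_add_distrib, ← Finset.sum_sub_distrib, Finset.mul_sum,
          Finset.sum_mul]
        refine Finset.sum_congr rfl fun i _ => Finset.sum_congr rfl fun j _ =>
          Finset.sum_congr rfl fun l _ => by ring
    _ = _ := by
      rw [hA, hB, hC]
      ring

/-- Invariantly, `Γ(Γ(g,f),f) = ∇²g(∇f,∇f) + ∇²f(∇g,∇f)`, while `Γ(Γ(f,f),g)/2 = ∇²f(∇f,∇g)`. The
Hessian thereby becomes an expression in first-order operations, which integration by parts can
handle. -/
theorem hessian_gradient_gradient {g f : M → ℝ} (hg : IsSmooth n g) (hf : IsSmooth n f) (x : M) :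
    hessian n g x (gradient n f x) (gradient n f x) =
      gradInner n (gradInner n g f) f x - (1 / 2) * gradInner n (gradInner n f f) g x := by
  set u := extChartAt (𝓡 n) x x with hu_def
  have hu : u ∈ (extChartAt (𝓡 n) x).target := mem_extChartAt_target x
  have hx : (extChartAt (𝓡 n) x).symm u = x := extChartAt_to_inv x
  have hT := isOpen_extChartAt_target (I := 𝓡 n) x
  have hcoord : ∀ i, coord n x x (gradient n f x) i = gradCoord n x f u i := by
    intro i
    have := coord_gradient hu (hf.mdifferentiableAt _) i
    rw [hx] at this
    exact this
  have h1 : gradInner n (gradInner n g f) f x = _ :=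
    (congrArg (gradInner n (gradInner n g f) f) hx.symm).trans
      (gradInner_eq_sum_gradCoord (hg.gradInner hf) hf hu)
  have h2 : gradInner n (gradInner n f f) g x = _ :=
    (congrArg (gradInner n (gradInner n f f) g) hx.symm).trans
      (gradInner_eq_sum_gradCoord (hf.gradInner hf) hg hu)
  rw [h1, h2]
  simp only [coordDeriv_gradInner hg hf hu, coordDeriv_gradInner hf hf hu]
  unfold hessian
  simp only [hcoord]
  rw [← hu_def]
  have hch := sum_sum_sum_christoffel (x₀ := x) (u := u) g (fun i => gradCoord n x f u i)
  simp only [sub_mul, Finset.sum_sub_distrib, add_mul, Finset.sum_add_distrib]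
  rw [hch]
  have hs : ∀ k i, coordDeriv k (coordDeriv i (f ∘ (extChartAt (𝓡 n) x).symm)) u =
    coordDeriv i (coordDeriv k (f ∘ (extChartAt (𝓡 n) x).symm)) u :=
    fun k i => coordDeriv_comm hT (isSmooth_iff.1 hf x) hu k i
  -- The second derivatives of `f` in the two terms cancel, by symmetry of second partials.
  have hB : ∑ k, (∑ j, coordDeriv k (coordDeriv j (f ∘ (extChartAt (𝓡 n) x).symm)) u *
      gradCoord n x g u j) * gradCoord n x f u k =
      ∑ k, (∑ j, coordDeriv k (coordDeriv j (f ∘ (extChartAt (𝓡 n) x).symm)) u *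
      gradCoord n x f u j) * gradCoord n x g u k := by
    simp only [Finset.sum_mul]
    rw [Finset.sum_comm]
    refine Finset.sum_congr rfl fun i _ => Finset.sum_congr rfl fun j _ => ?_
    rw [hs j i]
    ring
  have hA : ∑ i, ∑ j, coordDeriv i (coordDeriv j (g ∘ (extChartAt (𝓡 n) x).symm)) u *
      gradCoord n x f u i * gradCoord n x f u j =
      ∑ k, (∑ j, coordDeriv k (coordDeriv j (g ∘ (extChartAt (𝓡 n) x).symm)) u *
      gradCoord n x f u j) * gradCoord n x f u k := by
    simp only [Finset.sum_mul]
    refine Finset.sum_congr rfl fun i _ => Finset.sum_congr rfl fun j _ => by ring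
  rw [hA, hB]
  simp only [Finset.sum_mul]
  ring

end Hessian

/-! ### The Riemannian volume and its restriction to charts. -/

section Volume

variable {n : ℕ} {M : Type*} [TopologicalSpace M]
  [ChartedSpace (EuclideanSpace ℝ (Fin n)) M] [IsManifold (𝓡 n) ∞ M]
  [RiemannianBundle (fun x : M => TangentSpace (𝓡 n) x)]

/-- The base point `y` is kept separate from its expression in the chart around `x₁`, so that
vectors given in another chart can be inserted. -/
theorem inner_eq_sum_coord {x₁ : M} {u : EuclideanSpace ℝ (Fin n)}
    (hu : u ∈ (extChartAt (𝓡 n) x₁).target) {y : M} (hy : (extChartAt (𝓡 n) x₁).symm u = y)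
    (v w : TangentSpace (𝓡 n) y) :
    inner ℝ v w = ∑ k, ∑ l, coord n x₁ y v k * metricMatrix n x₁ u k l * coord n x₁ y w l := by
  subst hy
  conv_lhs => rw [← sum_coord_smul_coordVector hu v, ← sum_coord_smul_coordVector hu w]
  rw [sum_inner]
  refine Finset.sum_congr rfl fun k _ => ?_
  rw [inner_sum]
  refine Finset.sum_congr rfl fun l _ => ?_
  rw [real_inner_smul_left, real_inner_smul_right]
  simp only [metricMatrix, Matrix.of_apply]
  ring

variable (n) in
/-- The transition map between the charts around `x₀` and `x₁`. -/
def transition (x₀ x₁ : M) (u : EuclideanSpace ℝ (Fin n)) : EuclideanSpace ℝ (Fin n) :=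
  extChartAt (𝓡 n) x₁ ((extChartAt (𝓡 n) x₀).symm u)

theorem mfderiv_extChartAt_coordVector {x₀ x₁ : M} {u : EuclideanSpace ℝ (Fin n)}
    (hu : u ∈ (extChartAt (𝓡 n) x₀).target)
    (hu₁ : (extChartAt (𝓡 n) x₀).symm u ∈ (extChartAt (𝓡 n) x₁).source) :
    DifferentiableAt ℝ (transition n x₀ x₁) u ∧ ∀ i k,
      coord n x₁ _ (coordVector n x₀ u i) k =
        fderiv ℝ (transition n x₀ x₁) u (EuclideanSpace.single i 1) k := by
  have : IsManifold (𝓡 n) 1 M := .of_le (n := ∞) (by simp)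
  have h1 := mdifferentiableAt_extChartAt_symm hu
  have h2 : MDifferentiableAt (𝓡 n) 𝓘(ℝ, EuclideanSpace ℝ (Fin n)) (extChartAt (𝓡 n) x₁)
      ((extChartAt (𝓡 n) x₀).symm u) := by
    apply mdifferentiableAt_extChartAt
    rwa [← extChartAt_source (𝓡 n)]
  have h3 := mfderiv_comp u h2 h1
  rw [mfderiv_eq_fderiv] at h3
  refine ⟨mdifferentiableAt_iff_differentiableAt.1 (h2.comp u h1), fun i k => ?_⟩
  have h4 : fderiv ℝ (transition n x₀ x₁) u = _ := h3
  rw [h4]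
  rfl

/-- With `J` the Jacobian matrix of the transition map, the Gram matrices satisfy `G₀ = Jᵀ G₁ J`;
take determinants and square roots. -/
theorem volumeDensity_transition {x₀ x₁ : M} {u : EuclideanSpace ℝ (Fin n)}
    (hu : u ∈ (extChartAt (𝓡 n) x₀).target)
    (hu₁ : (extChartAt (𝓡 n) x₀).symm u ∈ (extChartAt (𝓡 n) x₁).source) :
    volumeDensity n x₀ u =
      |(fderiv ℝ (transition n x₀ x₁) u).det| * volumeDensity n x₁ (transition n x₀ x₁ u) := by
  obtain ⟨hd, hc⟩ := mfderiv_extChartAt_coordVector hu hu₁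
  set J : Matrix (Fin n) (Fin n) ℝ := Matrix.of fun k i =>
    fderiv ℝ (transition n x₀ x₁) u (EuclideanSpace.single i 1) k with hJ
  have hdet : J.det = (fderiv ℝ (transition n x₀ x₁) u).det := by
    have := LinearMap.det_toMatrix (EuclideanSpace.basisFun (Fin n) ℝ).toBasis
      (fderiv ℝ (transition n x₀ x₁) u : EuclideanSpace ℝ (Fin n) →ₗ[ℝ] EuclideanSpace ℝ (Fin n))
    rw [ContinuousLinearMap.det, ← this]
    congr 1
  have hG : metricMatrix n x₀ u =
      J.transpose * metricMatrix n x₁ (transition n x₀ x₁ u) * J := by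
    ext i j
    have hy : (extChartAt (𝓡 n) x₁).symm (transition n x₀ x₁ u) = (extChartAt (𝓡 n) x₀).symm u :=
      (extChartAt (𝓡 n) x₁).left_inv hu₁
    have := inner_eq_sum_coord ((extChartAt (𝓡 n) x₁).map_source hu₁) hy
      (coordVector n x₀ u i) (coordVector n x₀ u j)
    simp only [hc] at this
    refine Eq.trans this ?_
    simp only [Matrix.mul_apply, Finset.sum_mul]
    rw [Finset.sum_comm]
    rfl
  unfold volumeDensity
  rw [hG, Matrix.det_mul, Matrix.det_mul, Matrix.det_transpose, hdet,
    show ∀ d m : ℝ, d * m * d = d ^ 2 * m by intros; ring, Real.sqrt_mul (sq_nonneg _),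
    Real.sqrt_sq_eq_abs]

theorem measurableSet_preimage_inter_target [MeasurableSpace M] [BorelSpace M] (x₀ : M) {A : Set M}
    (hA : MeasurableSet A) :
    MeasurableSet ((extChartAt (𝓡 n) x₀).symm ⁻¹' A ∩ (extChartAt (𝓡 n) x₀).target) := by
  have hT := isOpen_extChartAt_target (I := 𝓡 n) x₀
  have h : Measurable fun u : (extChartAt (𝓡 n) x₀).target => (extChartAt (𝓡 n) x₀).symm u :=
    (continuousOn_iff_continuous_domRestrict.1 (continuousOn_extChartAt_symm x₀)).measurable
  have h2 := hT.measurableSet.subtype_image (h hA)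
  convert h2 using 1
  ext u
  simp [and_comm]

variable [IsContMDiffRiemannianBundle (𝓡 n) ∞ (EuclideanSpace ℝ (Fin n))
      (fun x : M => TangentSpace (𝓡 n) x)]

theorem aemeasurable_volumeDensity (x₀ : M) :
    AEMeasurable (volumeDensity n x₀)
      ((volume : Measure (EuclideanSpace ℝ (Fin n))).restrict (extChartAt (𝓡 n) x₀).target) :=
  (contDiffOn_volumeDensity x₀).continuousOn.aemeasurable
    (isOpen_extChartAt_target x₀).measurableSet

variable [MeasurableSpace M] [BorelSpace M]

theorem aemeasurable_extChartAt_symm (x₀ : M) :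
    AEMeasurable (extChartAt (𝓡 n) x₀).symm
      ((volume : Measure (EuclideanSpace ℝ (Fin n))).restrict (extChartAt (𝓡 n) x₀).target) :=
  (continuousOn_extChartAt_symm x₀).aemeasurable (isOpen_extChartAt_target x₀).measurableSet

theorem chartVolume_apply (x₀ : M) {A : Set M} (hA : MeasurableSet A) :
    chartVolume n x₀ A = ∫⁻ u in (extChartAt (𝓡 n) x₀).symm ⁻¹' A ∩ (extChartAt (𝓡 n) x₀).target,
      ENNReal.ofReal (volumeDensity n x₀ u) := by
  have h := aemeasurable_extChartAt_symm (n := n) x₀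
  unfold chartVolume
  rw [Measure.map_apply_of_aemeasurable (h.mono_ac (withDensity_absolutelyContinuous _ _)) hA,
    withDensity_apply', Measure.restrict_restrict₀ (h.nullMeasurableSet_preimage hA)]

theorem chartVolume_compl_source (x₀ : M) :
    chartVolume n x₀ (extChartAt (𝓡 n) x₀).sourceᶜ = 0 := by
  rw [chartVolume_apply x₀ (isOpen_extChartAt_source x₀).measurableSet.compl]
  have : (extChartAt (𝓡 n) x₀).symm ⁻¹' (extChartAt (𝓡 n) x₀).sourceᶜ ∩
      (extChartAt (𝓡 n) x₀).target = ∅ := by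
    ext u
    simp only [mem_inter_iff, mem_preimage, mem_compl_iff, mem_empty_iff_false, iff_false, not_and']
    intro hu h
    exact h ((extChartAt (𝓡 n) x₀).map_target hu)
  rw [this]
  simp

/-- Change of variables along the transition map, whose Jacobian determinant is the factor relating
the two densities. -/
theorem chartVolume_congr {x₀ x₁ : M} {A : Set M} (hA : MeasurableSet A)
    (h₀ : A ⊆ (extChartAt (𝓡 n) x₀).source) (h₁ : A ⊆ (extChartAt (𝓡 n) x₁).source) :
    chartVolume n x₀ A = chartVolume n x₁ A := by
  rw [chartVolume_apply x₀ hA, chartVolume_apply x₁ hA]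
  set s₀ := (extChartAt (𝓡 n) x₀).symm ⁻¹' A ∩ (extChartAt (𝓡 n) x₀).target with hs₀
  have hm : MeasurableSet s₀ := measurableSet_preimage_inter_target x₀ hA
  have himg : (extChartAt (𝓡 n) x₁).symm ⁻¹' A ∩ (extChartAt (𝓡 n) x₁).target =
      transition n x₀ x₁ '' s₀ := by
    ext u
    constructor
    · rintro ⟨hu, hu'⟩
      refine ⟨transition n x₁ x₀ u, ⟨?_, (extChartAt (𝓡 n) x₀).map_source (h₀ hu)⟩, ?_⟩
      · simp only [transition, mem_preimage]
        rwa [(extChartAt (𝓡 n) x₀).left_inv (h₀ hu)]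
      · simp only [transition]
        rw [(extChartAt (𝓡 n) x₀).left_inv (h₀ hu), (extChartAt (𝓡 n) x₁).right_inv hu']
    · rintro ⟨w, ⟨hw, hw'⟩, rfl⟩
      refine ⟨?_, (extChartAt (𝓡 n) x₁).map_source (h₁ hw)⟩
      simp only [transition, mem_preimage]
      rwa [(extChartAt (𝓡 n) x₁).left_inv (h₁ hw)]
  have hinj : InjOn (transition n x₀ x₁) s₀ := by
    rintro u ⟨hu, hu'⟩ w ⟨hw, hw'⟩ h
    have h2 := (extChartAt (𝓡 n) x₁).injOn (h₁ hu) (h₁ hw) h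
    exact (extChartAt (𝓡 n) x₀).symm.injOn hu' hw' h2
  have hder : ∀ u ∈ s₀, HasFDerivWithinAt (transition n x₀ x₁) (fderiv ℝ (transition n x₀ x₁) u)
      s₀ u := fun u hu =>
    (mfderiv_extChartAt_coordVector hu.2 (h₁ hu.1)).1.hasFDerivAt.hasFDerivWithinAt
  rw [himg, lintegral_image_eq_lintegral_abs_det_fderiv_mul volume hm hder hinj]
  refine setLIntegral_congr_fun hm fun u hu => ?_
  rw [volumeDensity_transition hu.2 (h₁ hu.1), ENNReal.ofReal_mul (abs_nonneg _)]

theorem chartVolume_inter_source (x₀ : M) (A : Set M) :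
    chartVolume n x₀ (A ∩ (extChartAt (𝓡 n) x₀).source) = chartVolume n x₀ A :=
  measure_inter_conull (chartVolume_compl_source x₀)

variable [CompactSpace M]

/-- The supremum over charts could a priori exceed a single chart measure. It does not, because one
glued measure dominates all chart measures and agrees with each on its own domain. -/
theorem riemannianVolume_apply {x₀ : M} {A : Set M} (hA : MeasurableSet A)
    (h₀ : A ⊆ (extChartAt (𝓡 n) x₀).source) :
    riemannianVolume n M A = chartVolume n x₀ A := by
  have hne : Nonempty M := ⟨x₀⟩
  obtain ⟨t, htc, ht⟩ := countable_cover_nhds_of_sigmaCompact (X := M)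
    (f := fun x => (extChartAt (𝓡 n) x).source) (fun x => extChartAt_source_mem_nhds x)
  have htne : t.Nonempty := by
    rw [nonempty_iff_ne_empty]
    rintro rfl
    simp only [biUnion_empty] at ht
    exact empty_ne_univ ht
  obtain ⟨p, rfl⟩ := htc.exists_eq_range htne
  set s : ℕ → Set M := fun i => (extChartAt (𝓡 n) (p i)).source with hs
  have hso : ∀ i, MeasurableSet (s i) := fun i => (isOpen_extChartAt_source (p i)).measurableSet
  have hd : ∀ i, MeasurableSet (disjointed s i) := fun i => MeasurableSet.disjointed hso i
  have hcover : ⋃ i, disjointed s i = univ := by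
    rw [iUnion_disjointed, ← ht]
    simp [hs]
  -- Glue countably many chart measures along a measurable partition of `M` subordinate to the chart
  -- domains.
  set ν : Measure M := Measure.sum fun i => (chartVolume n (p i)).restrict (disjointed s i) with hν
  have key : ∀ (x : M) (B : Set M), MeasurableSet B → B ⊆ (extChartAt (𝓡 n) x).source →
      chartVolume n x B = ν B := by
    intro x B hB hBx
    have h1 : B = ⋃ i, B ∩ disjointed s i := by
      rw [← inter_iUnion, hcover, inter_univ]
    have h2 : Pairwise (Function.onFun Disjoint fun i => B ∩ disjointed s i) := fun i j hij =>
      (disjoint_disjointed s hij).mono inter_subset_right inter_subset_right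
    rw [hν, Measure.sum_apply _ hB]
    conv_lhs => rw [h1]
    rw [measure_iUnion h2 fun i => hB.inter (hd i)]
    refine tsum_congr fun i => ?_
    rw [Measure.restrict_apply hB]
    exact chartVolume_congr (hB.inter (hd i)) (inter_subset_left.trans hBx)
      (inter_subset_right.trans (disjointed_subset s i))
  apply le_antisymm
  · have hle : riemannianVolume n M ≤ ν := by
      refine iSup_le fun x => Measure.le_iff.2 fun B hB => ?_
      have hBm := hB.inter (isOpen_extChartAt_source (I := 𝓡 n) x).measurableSet
      rw [← chartVolume_inter_source, key x _ hBm inter_subset_right]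
      exact measure_mono inter_subset_left
    rw [key x₀ A hA h₀]
    exact hle A
  · exact le_iSup (fun x : M => chartVolume n x) x₀ A

theorem riemannianVolume_restrict_source (x₀ : M) :
    (riemannianVolume n M).restrict (extChartAt (𝓡 n) x₀).source = chartVolume n x₀ := by
  ext A hA
  rw [Measure.restrict_apply hA, riemannianVolume_apply (x₀ := x₀)
    (hA.inter (isOpen_extChartAt_source x₀).measurableSet) inter_subset_right,
    chartVolume_inter_source]

theorem setIntegral_source {x₀ : M} {f : M → ℝ}
    (hf : AEStronglyMeasurable f (chartVolume n x₀)) :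
    ∫ x in (extChartAt (𝓡 n) x₀).source, f x ∂(riemannianVolume n M) =
      ∫ u in (extChartAt (𝓡 n) x₀).target,
        volumeDensity n x₀ u * f ((extChartAt (𝓡 n) x₀).symm u) := by
  have h := aemeasurable_extChartAt_symm (n := n) x₀
  rw [riemannianVolume_restrict_source]
  unfold chartVolume at hf ⊢
  rw [integral_map (h.mono_ac (withDensity_absolutelyContinuous _ _)) hf,
    integral_withDensity_eq_integral_toReal_smul₀ (aemeasurable_volumeDensity x₀).ennreal_ofReal
      (by simp)]
  refine setIntegral_congr_fun (isOpen_extChartAt_target x₀).measurableSet fun u hu => ?_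
  simp only [ENNReal.toReal_ofReal (volumeDensity_pos hu).le, smul_eq_mul]

theorem isLocallyFiniteMeasure_riemannianVolume : IsLocallyFiniteMeasure (riemannianVolume n M) := by
  refine ⟨fun x => ?_⟩
  have hT := isOpen_extChartAt_target (I := 𝓡 n) x
  obtain ⟨r, hr, hrT⟩ := Metric.nhds_basis_closedBall.mem_iff.1
    (hT.mem_nhds (mem_extChartAt_target x))
  set B := Metric.ball (extChartAt (𝓡 n) x x) r
  have ho : IsOpen ((extChartAt (𝓡 n) x).source ∩ extChartAt (𝓡 n) x ⁻¹' B) :=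
    (continuousOn_extChartAt x).isOpen_inter_preimage (isOpen_extChartAt_source x)
      Metric.isOpen_ball
  refine ⟨_, ho.mem_nhds ⟨mem_extChartAt_source x, Metric.mem_ball_self hr⟩, ?_⟩
  rw [riemannianVolume_apply (x₀ := x) ho.measurableSet inter_subset_left,
    chartVolume_apply x ho.measurableSet]
  have hint : IntegrableOn (volumeDensity n x) (Metric.closedBall (extChartAt (𝓡 n) x x) r) :=
    ((contDiffOn_volumeDensity x).continuousOn.mono hrT).integrableOn_compact
      (isCompact_closedBall _ _)
  refine lt_of_le_of_lt (lintegral_mono_set ?_) (Integrable.lintegral_lt_top hint)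
  rintro u ⟨⟨-, hu⟩, hu'⟩
  rw [mem_preimage, (extChartAt (𝓡 n) x).right_inv hu'] at hu
  exact Metric.ball_subset_closedBall hu

instance isFiniteMeasure_riemannianVolume : IsFiniteMeasure (riemannianVolume n M) :=
  have := isLocallyFiniteMeasure_riemannianVolume (n := n) (M := M)
  inferInstance

/-- The chart density is strictly positive, so a null open set would have a null open image in the
chart. This is what later upgrades a.e. equalities of continuous functions to pointwise ones. -/
instance isOpenPosMeasure_riemannianVolume : (riemannianVolume n M).IsOpenPosMeasure := by
  refine ⟨fun U hU hne h0 => ?_⟩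
  obtain ⟨x, hx⟩ := hne
  have h1 : chartVolume n x U = 0 :=
    le_antisymm ((le_iSup (fun x : M => chartVolume n x) x U).trans h0.le) bot_le
  rw [chartVolume_apply x hU.measurableSet, inter_comm] at h1
  have hT := isOpen_extChartAt_target (I := 𝓡 n) x
  set s := (extChartAt (𝓡 n) x).target ∩ (extChartAt (𝓡 n) x).symm ⁻¹' U
  have ho : IsOpen s := (continuousOn_extChartAt_symm x).isOpen_inter_preimage hT hU
  have hs : (volume : Measure (EuclideanSpace ℝ (Fin n))) s = 0 := by
    rw [lintegral_eq_zero_iff' ((aemeasurable_volumeDensity x).mono_measure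
      (Measure.restrict_mono inter_subset_left le_rfl)).ennreal_ofReal] at h1
    have h2 : ∀ᵐ u ∂((volume : Measure (EuclideanSpace ℝ (Fin n))).restrict s), False := by
      filter_upwards [h1, ae_restrict_mem ho.measurableSet] with u hu hus
      have := volumeDensity_pos (n := n) hus.1
      rw [Pi.zero_apply, ENNReal.ofReal_eq_zero] at hu
      linarith
    simpa [ae_iff] using h2
  refine ho.measure_ne_zero volume ⟨extChartAt (𝓡 n) x x, mem_extChartAt_target x, ?_⟩ hs
  rw [mem_preimage, extChartAt_to_inv]
  exact hx

end Volume

/-! ### Integration by parts on open subsets of `ℝⁿ`. -/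

theorem integrable_of_continuousOn_of_eq_zero {X : Type*} [TopologicalSpace X] [T2Space X]
    [MeasurableSpace X] [OpensMeasurableSpace X] {μ : Measure X} [IsFiniteMeasureOnCompacts μ]
    {f : X → ℝ} {K : Set X} (hK : IsCompact K) (hf : ContinuousOn f K)
    (h0 : ∀ x, x ∉ K → f x = 0) : Integrable f μ :=
  (integrableOn_iff_integrable_of_support_subset (Function.support_subset_iff'.2 h0)).1
    (hf.integrableOn_compact' hK hK.measurableSet)

section EuclideanParts

variable {n : ℕ} {T K : Set (EuclideanSpace ℝ (Fin n))} {f g : EuclideanSpace ℝ (Fin n) → ℝ}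

theorem integrableOn_of_continuousOn_of_eq_zero (hT : MeasurableSet T) (hK : IsCompact K)
    (hKT : K ⊆ T) (hf : ContinuousOn f T) (h0 : ∀ u ∈ T, u ∉ K → f u = 0) :
    IntegrableOn f T := by
  have h1 : Integrable (T.indicator f) (volume : Measure (EuclideanSpace ℝ (Fin n))) := by
    refine integrable_of_continuousOn_of_eq_zero hK ?_ fun u hu => ?_
    · exact (hf.mono hKT).congr fun u hu => indicator_of_mem (hKT hu) f
    · by_cases h : u ∈ T
      · rw [indicator_of_mem h, h0 u h hu]
      · exact indicator_of_notMem h f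
  exact (integrable_indicator_iff hT).1 h1

theorem coordDeriv_eq_zero (hT : IsOpen T) (hK : IsCompact K)
    (h0 : ∀ u ∈ T, u ∉ K → f u = 0) (i : Fin n) : ∀ u ∈ T, u ∉ K → coordDeriv i f u = 0 := by
  intro u hu huK
  have h : f =ᶠ[nhds u] fun _ => 0 := by
    filter_upwards [hT.mem_nhds hu, hK.isClosed.isOpen_compl.mem_nhds huK] with w hw hwK
    exact h0 w hw hwK
  rw [coordDeriv_congr i h]
  simp [coordDeriv]

theorem setIntegral_mul_coordDeriv (hT : IsOpen T) (hK : IsCompact K) (hKT : K ⊆ T)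
    (hf : ContDiffOn ℝ ∞ f T) (hg : ContDiffOn ℝ ∞ g T) (h0 : ∀ u ∈ T, u ∉ K → f u = 0)
    (i : Fin n) :
    ∫ u in T, f u * coordDeriv i g u = -∫ u in T, coordDeriv i f u * g u := by
  have hdiff : ∀ {h : EuclideanSpace ℝ (Fin n) → ℝ}, ContDiffOn ℝ ∞ h T → ∀ u ∈ T,
      DifferentiableAt ℝ h u :=
    fun hh u hu => (hh.contDiffAt (hT.mem_nhds hu)).differentiableAt (by simp)
  -- Extension by zero is differentiable everywhere because `f` vanishes on `T` off the compact set
  -- `K`. The factor `g` need not extend beyond `T`: its differentiability is used only on the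
  -- support of `F`.
  set F := T.indicator f with hF
  have hF0 : ∀ u, u ∉ K → F u = 0 := by
    intro u hu
    by_cases h : u ∈ T
    · rw [hF, indicator_of_mem h, h0 u h hu]
    · exact indicator_of_notMem h f
  have hFT : ∀ u ∈ T, F =ᶠ[nhds u] f := fun u hu => by
    filter_upwards [hT.mem_nhds hu] with w hw
    exact indicator_of_mem hw f
  have hFK : ∀ u, u ∉ K → F =ᶠ[nhds u] fun _ => 0 := fun u hu => by
    filter_upwards [hK.isClosed.isOpen_compl.mem_nhds hu] with w hw
    exact hF0 w hw
  have hFd : ∀ u, DifferentiableAt ℝ F u := by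
    intro u
    by_cases h : u ∈ K
    · exact (hdiff hf u (hKT h)).congr_of_eventuallyEq (hFT u (hKT h))
    · exact (differentiableAt_const 0).congr_of_eventuallyEq (hFK u h)
  have hFd0 : ∀ u, u ∉ K → coordDeriv i F u = 0 := fun u hu => by
    rw [coordDeriv_congr i (hFK u hu)]
    simp [coordDeriv]
  have hsupp : tsupport F ⊆ T :=
    (closure_minimal (Function.support_subset_iff'.2 hF0) hK.isClosed).trans hKT
  have hfK := (hf.continuousOn).mono hKT
  have hgK := (hg.continuousOn).mono hKT
  have hFK' : ContinuousOn F K := hfK.congr fun u hu => indicator_of_mem (hKT hu) f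
  have hdF : ContinuousOn (coordDeriv i F) K :=
    ((contDiffOn_coordDeriv hT hf i).continuousOn.mono hKT).congr fun u hu =>
      coordDeriv_congr i (hFT u (hKT hu))
  have hdg := (contDiffOn_coordDeriv hT hg i).continuousOn.mono hKT
  have key : ∫ u, F u * coordDeriv i g u = -∫ u, coordDeriv i F u * g u :=
    integral_mul_fderiv_eq_neg_fderiv_mul_of_integrable
    (μ := (volume : Measure (EuclideanSpace ℝ (Fin n)))) (f := F) (g := g)
    (v := EuclideanSpace.single i 1)
    (integrable_of_continuousOn_of_eq_zero hK (hdF.mul hgK)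
      fun u hu => mul_eq_zero_of_left (hFd0 u hu) _)
    (integrable_of_continuousOn_of_eq_zero hK (hFK'.mul hdg)
      fun u hu => mul_eq_zero_of_left (hF0 u hu) _)
    (integrable_of_continuousOn_of_eq_zero hK (hFK'.mul hgK)
      fun u hu => mul_eq_zero_of_left (hF0 u hu) _)
    (fun u _ => hFd u) (fun u hu => hdiff hg u (hsupp hu))
  rw [← setIntegral_eq_integral_of_forall_compl_eq_zero (s := T)
      (fun u hu => mul_eq_zero_of_left (hF0 u fun h => hu (hKT h)) _),
    ← setIntegral_eq_integral_of_forall_compl_eq_zero (s := T)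
      (fun u hu => mul_eq_zero_of_left (hFd0 u fun h => hu (hKT h)) _)] at key
  rw [setIntegral_congr_fun (g := fun u => F u * coordDeriv i g u)
    hT.measurableSet fun u hu => ?_, key, setIntegral_congr_fun hT.measurableSet fun u hu => ?_]
  · rw [← coordDeriv_congr i (hFT u hu)]
  · simp only [hF, indicator_of_mem hu]

end EuclideanParts

/-! ### The divergence: chart independence and integration by parts on `M`. -/

section Divergence

variable {n : ℕ} {M : Type*} [TopologicalSpace M]
  [ChartedSpace (EuclideanSpace ℝ (Fin n)) M] [IsManifold (𝓡 n) ∞ M]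
  [RiemannianBundle (fun x : M => TangentSpace (𝓡 n) x)]
  [IsContMDiffRiemannianBundle (𝓡 n) ∞ (EuclideanSpace ℝ (Fin n))
      (fun x : M => TangentSpace (𝓡 n) x)]

variable (n) in
/-- The components of `√(det g) ρ ∇Φ` in the chart around `x₀`. -/
def fluxCoord (x₀ : M) (ρ Φ : M → ℝ) (i : Fin n) (u : EuclideanSpace ℝ (Fin n)) : ℝ :=
  volumeDensity n x₀ u * (ρ ((extChartAt (𝓡 n) x₀).symm u) * gradCoord n x₀ Φ u i)

variable (n) in
/-- The divergence of `ρ ∇Φ` in the chart around `x₀`. -/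
def chartDivergence (x₀ : M) (ρ Φ : M → ℝ) (u : EuclideanSpace ℝ (Fin n)) : ℝ :=
  (volumeDensity n x₀ u)⁻¹ * ∑ i, coordDeriv i (fluxCoord n x₀ ρ Φ i) u

theorem contDiffOn_fluxCoord (x₀ : M) {ρ Φ : M → ℝ} (hρ : IsSmooth n ρ) (hΦ : IsSmooth n Φ)
    (i : Fin n) : ContDiffOn ℝ ∞ (fluxCoord n x₀ ρ Φ i) (extChartAt (𝓡 n) x₀).target :=
  (contDiffOn_volumeDensity x₀).mul ((isSmooth_iff.1 hρ x₀).mul (contDiffOn_gradCoord x₀ hΦ i))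

theorem contDiffOn_chartDivergence (x₀ : M) {ρ Φ : M → ℝ} (hρ : IsSmooth n ρ)
    (hΦ : IsSmooth n Φ) :
    ContDiffOn ℝ ∞ (chartDivergence n x₀ ρ Φ) (extChartAt (𝓡 n) x₀).target :=
  ((contDiffOn_volumeDensity x₀).inv fun _ hu => (volumeDensity_pos hu).ne').mul
    (ContDiffOn.sum fun i _ => contDiffOn_coordDeriv (isOpen_extChartAt_target x₀)
      (contDiffOn_fluxCoord x₀ hρ hΦ i) i)

/-- Only the chart around `x` itself appears, since `divergence` is computed there; a general chart
is reached in `wassersteinVector_eq_chart`. -/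
theorem wassersteinVector_eq_neg_chartDivergence {ρ Φ : M → ℝ} (hΦ : IsSmooth n Φ) (x : M) :
    wassersteinVector n ρ Φ x = -chartDivergence n x ρ Φ (extChartAt (𝓡 n) x x) := by
  unfold wassersteinVector divergence chartDivergence
  congr 2
  refine Finset.sum_congr rfl fun i _ => coordDeriv_congr i ?_
  filter_upwards [(isOpen_extChartAt_target (I := 𝓡 n) x).mem_nhds (mem_extChartAt_target x)]
    with u hu
  have h1 : coord n x _ (ρ ((extChartAt (𝓡 n) x).symm u) •
      gradient n Φ ((extChartAt (𝓡 n) x).symm u)) i =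
      ρ ((extChartAt (𝓡 n) x).symm u) * coord n x _ (gradient n Φ ((extChartAt (𝓡 n) x).symm u)) i := by
    simp only [coord]
    rw [map_smul]
    rfl
  rw [h1, coord_gradient hu (hΦ.mdifferentiableAt _)]
  rfl

theorem gradInner_eq_zero_of_notMem_tsupport {ψ Φ : M → ℝ} {x : M} (hx : x ∉ tsupport ψ) :
    gradInner n ψ Φ x = 0 := by
  have h : ψ =ᶠ[nhds x] fun _ => 0 := notMem_tsupport_iff_eventuallyEq.1 hx
  have h2 := gradInner_const_left (n := n) 0 Φ
  have h3 : gradient n ψ x = gradient n (fun _ : M => (0 : ℝ)) x := by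
    unfold gradient
    rw [h.mfderiv_eq]
  have h4 := congrFun h2 x
  simp only [gradInner, Pi.zero_apply] at h4 ⊢
  rw [h3, h4]

variable [MeasurableSpace M] [BorelSpace M] [CompactSpace M] [T2Space M]

theorem IsSmooth.integrable {f : M → ℝ} (hf : IsSmooth n f) :
    Integrable f (riemannianVolume n M) :=
  hf.continuous.integrable_of_hasCompactSupport (HasCompactSupport.of_compactSpace f)

theorem IsSmooth.integrable_mul {f g : M → ℝ} (hf : IsSmooth n f) (hg : IsSmooth n g) :
    Integrable (fun x => f x * g x) (riemannianVolume n M) :=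
  (hf.mul hg).integrable

theorem integrable_mul_chartDivergence {x₀ : M} {ψ ρ Φ : M → ℝ} (hψ : IsSmooth n ψ)
    (hρ : IsSmooth n ρ) (hΦ : IsSmooth n Φ) (hs : tsupport ψ ⊆ (extChartAt (𝓡 n) x₀).source) :
    Integrable (fun x => ψ x * chartDivergence n x₀ ρ Φ (extChartAt (𝓡 n) x₀ x))
      (riemannianVolume n M) := by
  refine integrable_of_continuousOn_of_eq_zero (isClosed_tsupport ψ).isCompact
    (ContinuousOn.mono (ContinuousOn.mul hψ.continuous.continuousOn ?_) hs)
    fun x hx => mul_eq_zero_of_left (image_eq_zero_of_notMem_tsupport hx) _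
  exact (contDiffOn_chartDivergence x₀ hρ hΦ).continuousOn.comp (continuousOn_extChartAt x₀)
    fun x hx => (extChartAt (𝓡 n) x₀).map_source hx

/-- The density `√(det g)` of the volume cancels its inverse in the divergence, leaving a Euclidean
integration by parts for a `ψ` supported in the chart. The right side no longer mentions the chart.
-/
theorem integral_mul_chartDivergence {x₀ : M} {ψ ρ Φ : M → ℝ} (hψ : IsSmooth n ψ)
    (hρ : IsSmooth n ρ) (hΦ : IsSmooth n Φ) (hs : tsupport ψ ⊆ (extChartAt (𝓡 n) x₀).source) :
    ∫ x, ψ x * chartDivergence n x₀ ρ Φ (extChartAt (𝓡 n) x₀ x) ∂(riemannianVolume n M) =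
      -∫ x, gradInner n ψ Φ x * ρ x ∂(riemannianVolume n M) := by
  have hT := isOpen_extChartAt_target (I := 𝓡 n) x₀
  have hS := isOpen_extChartAt_source (I := 𝓡 n) x₀
  set K := extChartAt (𝓡 n) x₀ '' tsupport ψ with hKdef
  have hK : IsCompact K :=
    (isClosed_tsupport ψ).isCompact.image_of_continuousOn ((continuousOn_extChartAt x₀).mono hs)
  have hKT : K ⊆ (extChartAt (𝓡 n) x₀).target := by
    rintro _ ⟨x, hx, rfl⟩
    exact (extChartAt (𝓡 n) x₀).map_source (hs hx)
  have h0 : ∀ u ∈ (extChartAt (𝓡 n) x₀).target, u ∉ K →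
      (ψ ∘ (extChartAt (𝓡 n) x₀).symm) u = 0 := by
    intro u hu huK
    refine image_eq_zero_of_notMem_tsupport (f := ψ) fun h => huK ?_
    exact ⟨_, h, (extChartAt (𝓡 n) x₀).right_inv hu⟩
  have hψ' := isSmooth_iff.1 hψ x₀
  have hm1 : AEStronglyMeasurable
      (fun x => ψ x * chartDivergence n x₀ ρ Φ (extChartAt (𝓡 n) x₀ x)) (chartVolume n x₀) := by
    rw [← riemannianVolume_restrict_source]
    exact (integrable_mul_chartDivergence hψ hρ hΦ hs).aestronglyMeasurable.restrict
  have hm2 : AEStronglyMeasurable (fun x => gradInner n ψ Φ x * ρ x) (chartVolume n x₀) := by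
    exact ((hψ.gradInner hΦ).mul hρ).continuous.aestronglyMeasurable
  rw [← setIntegral_eq_integral_of_forall_compl_eq_zero (s := (extChartAt (𝓡 n) x₀).source)
      (fun x hx => mul_eq_zero_of_left (image_eq_zero_of_notMem_tsupport fun h => hx (hs h)) _),
    ← setIntegral_eq_integral_of_forall_compl_eq_zero (s := (extChartAt (𝓡 n) x₀).source)
      (fun x hx => mul_eq_zero_of_left
        (gradInner_eq_zero_of_notMem_tsupport (n := n) (Φ := Φ) fun h => hx (hs h)) _),
    setIntegral_source hm1, setIntegral_source hm2]
  have e1 : ∫ u in (extChartAt (𝓡 n) x₀).target, volumeDensity n x₀ u *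
      (ψ ((extChartAt (𝓡 n) x₀).symm u) *
        chartDivergence n x₀ ρ Φ (extChartAt (𝓡 n) x₀ ((extChartAt (𝓡 n) x₀).symm u))) =
      ∫ u in (extChartAt (𝓡 n) x₀).target, ∑ i, (ψ ∘ (extChartAt (𝓡 n) x₀).symm) u *
        coordDeriv i (fluxCoord n x₀ ρ Φ i) u := by
    refine setIntegral_congr_fun hT.measurableSet fun u hu => ?_
    have hv := (volumeDensity_pos (n := n) hu).ne'
    simp only [(extChartAt (𝓡 n) x₀).right_inv hu, chartDivergence, Function.comp_apply]
    rw [← Finset.mul_sum]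
    field_simp
  have e2 : ∫ u in (extChartAt (𝓡 n) x₀).target, volumeDensity n x₀ u *
      (gradInner n ψ Φ ((extChartAt (𝓡 n) x₀).symm u) * ρ ((extChartAt (𝓡 n) x₀).symm u)) =
      ∫ u in (extChartAt (𝓡 n) x₀).target, ∑ i, coordDeriv i (ψ ∘ (extChartAt (𝓡 n) x₀).symm) u *
        fluxCoord n x₀ ρ Φ i u := by
    refine setIntegral_congr_fun hT.measurableSet fun u hu => ?_
    simp only [gradInner_eq_sum_gradCoord hψ hΦ hu, fluxCoord, Finset.sum_mul, Finset.mul_sum]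
    exact Finset.sum_congr rfl fun i _ => by ring
  rw [e1, e2, integral_finsetSum _ fun i _ => ?_, integral_finsetSum _ fun i _ => ?_,
    ← Finset.sum_neg_distrib]
  · exact Finset.sum_congr rfl fun i _ => setIntegral_mul_coordDeriv hT hK hKT hψ'
      (contDiffOn_fluxCoord x₀ hρ hΦ i) h0 i
  · exact integrableOn_of_continuousOn_of_eq_zero hT.measurableSet hK hKT
      ((contDiffOn_coordDeriv hT hψ' i).continuousOn.mul
        (contDiffOn_fluxCoord x₀ hρ hΦ i).continuousOn)
      fun u hu huK => mul_eq_zero_of_left (coordDeriv_eq_zero hT hK h0 i u hu huK) _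
  · exact integrableOn_of_continuousOn_of_eq_zero hT.measurableSet hK hKT
      (hψ'.continuousOn.mul (contDiffOn_coordDeriv hT (contDiffOn_fluxCoord x₀ hρ hΦ i)
        i).continuousOn)
      fun u hu huK => mul_eq_zero_of_left (h0 u hu huK) _

/-- No change-of-coordinates computation is needed: by `integral_mul_chartDivergence` the
expressions in two charts have equal integrals against every test function supported in the overlap.
They agree a.e. there, and everywhere by continuity. -/
theorem wassersteinVector_eq_chart {ρ Φ : M → ℝ} (hρ : IsSmooth n ρ) (hΦ : IsSmooth n Φ)
    {x₀ x : M} (hx : x ∈ (extChartAt (𝓡 n) x₀).source) :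
    wassersteinVector n ρ Φ x = -chartDivergence n x₀ ρ Φ (extChartAt (𝓡 n) x₀ x) := by
  rw [wassersteinVector_eq_neg_chartDivergence hΦ]
  congr 1
  set O := (extChartAt (𝓡 n) x).source ∩ (extChartAt (𝓡 n) x₀).source with hO
  have hOo : IsOpen O := (isOpen_extChartAt_source x).inter (isOpen_extChartAt_source x₀)
  have hc : ∀ y : M, O ⊆ (extChartAt (𝓡 n) y).source →
      ContinuousOn (fun z => chartDivergence n y ρ Φ (extChartAt (𝓡 n) y z)) O := fun y hy =>
    ((contDiffOn_chartDivergence y hρ hΦ).continuousOn.comp (continuousOn_extChartAt y)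
      fun z hz => (extChartAt (𝓡 n) y).map_source hz).mono hy
  have h1 := hc x inter_subset_left
  have h2 := hc x₀ inter_subset_right
  have hae := hOo.ae_eq_zero_of_integral_contMDiff_smul_eq_zero (𝓡 n) (μ := riemannianVolume n M)
    ((h1.sub h2).locallyIntegrableOn hOo.measurableSet) (fun ψ hψ _ hs => by
      simp only [smul_eq_mul, Pi.sub_apply, mul_sub]
      rw [integral_sub (integrable_mul_chartDivergence hψ hρ hΦ (hs.trans inter_subset_left))
        (integrable_mul_chartDivergence hψ hρ hΦ (hs.trans inter_subset_right)),
        integral_mul_chartDivergence hψ hρ hΦ (hs.trans inter_subset_left),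
        integral_mul_chartDivergence hψ hρ hΦ (hs.trans inter_subset_right), sub_self])
  refine Measure.eqOn_open_of_ae_eq (μ := riemannianVolume n M) ?_ hOo h1 h2
    ⟨mem_extChartAt_source x, hx⟩
  refine (ae_restrict_iff' hOo.measurableSet).2 ?_
  filter_upwards [hae] with y hy hyO
  exact sub_eq_zero.1 (hy hyO)

theorem IsSmooth.wassersteinVector {ρ Φ : M → ℝ} (hρ : IsSmooth n ρ) (hΦ : IsSmooth n Φ) :
    IsSmooth n (wassersteinVector n ρ Φ) := by
  refine isSmooth_iff.2 fun x₀ => (contDiffOn_chartDivergence x₀ hρ hΦ).neg.congr fun u hu => ?_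
  rw [Function.comp_apply,
    wassersteinVector_eq_chart hρ hΦ ((extChartAt (𝓡 n) x₀).map_target hu),
    (extChartAt (𝓡 n) x₀).right_inv hu]

/-- A partition of unity reduces to `ψ` supported in one chart, where `integral_mul_chartDivergence`
applies. -/
theorem integral_mul_wassersteinVector {ψ ρ Φ : M → ℝ} (hψ : IsSmooth n ψ) (hρ : IsSmooth n ρ)
    (hΦ : IsSmooth n Φ) :
    ∫ x, ψ x * wassersteinVector n ρ Φ x ∂(riemannianVolume n M) =
      ∫ x, gradInner n ψ Φ x * ρ x ∂(riemannianVolume n M) := by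
  obtain ⟨χ, hχ⟩ := SmoothPartitionOfUnity.exists_isSubordinate_chartAt_source (𝓡 n) M
  have hfin := χ.locallyFinite.finite_nonempty_of_compact
  have hV := hρ.wassersteinVector hΦ
  have hsum : ψ = ∑ i ∈ hfin.toFinset, (fun x => χ i x * ψ x) := by
    ext x
    have h1 : ∑ i ∈ hfin.toFinset, χ i x = 1 := by
      rw [← χ.sum_eq_one (mem_univ x)]
      refine (finsum_eq_sum_of_support_subset _ fun i hi => ?_).symm
      simp only [Finite.coe_toFinset, mem_ofPred_eq]
      exact ⟨x, hi⟩
    rw [Finset.sum_apply, ← Finset.sum_mul, h1, one_mul]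
  have key : IsSmooth n (∑ i ∈ hfin.toFinset, (fun x => χ i x * ψ x)) ∧
      ∫ x, (∑ i ∈ hfin.toFinset, (fun x => χ i x * ψ x)) x * wassersteinVector n ρ Φ x
        ∂(riemannianVolume n M) =
      ∫ x, gradInner n (∑ i ∈ hfin.toFinset, (fun x => χ i x * ψ x)) Φ x * ρ x
        ∂(riemannianVolume n M) := by
    -- Smoothness is carried along in the induction, since it gives the integrability needed to
    -- split the integrals of a sum.
    refine Finset.sum_induction _ (fun f : M → ℝ => IsSmooth n f ∧
      ∫ x, f x * wassersteinVector n ρ Φ x ∂(riemannianVolume n M) =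
      ∫ x, gradInner n f Φ x * ρ x ∂(riemannianVolume n M)) ?_ ?_ ?_
    · rintro f g ⟨hf, hf'⟩ ⟨hg, hg'⟩
      refine ⟨hf.add hg, ?_⟩
      rw [gradInner_add_left hf hg]
      simp only [Pi.add_apply, add_mul]
      rw [integral_add (hf.integrable_mul hV) (hg.integrable_mul hV),
        integral_add ((hf.gradInner hΦ).integrable_mul hρ)
          ((hg.gradInner hΦ).integrable_mul hρ),
        hf', hg']
    · refine ⟨isSmooth_const 0, ?_⟩
      have := gradInner_const_left (n := n) 0 Φ
      simp only [Pi.zero_apply, zero_mul, integral_zero]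
      rw [show (0 : M → ℝ) = fun _ => 0 from rfl, this]
      simp
    · intro i _
      have hsm : IsSmooth n (fun x => χ i x * ψ x) := IsSmooth.mul (χ i).contMDiff hψ
      have hs : tsupport (fun x => χ i x * ψ x) ⊆ (extChartAt (𝓡 n) i).source := by
        rw [extChartAt_source]
        exact (tsupport_mul_subset_left (f := χ i) (g := ψ)).trans (hχ i)
      refine ⟨hsm, ?_⟩
      have h1 := integral_mul_chartDivergence hsm hρ hΦ hs
      rw [eq_neg_iff_add_eq_zero, add_comm, ← eq_neg_iff_add_eq_zero] at h1
      rw [h1, ← integral_neg]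
      refine integral_congr_ae (Filter.Eventually.of_forall fun x => ?_)
      by_cases hx : x ∈ (extChartAt (𝓡 n) i).source
      · simp only [wassersteinVector_eq_chart hρ hΦ hx]
        ring
      · have : χ i x * ψ x = 0 :=
          image_eq_zero_of_notMem_tsupport (f := fun x => χ i x * ψ x) fun h => hx (hs h)
        simp only [this]
        ring
  rw [hsum]
  exact key.2

end Divergence

/-! ### Smooth dependence of integrals over `[0, 1]` on parameters. -/

section ParametricIntegral

variable {X : Type} [NormedAddCommGroup X] [NormedSpace ℝ X] [ProperSpace X]

theorem hasFDerivAt_integral_unitInterval {F : Type} [NormedAddCommGroup F] [NormedSpace ℝ F]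
    [CompleteSpace F] {f : X × ℝ → F} {W : Set (X × ℝ)} {V : Set X} (hW : IsOpen W) (hV : IsOpen V)
    (hVW : V ×ˢ Icc (0 : ℝ) 1 ⊆ W) (hf : ContDiffOn ℝ ∞ f W) {x₀ : X} (hx₀ : x₀ ∈ V) :
    HasFDerivAt (fun x => ∫ θ in (0 : ℝ)..1, f (x, θ))
      (∫ θ in (0 : ℝ)..1, (fderiv ℝ f (x₀, θ)).comp (ContinuousLinearMap.inl ℝ X ℝ)) x₀ := by
  obtain ⟨r, hr, hrV⟩ := Metric.nhds_basis_closedBall.mem_iff.1 (hV.mem_nhds hx₀)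
  have hI : uIoc (0 : ℝ) 1 ⊆ Icc 0 1 := by
    rw [uIoc_of_le zero_le_one]
    exact Ioc_subset_Icc_self
  have hD : ContinuousOn (fun q : X × ℝ => (fderiv ℝ f q).comp (ContinuousLinearMap.inl ℝ X ℝ)) W :=
    (hf.continuousOn_fderiv_of_isOpen hW (by simp)).clm_comp continuousOn_const
  have hslice : ∀ {Y : Type} [TopologicalSpace Y] {h : X × ℝ → Y}, ContinuousOn h W → ∀ x ∈ V,
      ContinuousOn (fun θ => h (x, θ)) (Icc 0 1) := fun hh x hx =>
    hh.comp (by fun_prop) fun θ hθ => hVW ⟨hx, hθ⟩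
  obtain ⟨C, hC⟩ := ((isCompact_closedBall x₀ r).prod (isCompact_Icc (a := (0 : ℝ))
    (b := 1))).exists_bound_of_continuousOn (hD.mono ((prod_mono hrV subset_rfl).trans hVW))
  refine intervalIntegral.hasFDerivAt_integral_of_dominated_of_fderiv_le
    (F' := fun x θ => (fderiv ℝ f (x, θ)).comp (ContinuousLinearMap.inl ℝ X ℝ))
    (bound := fun _ => C) (Metric.closedBall_mem_nhds x₀ hr) ?_ ?_ ?_ ?_ ?_ ?_
  · filter_upwards [hV.mem_nhds hx₀] with x hx
    exact ((hslice hf.continuousOn x hx).aestronglyMeasurable measurableSet_Icc).mono_measure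
      (Measure.restrict_mono hI le_rfl)
  · refine ContinuousOn.intervalIntegrable ?_
    rw [uIcc_of_le zero_le_one]
    exact hslice hf.continuousOn x₀ hx₀
  · exact ((hslice hD x₀ hx₀).aestronglyMeasurable measurableSet_Icc).mono_measure
      (Measure.restrict_mono hI le_rfl)
  · exact Filter.Eventually.of_forall fun θ hθ x hx => hC (x, θ) ⟨hx, hI hθ⟩
  · exact intervalIntegrable_const
  · refine Filter.Eventually.of_forall fun θ hθ x hx => ?_
    have h1 : DifferentiableAt ℝ f (x, θ) :=
      (hf.contDiffAt (hW.mem_nhds (hVW ⟨hrV hx, hI hθ⟩))).differentiableAt (by simp)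
    exact h1.hasFDerivAt.comp x (hasFDerivAt_prodMk_left x θ)

theorem contDiffOn_integral_unitInterval {F : Type} [NormedAddCommGroup F] [NormedSpace ℝ F]
    [CompleteSpace F] {f : X × ℝ → F} {W : Set (X × ℝ)} {V : Set X} (hW : IsOpen W) (hV : IsOpen V)
    (hVW : V ×ˢ Icc (0 : ℝ) 1 ⊆ W) (hf : ContDiffOn ℝ ∞ f W) :
    ContDiffOn ℝ ∞ (fun x => ∫ θ in (0 : ℝ)..1, f (x, θ)) V := by
  rw [contDiffOn_infty]
  intro k
  -- The target space must vary: the derivative is again such an integral, with values in continuous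
  -- linear maps.
  induction k generalizing F with
  | zero =>
    refine contDiffOn_zero.2 fun x hx => ?_
    exact (hasFDerivAt_integral_unitInterval hW hV hVW hf hx).continuousAt.continuousWithinAt
  | succ k ih =>
    push_cast
    refine (contDiffOn_succ_iff_fderiv_of_isOpen hV).2 ⟨fun x hx =>
      (hasFDerivAt_integral_unitInterval hW hV hVW hf hx).differentiableAt.differentiableWithinAt,
      by simp, ?_⟩
    have h1 : ContDiffOn ℝ ∞
        (fun q : X × ℝ => (fderiv ℝ f q).comp (ContinuousLinearMap.inl ℝ X ℝ)) W :=
      (hf.fderiv_of_isOpen hW (m := ∞) (by simp)).clm_comp contDiffOn_const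
    exact (ih h1).congr fun x hx => (hasFDerivAt_integral_unitInterval hW hV hVW hf hx).fderiv

end ParametricIntegral

/-! ### Smooth difference quotients of families. -/

section Hadamard

variable {n : ℕ} {M : Type*} [TopologicalSpace M]
  [ChartedSpace (EuclideanSpace ℝ (Fin n)) M] [IsManifold (𝓡 n) ∞ M]

/-- Hadamard's lemma for smooth one-parameter families of functions. -/
theorem IsSmoothFamily.exists_quotient {J : Set ℝ} {c : ℝ → M → ℝ} (hJ : IsOpen J)
    (hc : IsSmoothFamily n J c) {t₀ : ℝ} (ht₀ : t₀ ∈ J) :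
    ∃ r : ℝ, 0 < r ∧ ∃ q : ℝ → M → ℝ, IsSmoothFamily n (Metric.ball 0 r) q ∧
      q 0 = HopfCole.familyDeriv c t₀ ∧ ∀ τ ∈ Metric.ball (0 : ℝ) r, t₀ + τ ∈ J ∧
        c (t₀ + τ) = c t₀ + τ • q τ := by
  obtain ⟨r, hr, hrJ⟩ := Metric.isOpen_iff.1 hJ t₀ ht₀
  have hmem : ∀ τ ∈ Metric.ball (0 : ℝ) r, ∀ θ ∈ Icc (0 : ℝ) 1, t₀ + θ * τ ∈ J := by
    intro τ hτ θ hθ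
    apply hrJ
    rw [Metric.mem_ball, dist_zero_right, Real.norm_eq_abs] at hτ
    rw [Metric.mem_ball, dist_eq_norm, add_sub_cancel_left, Real.norm_eq_abs, abs_mul,
      abs_of_nonneg hθ.1]
    exact (mul_le_of_le_one_left (abs_nonneg τ) hθ.2).trans_lt hτ
  have hcd := hc.familyDeriv hJ
  -- The quotient is the average of `∂_t c` over the segment from `t₀` to `t₀ + τ`, hence smooth
  -- also at `τ = 0`.
  refine ⟨r, hr, fun τ x => ∫ θ in (0 : ℝ)..1, HopfCole.familyDeriv c (t₀ + θ * τ) x, ?_, ?_, ?_⟩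
  · refine (isSmoothFamily_iff Metric.isOpen_ball).2 fun x₀ => ?_
    have hT := isOpen_extChartAt_target (I := 𝓡 n) x₀
    have h1 := (isSmoothFamily_iff hJ).1 hcd x₀
    set γ : (ℝ × EuclideanSpace ℝ (Fin n)) × ℝ → ℝ × EuclideanSpace ℝ (Fin n) :=
      fun p => (t₀ + p.2 * p.1.1, p.1.2) with hγ
    have hγd : ContDiff ℝ ∞ γ := by fun_prop
    refine contDiffOn_integral_unitInterval
      (f := fun p : (ℝ × EuclideanSpace ℝ (Fin n)) × ℝ =>
        HopfCole.familyDeriv c (t₀ + p.2 * p.1.1) ((extChartAt (𝓡 n) x₀).symm p.1.2))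
      (W := γ ⁻¹' (J ×ˢ (extChartAt (𝓡 n) x₀).target))
      ((hJ.prod hT).preimage hγd.continuous) (Metric.isOpen_ball.prod hT) ?_ ?_
    · rintro ⟨⟨τ, u⟩, θ⟩ ⟨⟨hτ, hu⟩, hθ⟩
      exact ⟨hmem τ hτ θ hθ, hu⟩
    · exact h1.comp hγd.contDiffOn fun p hp => hp
  · ext x
    simp
  · intro τ hτ
    refine ⟨by simpa using hmem τ hτ 1 (by simp), ?_⟩
    ext x
    have hd : ∀ θ ∈ uIcc (0 : ℝ) 1, HasDerivAt (fun θ => c (t₀ + θ * τ) x)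
        (HopfCole.familyDeriv c (t₀ + θ * τ) x * τ) θ := by
      intro θ hθ
      rw [uIcc_of_le zero_le_one] at hθ
      have h1 := hc.hasDerivAt hJ (hmem τ hτ θ hθ) x
      have h2 : HasDerivAt (fun θ : ℝ => t₀ + θ * τ) τ θ := by
        simpa using ((hasDerivAt_id θ).mul_const τ).const_add t₀
      exact h1.comp θ h2
    have hcont : ContinuousOn (fun θ => HopfCole.familyDeriv c (t₀ + θ * τ) x * τ)
        (uIcc (0 : ℝ) 1) := by
      rw [uIcc_of_le zero_le_one]
      exact ((hcd.contDiffOn_eval x).continuousOn.comp (by fun_prop)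
        fun θ hθ => hmem τ hτ θ hθ).mul continuousOn_const
    have h3 := intervalIntegral.integral_eq_sub_of_hasDerivAt hd hcont.intervalIntegrable
    rw [intervalIntegral.integral_mul_const] at h3
    simp only [one_mul, zero_mul, add_zero] at h3
    simp only [Pi.add_apply, Pi.smul_apply, smul_eq_mul]
    linarith

end Hadamard

/-! ### Integrals of families, test functions, and uniqueness of the potential. -/

section Integrals

variable {n : ℕ} {M : Type*} [TopologicalSpace M]
  [ChartedSpace (EuclideanSpace ℝ (Fin n)) M] [IsManifold (𝓡 n) ∞ M]
  [RiemannianBundle (fun x : M => TangentSpace (𝓡 n) x)]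
  [IsContMDiffRiemannianBundle (𝓡 n) ∞ (EuclideanSpace ℝ (Fin n))
      (fun x : M => TangentSpace (𝓡 n) x)]
  [MeasurableSpace M] [BorelSpace M] [CompactSpace M] [T2Space M]

theorem IsSmoothFamily.hasDerivAt_integral {U : Set ℝ} {c : ℝ → M → ℝ} (hU : IsOpen U)
    (hc : IsSmoothFamily n U c) {t : ℝ} (ht : t ∈ U) :
    HasDerivAt (fun s => ∫ x, c s x ∂(riemannianVolume n M))
      (∫ x, HopfCole.familyDeriv c t x ∂(riemannianVolume n M)) t := by
  obtain ⟨r, hr, hrU⟩ := Metric.nhds_basis_closedBall.mem_iff.1 (hU.mem_nhds ht)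
  have hcd := hc.familyDeriv hU
  obtain ⟨C, hC⟩ := ((isCompact_closedBall t r).prod (isCompact_univ (X := M))
    ).exists_bound_of_continuousOn (hcd.continuousOn.mono (prod_mono hrU subset_rfl))
  refine (hasDerivAt_integral_of_dominated_loc_of_deriv_le (bound := fun _ => C)
    (Metric.closedBall_mem_nhds t hr) ?_ (hc.isSmooth ht).integrable ?_ ?_ ?_ ?_).2
  · filter_upwards [hU.mem_nhds ht] with s hs
    exact (hc.isSmooth hs).continuous.aestronglyMeasurable
  · exact (hcd.isSmooth ht).continuous.aestronglyMeasurable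
  · exact Filter.Eventually.of_forall fun x s hs => hC (s, x) ⟨hs, mem_univ _⟩
  · exact integrable_const C
  · exact Filter.Eventually.of_forall fun x s hs => hc.hasDerivAt hU (hrU hs) x

theorem eq_zero_of_integral_eq_zero {w : M → ℝ} (hw : Continuous w) (h0 : ∀ x, 0 ≤ w x)
    (h : ∫ x, w x ∂(riemannianVolume n M) = 0) : w = 0 := by
  have h1 := (integral_eq_zero_iff_of_nonneg (μ := riemannianVolume n M) h0
    (hw.integrable_of_hasCompactSupport (HasCompactSupport.of_compactSpace w))).1 h
  exact (hw.ae_eq_iff_eq (riemannianVolume n M) continuous_const).1 h1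

theorem IsSmooth.eq_of_integral_mul_eq {f g : M → ℝ} (hf : IsSmooth n f) (hg : IsSmooth n g)
    (h : ∀ k : M → ℝ, IsSmooth n k →
      ∫ x, f x * k x ∂(riemannianVolume n M) = ∫ x, g x * k x ∂(riemannianVolume n M)) : f = g := by
  have hd := hf.sub hg
  have h1 : ∫ x, (f x - g x) * (f x - g x) ∂(riemannianVolume n M) = 0 := by
    have := h _ hd
    simp only [Pi.sub_apply] at this
    simp only [sub_mul (f _)]
    have i1 : Integrable (fun x => f x * (f x - g x)) (riemannianVolume n M) :=
      hf.integrable_mul hd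
    have i2 : Integrable (fun x => g x * (f x - g x)) (riemannianVolume n M) :=
      hg.integrable_mul hd
    rw [integral_sub i1 i2, this, sub_self]
  have h2 := eq_zero_of_integral_eq_zero (hd.mul hd).continuous (fun x => mul_self_nonneg _) h1
  ext x
  have h3 := congrFun h2 x
  exact sub_eq_zero.1 (mul_self_eq_zero.1 h3)

/-- Testing with `f = Φ - Ψ` gives `∫ |∇f|² ρ = 0`, and `ρ` is positive. Consequently the arbitrary
choice made in `wassersteinPotential` does not affect the Hessian form. -/
theorem gradient_eq_of_wassersteinVector_eq {ρ Φ Ψ : M → ℝ} (hρ : IsSmooth n ρ)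
    (hpos : ∀ x, 0 < ρ x) (hΦ : IsSmooth n Φ) (hΨ : IsSmooth n Ψ)
    (h : wassersteinVector n ρ Φ = wassersteinVector n ρ Ψ) (x : M) :
    gradient n Φ x = gradient n Ψ x := by
  set f := Φ + (-1 : ℝ) • Ψ with hf_def
  have hf : IsSmooth n f := hΦ.add (hΨ.smul _)
  have e1 := integral_mul_wassersteinVector hf hρ hΦ
  have e2 := integral_mul_wassersteinVector hf hρ hΨ
  rw [h, e2] at e1
  have e3 : ∫ x, gradInner n f f x * ρ x ∂(riemannianVolume n M) = 0 := by
    have : gradInner n f f = gradInner n f Φ + (-1 : ℝ) • gradInner n f Ψ := by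
      conv_lhs => rw [hf_def, gradInner_add_right hΦ (hΨ.smul _), gradInner_smul_right hΨ]
    rw [this]
    simp only [Pi.add_apply, Pi.smul_apply, smul_eq_mul, add_mul, neg_mul, one_mul]
    simp only [← sub_eq_add_neg]
    rw [integral_sub ((hf.gradInner hΦ).integrable_mul hρ)
      ((hf.gradInner hΨ).integrable_mul hρ), e1, sub_self]
  have h2 := eq_zero_of_integral_eq_zero (n := n) ((hf.gradInner hf).mul hρ).continuous (fun x =>
    mul_nonneg (by rw [gradInner_self_eq]; exact sq_nonneg _) (hpos x).le) e3
  have h3 := congrFun h2 x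
  simp only [Pi.mul_apply, Pi.zero_apply, mul_eq_zero, (hpos x).ne', or_false,
    gradInner_self_eq] at h3
  have h4 : gradient n f x = 0 := norm_eq_zero.1 (pow_eq_zero_iff two_ne_zero |>.1 h3)
  rw [hf_def, gradient_add hΦ (hΨ.smul _), gradient_smul hΨ] at h4
  have h5 : gradient n Φ x = -((-1 : ℝ) • gradient n Ψ x) := eq_neg_of_add_eq_zero_left h4
  rw [h5]
  simp

end Integrals

/-! ### Calculus of the second variation. -/

section Variations

variable {n : ℕ} {M : Type*} [TopologicalSpace M]
  [ChartedSpace (EuclideanSpace ℝ (Fin n)) M] [MeasurableSpace M]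
  [RiemannianBundle (fun x : M => TangentSpace (𝓡 n) x)]
  {F : (M → ℝ) → ℝ} {D : Set (M → ℝ)}

theorem IsSmoothFunctional.isSmooth (hF : IsSmoothFunctional n F D) {ρ : M → ℝ} (hρ : ρ ∈ D) :
    IsSmooth n ρ :=
  hF.isOpen.1 ρ hρ

theorem IsSmoothFunctional.hasFirstVariationAt (hF : IsSmoothFunctional n F D) {ρ : M → ℝ}
    (hρ : ρ ∈ D) : HasFirstVariationAt n F (firstVariation n F ρ) ρ := by
  unfold firstVariation
  rw [dif_pos (hF.exists_firstVariation ρ hρ)]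
  exact (hF.exists_firstVariation ρ hρ).choose_spec

theorem IsSmoothFunctional.isOpen_setOf {P : Type} [NormedAddCommGroup P] [NormedSpace ℝ P]
    [FiniteDimensional ℝ P] (hF : IsSmoothFunctional n F D) {V : Set P} {c : P → M → ℝ}
    (hV : IsOpen V) (hc : IsSmoothFamily n V c) : IsOpen {p ∈ V | c p ∈ D} :=
  hF.isOpen.2 P V c hV hc

theorem IsSmoothFunctional.isSmoothFamily_firstVariation {P : Type} [NormedAddCommGroup P]
    [NormedSpace ℝ P] [FiniteDimensional ℝ P] (hF : IsSmoothFunctional n F D) {V : Set P}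
    {c : P → M → ℝ} (hV : IsOpen V) (hc : IsSmoothFamily n V c) :
    IsSmoothFamily n {p ∈ V | c p ∈ D} (fun p => firstVariation n F (c p)) :=
  hF.smooth_firstVariation P _ c (hF.isOpen_setOf hV hc) (hc.mono fun _ hp => hp.1)
    fun _ hp => hp.2

theorem isSmoothFamily_line {ρ h : M → ℝ} (hρ : IsSmooth n ρ) (hh : IsSmooth n h) :
    IsSmoothFamily n univ (fun ε : ℝ => ρ + ε • h) :=
  (hρ.isSmoothFamily univ).add
    (IsSmoothFamily.smul contDiff_id.contDiffOn (hh.isSmoothFamily univ))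

theorem isSmoothFamily_plane {ρ h k : M → ℝ} (hρ : IsSmooth n ρ) (hh : IsSmooth n h)
    (hk : IsSmooth n k) :
    IsSmoothFamily n univ (fun p : ℝ × ℝ => ρ + p.1 • h + p.2 • k) :=
  ((hρ.isSmoothFamily univ).add
    (IsSmoothFamily.smul contDiff_fst.contDiffOn (hh.isSmoothFamily univ))).add
    (IsSmoothFamily.smul contDiff_snd.contDiffOn (hk.isSmoothFamily univ))

theorem plane_line {X : Type*} (ρ h k : X → ℝ) (p w : ℝ × ℝ) (ε : ℝ) :
    ρ + p.1 • h + p.2 • k + ε • (w.1 • h + w.2 • k) =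
      ρ + (p + ε • w).1 • h + (p + ε • w).2 • k := by
  ext y
  simp only [Pi.add_apply, Pi.smul_apply, smul_eq_mul, Prod.fst_add, Prod.snd_add, Prod.smul_fst,
    Prod.smul_snd]
  ring

theorem IsSmoothFunctional.isOpen_line (hF : IsSmoothFunctional n F D) {ρ h : M → ℝ}
    (hρ : ρ ∈ D) (hh : IsSmooth n h) :
    IsOpen {ε : ℝ | ρ + ε • h ∈ D} ∧ (0 : ℝ) ∈ {ε : ℝ | ρ + ε • h ∈ D} ∧
      IsSmoothFamily n {ε : ℝ | ρ + ε • h ∈ D} (fun ε => firstVariation n F (ρ + ε • h)) := by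
  have h1 := isSmoothFamily_line (hF.isSmooth hρ) hh
  have h2 := hF.isOpen_setOf isOpen_univ h1
  have h3 := hF.isSmoothFamily_firstVariation isOpen_univ h1
  simp only [mem_univ, true_and] at h2 h3
  refine ⟨h2, ?_, h3⟩
  simpa using hρ

theorem secondVariation_eq_familyDeriv (ρ h : M → ℝ) :
    secondVariation n F ρ h = familyDeriv (fun ε : ℝ => firstVariation n F (ρ + ε • h)) 0 :=
  rfl

theorem IsSmoothFunctional.isSmooth_firstVariation (hF : IsSmoothFunctional n F D) {ρ : M → ℝ}
    (hρ : ρ ∈ D) : IsSmooth n (firstVariation n F ρ) :=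
  (hF.hasFirstVariationAt hρ).1

theorem IsSmoothFunctional.isSmooth_secondVariation [IsManifold (𝓡 n) ∞ M]
    (hF : IsSmoothFunctional n F D) {ρ h : M → ℝ} (hρ : ρ ∈ D) (hh : IsSmooth n h) :
    IsSmooth n (secondVariation n F ρ h) := by
  obtain ⟨h1, h2, h3⟩ := hF.isOpen_line hρ hh
  exact (h3.familyDeriv h1).isSmooth h2

theorem hasDerivAt_smul_fderiv {P : Type} [NormedAddCommGroup P] [NormedSpace ℝ P] {ψ : P → ℝ}
    {p : P} (hψ : DifferentiableAt ℝ ψ p) (w : P) :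
    HasDerivAt (fun ε : ℝ => ψ (p + ε • w)) (fderiv ℝ ψ p w) 0 := by
  have h1 : HasDerivAt (fun ε : ℝ => p + ε • w) w 0 := by
    simpa using ((hasDerivAt_id (0 : ℝ)).smul_const w).const_add p
  have h2 : HasFDerivAt ψ (fderiv ℝ ψ p) (p + (0 : ℝ) • w) := by
    simpa using hψ.hasFDerivAt
  exact h2.comp_hasDerivAt 0 h1

/-- A directional derivative need not be linear in the direction. Here it is, because `δF` is
differentiable on the plane `ρ + p₁ h + p₂ k`, and all the directions concerned lie in that plane.
-/
theorem IsSmoothFunctional.secondVariation_add_smul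
    (hF : IsSmoothFunctional n F D) {ρ h k : M → ℝ} (hρ : ρ ∈ D) (hh : IsSmooth n h)
    (hk : IsSmooth n k) (a b : ℝ) :
    secondVariation n F ρ (a • h + b • k) =
      a • secondVariation n F ρ h + b • secondVariation n F ρ k := by
  ext x
  have hc := isSmoothFamily_plane (hF.isSmooth hρ) hh hk
  have hU := hF.isOpen_setOf isOpen_univ hc
  have h0 : (0 : ℝ × ℝ) ∈ {p : ℝ × ℝ | p ∈ univ ∧ ρ + p.1 • h + p.2 • k ∈ D} := by
    refine ⟨mem_univ _, ?_⟩
    simpa using hρ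
  have hd := (((hF.isSmoothFamily_firstVariation isOpen_univ hc).contDiffOn_eval x).contDiffAt
    (hU.mem_nhds h0)).differentiableAt (by simp)
  set A := fderiv ℝ (fun p : ℝ × ℝ => firstVariation n F (ρ + p.1 • h + p.2 • k) x) 0 with hA
  have key : ∀ a b : ℝ, secondVariation n F ρ (a • h + b • k) x = A (a, b) := by
    intro a b
    have h1 := hasDerivAt_smul_fderiv hd (a, b)
    unfold secondVariation
    rw [← h1.deriv]
    congr 1
    ext ε
    rw [← plane_line]
    simp
  have e1 := key 1 0
  have e2 := key 0 1
  simp only [one_smul, zero_smul, add_zero, zero_add] at e1 e2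
  rw [key, Pi.add_apply, Pi.smul_apply, Pi.smul_apply, e1, e2, ← map_smul, ← map_smul, ← map_add]
  simp

variable [IsManifold (𝓡 n) ∞ M]
  [IsContMDiffRiemannianBundle (𝓡 n) ∞ (EuclideanSpace ℝ (Fin n))
      (fun x : M => TangentSpace (𝓡 n) x)]
  [BorelSpace M] [CompactSpace M] [T2Space M]

theorem IsSmoothFunctional.hasDerivAt_integral_firstVariation_mul
    (hF : IsSmoothFunctional n F D) {ρ h k : M → ℝ} (hρ : ρ ∈ D) (hh : IsSmooth n h)
    (hk : IsSmooth n k) :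
    HasDerivAt (fun ε : ℝ => ∫ x, firstVariation n F (ρ + ε • h) x * k x ∂(riemannianVolume n M))
      (∫ x, secondVariation n F ρ h x * k x ∂(riemannianVolume n M)) 0 := by
  obtain ⟨h1, h2, h3⟩ := hF.isOpen_line hρ hh
  have h4 := (h3.mul (hk.isSmoothFamily {ε : ℝ | ρ + ε • h ∈ D})).hasDerivAt_integral h1 h2
  have h5 : familyDeriv (fun ε : ℝ => firstVariation n F (ρ + ε • h) * k) 0 =
      fun x => secondVariation n F ρ h x * k x := by
    ext x
    have h5 := (h3.hasDerivAt h1 h2 x).mul_const (k x)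
    exact h5.deriv
  rw [h5] at h4
  exact h4

/-- Schwarz's theorem for the smooth function `p ↦ F(ρ + p₁ h + p₂ k)` of two real variables. -/
theorem IsSmoothFunctional.integral_secondVariation_mul_comm
    (hF : IsSmoothFunctional n F D) {ρ h k : M → ℝ} (hρ : ρ ∈ D) (hh : IsSmooth n h)
    (hk : IsSmooth n k) :
    ∫ x, secondVariation n F ρ h x * k x ∂(riemannianVolume n M) =
      ∫ x, secondVariation n F ρ k x * h x ∂(riemannianVolume n M) := by
  have hc := isSmoothFamily_plane (hF.isSmooth hρ) hh hk
  set U := {p : ℝ × ℝ | p ∈ univ ∧ ρ + p.1 • h + p.2 • k ∈ D} with hUdef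
  have hU : IsOpen U := hF.isOpen_setOf isOpen_univ hc
  have h0 : (0 : ℝ × ℝ) ∈ U := by
    refine ⟨mem_univ _, ?_⟩
    simpa using hρ
  set φ : ℝ × ℝ → ℝ := fun p => F (ρ + p.1 • h + p.2 • k) with hφ
  have hφs : ContDiffOn ℝ ∞ φ U :=
    hF.smooth (ℝ × ℝ) U _ hU (hc.mono (subset_univ _)) fun p hp => hp.2
  have hfst : ∀ p ∈ U, ∀ a b : ℝ, fderiv ℝ φ p (a, b) =
      ∫ x, firstVariation n F (ρ + p.1 • h + p.2 • k) x * (a • h + b • k) x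
        ∂(riemannianVolume n M) := by
    intro p hp a b
    have h1 := hasDerivAt_smul_fderiv
      ((hφs.contDiffAt (hU.mem_nhds hp)).differentiableAt (by simp)) (a, b)
    have h2 := (hF.hasFirstVariationAt hp.2).2 (a • h + b • k) ((hh.smul a).add (hk.smul b))
    refine h1.unique ?_
    refine h2.congr_of_eventuallyEq (Filter.Eventually.of_forall fun ε => ?_)
    simp only [hφ]
    rw [← plane_line]
  have hcd : ContDiffAt ℝ ∞ φ 0 := hφs.contDiffAt (hU.mem_nhds h0)
  have hd2 : DifferentiableAt ℝ (fderiv ℝ φ) 0 :=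
    (hcd.fderiv_right (m := ∞) (by simp)).differentiableAt (by simp)
  have hsnd : ∀ a b a' b' : ℝ, fderiv ℝ (fderiv ℝ φ) 0 (a, b) (a', b') =
      ∫ x, secondVariation n F ρ (a • h + b • k) x * (a' • h + b' • k) x
        ∂(riemannianVolume n M) := by
    intro a b a' b'
    have h1 := hasDerivAt_smul_fderiv (p := (0 : ℝ × ℝ))
      (ψ := fun p => fderiv ℝ φ p (a', b')) (hd2.clm_apply (differentiableAt_const _)) (a, b)
    rw [fderiv_clm_apply hd2 (differentiableAt_const _)] at h1
    have h2 := hF.hasDerivAt_integral_firstVariation_mul hρ ((hh.smul a).add (hk.smul b))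
      ((hh.smul a').add (hk.smul b'))
    have h3 : (fun ε : ℝ => fderiv ℝ φ (0 + ε • (a, b)) (a', b')) =ᶠ[nhds 0] fun ε : ℝ =>
        ∫ x, firstVariation n F (ρ + ε • (a • h + b • k)) x * (a' • h + b' • k) x
          ∂(riemannianVolume n M) := by
      have hcont : ContinuousAt (fun ε : ℝ => (0 : ℝ × ℝ) + ε • (a, b)) 0 := by fun_prop
      filter_upwards [hcont.preimage_mem_nhds (hU.mem_nhds (by simpa using h0))] with ε hε
      rw [hfst _ hε a' b', ← plane_line]
      simp
    have h4 := (h2.congr_of_eventuallyEq h3).unique h1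
    simpa using h4.symm
  -- The two mixed partial derivatives are the two pairings to be compared.
  have e1 := hsnd 1 0 0 1
  have e2 := hsnd 0 1 1 0
  simp only [one_smul, zero_smul, add_zero, zero_add] at e1 e2
  rw [← e1, ← e2]
  exact (hcd.isSymmSndFDerivAt
    (by rw [minSmoothness_of_isRCLikeNormedField]; exact ENat.LEInfty.out)) _ _

omit [IsContMDiffRiemannianBundle (𝓡 n) ∞ (EuclideanSpace ℝ (Fin n))
      (fun x : M => TangentSpace (𝓡 n) x)] [BorelSpace M] [CompactSpace M] [T2Space M] in
/-- The chain rule for `δF` along a smooth curve. -/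
theorem IsSmoothFunctional.familyDeriv_firstVariation (hF : IsSmoothFunctional n F D) {J : Set ℝ}
    {c : ℝ → M → ℝ} (hJ : IsOpen J) (hc : IsSmoothFamily n J c) (hcD : ∀ t ∈ J, c t ∈ D) {t₀ : ℝ}
    (ht₀ : t₀ ∈ J) :
    familyDeriv (fun t => firstVariation n F (c t)) t₀ =
      secondVariation n F (c t₀) (familyDeriv c t₀) := by
  ext x
  obtain ⟨r, hr, q, hq, hq0, hqr⟩ := hc.exists_quotient hJ ht₀
  -- Hadamard's quotient `q` gives the two-parameter family `c t₀ + p₁ q(p₂)`, whose diagonal is the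
  -- curve itself. The derivative along `(1, 0)` at the origin is the second variation in direction
  -- `q 0`, and along `(0, 1)` the family is constant.
  set V : Set (ℝ × ℝ) := univ ×ˢ Metric.ball 0 r with hV
  have hVo : IsOpen V := isOpen_univ.prod Metric.isOpen_ball
  have hC : IsSmoothFamily n V (fun p : ℝ × ℝ => c t₀ + p.1 • q p.2) :=
    ((hc.isSmooth ht₀).isSmoothFamily V).add
      (IsSmoothFamily.smul contDiff_fst.contDiffOn
        (hq.comp contDiff_snd.contDiffOn fun p hp => hp.2))
  have hU := hF.isOpen_setOf hVo hC
  have h0 : (0 : ℝ × ℝ) ∈ {p : ℝ × ℝ | p ∈ V ∧ c t₀ + p.1 • q p.2 ∈ D} := by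
    refine ⟨⟨mem_univ _, Metric.mem_ball_self hr⟩, ?_⟩
    simpa using hcD t₀ ht₀
  have hd := (((hF.isSmoothFamily_firstVariation hVo hC).contDiffOn_eval x).contDiffAt
    (hU.mem_nhds h0)).differentiableAt (by simp)
  set A := fderiv ℝ (fun p : ℝ × ℝ => firstVariation n F (c t₀ + p.1 • q p.2) x) 0 with hA
  have e1 : A (1, 0) = secondVariation n F (c t₀) (HopfCole.familyDeriv c t₀) x := by
    have h1 := hasDerivAt_smul_fderiv hd (1, 0)
    simp only [zero_add, Prod.smul_mk, smul_eq_mul, mul_one, mul_zero, hq0] at h1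
    exact h1.deriv.symm
  have e2 : A (0, 1) = 0 := by
    have h1 := hasDerivAt_smul_fderiv hd (0, 1)
    simp only [zero_add, Prod.smul_mk, smul_eq_mul, mul_one, mul_zero, zero_smul, add_zero] at h1
    exact h1.unique (hasDerivAt_const _ _)
  have e3 : HasDerivAt (fun t => firstVariation n F (c t) x) (A (1, 1)) t₀ := by
    have h1 := hasDerivAt_smul_fderiv hd (1, 1)
    simp only [zero_add, Prod.smul_mk, smul_eq_mul, mul_one] at h1
    rw [← sub_self t₀] at h1
    refine (h1.comp_sub_const t₀ t₀).congr_of_eventuallyEq ?_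
    filter_upwards [Metric.ball_mem_nhds t₀ hr] with t ht
    have h2 := (hqr (t - t₀) (by simpa [dist_eq_norm] using ht)).2
    rw [add_sub_cancel] at h2
    rw [h2]
  refine e3.deriv.trans ?_
  rw [← e1, show ((1 : ℝ), (1 : ℝ)) = (1, 0) + (0, 1) by simp, map_add, e2, add_zero]

end Variations

/-! ### The `L²` pairing and its time derivatives. -/

section Pairing

variable {n : ℕ} {M : Type*} [TopologicalSpace M]
  [ChartedSpace (EuclideanSpace ℝ (Fin n)) M] [IsManifold (𝓡 n) ∞ M]
  [RiemannianBundle (fun x : M => TangentSpace (𝓡 n) x)]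
  [MeasurableSpace M]

variable (n) in
/-- The `L²` inner product. -/
def pairing (u v : M → ℝ) : ℝ := ∫ x, u x * v x ∂(riemannianVolume n M)

theorem pairing_comm (u v : M → ℝ) : pairing n u v = pairing n v u := by
  simp only [pairing, mul_comm]

variable [IsContMDiffRiemannianBundle (𝓡 n) ∞ (EuclideanSpace ℝ (Fin n))
      (fun x : M => TangentSpace (𝓡 n) x)]
  [BorelSpace M] [CompactSpace M] [T2Space M]

theorem pairing_add_smul_left {u v w : M → ℝ} (hu : IsSmooth n u) (hv : IsSmooth n v)
    (hw : IsSmooth n w) (a b : ℝ) :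
    pairing n (a • u + b • v) w = a * pairing n u w + b * pairing n v w := by
  simp only [pairing, Pi.add_apply, Pi.smul_apply, smul_eq_mul, add_mul, mul_assoc]
  rw [integral_add ((hu.integrable_mul hw).const_mul a) ((hv.integrable_mul hw).const_mul b),
    integral_const_mul, integral_const_mul]

theorem pairing_add_smul_right {u v w : M → ℝ} (hu : IsSmooth n u) (hv : IsSmooth n v)
    (hw : IsSmooth n w) (a b : ℝ) :
    pairing n w (a • u + b • v) = a * pairing n w u + b * pairing n w v := by
  rw [pairing_comm, pairing_add_smul_left hu hv hw, pairing_comm u, pairing_comm v]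

theorem pairing_gradInner {ψ ρ Φ : M → ℝ} (hψ : IsSmooth n ψ) (hρ : IsSmooth n ρ)
    (hΦ : IsSmooth n Φ) :
    pairing n (gradInner n ψ Φ) ρ = pairing n ψ (wassersteinVector n ρ Φ) :=
  (integral_mul_wassersteinVector hψ hρ hΦ).symm

theorem integral_wassersteinVector {ρ Φ : M → ℝ} (hρ : IsSmooth n ρ) (hΦ : IsSmooth n Φ) :
    ∫ x, wassersteinVector n ρ Φ x ∂(riemannianVolume n M) = 0 := by
  have h := integral_mul_wassersteinVector (isSmooth_const 1) hρ hΦ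
  rw [gradInner_const_left] at h
  simpa using h

/-- Deduced from the weak form: both sides are smooth and have equal pairings with every smooth
function. -/
theorem wassersteinVector_add_smul {ρ Φ Ψ : M → ℝ} (hρ : IsSmooth n ρ) (hΦ : IsSmooth n Φ)
    (hΨ : IsSmooth n Ψ) (a b : ℝ) :
    wassersteinVector n ρ (a • Φ + b • Ψ) =
      a • wassersteinVector n ρ Φ + b • wassersteinVector n ρ Ψ := by
  have h1 := hρ.wassersteinVector hΦ
  have h2 := hρ.wassersteinVector hΨ
  have hs : IsSmooth n (a • Φ + b • Ψ) := (hΦ.smul a).add (hΨ.smul b)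
  refine (hρ.wassersteinVector hs).eq_of_integral_mul_eq ((h1.smul a).add (h2.smul b))
    fun k hk => ?_
  change pairing n _ k = pairing n _ k
  rw [pairing_add_smul_left h1 h2 hk, pairing_comm, ← pairing_gradInner hk hρ hs,
    gradInner_add_right (hΦ.smul a) (hΨ.smul b), gradInner_smul_right hΦ, gradInner_smul_right hΨ,
    pairing_add_smul_left (hk.gradInner hΦ) (hk.gradInner hΨ) hρ, pairing_gradInner hk hρ hΦ,
    pairing_gradInner hk hρ hΨ, pairing_comm k, pairing_comm k]

theorem hasDerivAt_pairing {U : Set ℝ} {c d : ℝ → M → ℝ} (hU : IsOpen U)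
    (hc : IsSmoothFamily n U c) (hd : IsSmoothFamily n U d) {t : ℝ} (ht : t ∈ U) :
    HasDerivAt (fun s => pairing n (c s) (d s))
      (pairing n (familyDeriv c t) (d t) + pairing n (c t) (familyDeriv d t)) t := by
  have h1 := (hc.mul hd).hasDerivAt_integral hU ht
  have h2 : familyDeriv (fun s => c s * d s) t =
      fun x => familyDeriv c t x * d t x + c t x * familyDeriv d t x := by
    ext x
    exact ((hc.hasDerivAt hU ht x).mul (hd.hasDerivAt hU ht x)).deriv
  rw [h2, integral_add (((hc.familyDeriv hU).isSmooth ht).integrable_mul (hd.isSmooth ht))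
    ((hc.isSmooth ht).integrable_mul ((hd.familyDeriv hU).isSmooth ht))] at h1
  exact h1

theorem familyDeriv_gradInner {U : Set ℝ} {c d : ℝ → M → ℝ} (hU : IsOpen U)
    (hc : IsSmoothFamily n U c) (hd : IsSmoothFamily n U d) {t : ℝ} (ht : t ∈ U) :
    familyDeriv (fun s => gradInner n (c s) (d s)) t =
      gradInner n (familyDeriv c t) (d t) + gradInner n (c t) (familyDeriv d t) :=
  funext fun x => (hasDerivAt_gradInner hU hc hd ht x).deriv

/-- Product rule, with an integration by parts taking the gradients off the differentiated
functions. Both variations of the Hamiltonian and the second derivative of the energies come from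
this formula. -/
theorem hasDerivAt_pairing_gradInner {U : Set ℝ} {c d ρ : ℝ → M → ℝ} (hU : IsOpen U)
    (hc : IsSmoothFamily n U c) (hd : IsSmoothFamily n U d) (hρ : IsSmoothFamily n U ρ) {t : ℝ}
    (ht : t ∈ U) :
    HasDerivAt (fun s => pairing n (gradInner n (c s) (d s)) (ρ s))
      (pairing n (familyDeriv c t) (wassersteinVector n (ρ t) (d t))
        + pairing n (familyDeriv d t) (wassersteinVector n (ρ t) (c t))
        + pairing n (gradInner n (c t) (d t)) (familyDeriv ρ t)) t := by
  have h := hasDerivAt_pairing hU (hc.gradInner hU hd) hρ ht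
  have hct := hc.isSmooth ht
  have hdt := hd.isSmooth ht
  have hρt := hρ.isSmooth ht
  have hc' := (hc.familyDeriv hU).isSmooth ht
  have hd' := (hd.familyDeriv hU).isSmooth ht
  have e : pairing n (gradInner n (familyDeriv c t) (d t) + gradInner n (c t) (familyDeriv d t))
      (ρ t) = pairing n (familyDeriv c t) (wassersteinVector n (ρ t) (d t))
        + pairing n (familyDeriv d t) (wassersteinVector n (ρ t) (c t)) := by
    have := pairing_add_smul_left (hc'.gradInner hdt) (hct.gradInner hd') hρt 1 1
    simp only [one_smul, one_mul] at this
    rw [this, gradInner_comm (c t), pairing_gradInner hc' hρt hdt, pairing_gradInner hd' hρt hct]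
  rw [familyDeriv_gradInner hU hc hd ht, e] at h
  exact h

theorem familyDeriv_line (ρ h : M → ℝ) : familyDeriv (fun ε : ℝ => ρ + ε • h) 0 = h := by
  ext x
  have h1 : HasDerivAt (fun ε : ℝ => ρ x + ε * h x) (1 * h x) 0 :=
    ((hasDerivAt_id (0 : ℝ)).mul_const (h x)).const_add (ρ x)
  rw [one_mul] at h1
  exact h1.deriv

theorem hamiltonian_eq (F : (M → ℝ) → ℝ) (ρ S : M → ℝ) :
    hamiltonian n F ρ S = (1 / 2) * pairing n (gradInner n S S) ρ -
      (1 / 2) * pairing n (gradInner n (firstVariation n F ρ) (firstVariation n F ρ)) ρ := by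
  simp only [hamiltonian, pairing, gradInner_self_eq]

end Pairing

/-! ### Explicit flow equations, homogeneity and the Wasserstein Hessian. -/

section Flow

variable {n : ℕ} {M : Type*} [TopologicalSpace M]
  [ChartedSpace (EuclideanSpace ℝ (Fin n)) M] [IsManifold (𝓡 n) ∞ M]
  [RiemannianBundle (fun x : M => TangentSpace (𝓡 n) x)]
  [MeasurableSpace M]
  [IsContMDiffRiemannianBundle (𝓡 n) ∞ (EuclideanSpace ℝ (Fin n))
      (fun x : M => TangentSpace (𝓡 n) x)]
  [BorelSpace M] [CompactSpace M] [T2Space M]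
  {F : (M → ℝ) → ℝ} {D : Set (M → ℝ)}

theorem eq_wassersteinVector_of_hasFirstVariationAt {ρ S v : M → ℝ} (hρ : IsSmooth n ρ)
    (hS : IsSmooth n S) (h : HasFirstVariationAt n (fun S' => hamiltonian n F ρ S') v S) :
    v = wassersteinVector n ρ S := by
  refine h.1.eq_of_integral_mul_eq (hρ.wassersteinVector hS) fun k hk => ?_
  have h1 := h.2 k hk
  have hl := isSmoothFamily_line hS hk
  have h2 := hasDerivAt_pairing_gradInner isOpen_univ hl hl (hρ.isSmoothFamily univ) (mem_univ 0)
  have h3 : familyDeriv (fun _ : ℝ => ρ) 0 = (0 : ℝ) • ρ := by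
    ext x
    rw [zero_smul]
    exact (hasDerivAt_const (0 : ℝ) (ρ x)).deriv
  simp only [hamiltonian_eq] at h1
  have h4 := h1.unique ((h2.const_mul (1 / 2)).sub_const _)
  rw [h3, familyDeriv_line] at h4
  simp only [zero_smul, add_zero] at h4
  have h5 : pairing n (gradInner n S S) (0 : M → ℝ) = 0 := by simp [pairing]
  rw [h5] at h4
  change pairing n _ k = pairing n _ k
  rw [pairing_comm (wassersteinVector n ρ S)]
  refine h4.trans ?_
  ring

/-- Varying `ρ` inside `δF(ρ)` produces `∫ (δ²F(ρ) k) V_g` with `g = δF(ρ)`; symmetry of `δ²F` frees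
the test function `k`. The unit scalars in the conclusion match the bilinearity lemmas for
`pairing`. -/
theorem eq_of_hasFirstVariationAt_density (hF : IsSmoothFunctional n F D) {ρ S v : M → ℝ}
    (hρ : ρ ∈ D) (hS : IsSmooth n S)
    (h : HasFirstVariationAt n (fun ρ' => hamiltonian n F ρ' S) v ρ) :
    v = (1 / 2 : ℝ) • gradInner n S S + (-1 : ℝ) • ((1 / 2 : ℝ) •
      gradInner n (firstVariation n F ρ) (firstVariation n F ρ) +
      (1 : ℝ) • secondVariation n F ρ (wassersteinVector n ρ (firstVariation n F ρ))) := by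
  have hρs := hF.isSmooth hρ
  have hg := hF.isSmooth_firstVariation hρ
  have hV := hρs.wassersteinVector hg
  have hSS := hS.gradInner hS
  have hgg := hg.gradInner hg
  have hq := hF.isSmooth_secondVariation hρ hV
  have hgq := (hgg.smul (1 / 2)).add (hq.smul 1)
  refine h.1.eq_of_integral_mul_eq ((hSS.smul _).add (hgq.smul (-1))) fun k hk => ?_
  have h1 := h.2 k hk
  obtain ⟨hU, h0, hfam⟩ := hF.isOpen_line hρ hk
  have hl := (isSmoothFamily_line hρs hk).mono (subset_univ {ε : ℝ | ρ + ε • k ∈ D})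
  have h2 := hasDerivAt_pairing hU (hSS.isSmoothFamily _) hl h0
  have h3 := hasDerivAt_pairing_gradInner hU hfam hfam hl h0
  have h4 : familyDeriv (fun _ : ℝ => gradInner n S S) 0 = (0 : M → ℝ) := by
    ext x
    exact (hasDerivAt_const (0 : ℝ) (gradInner n S S x)).deriv
  simp only [hamiltonian_eq] at h1
  have h5 := h1.unique ((h2.const_mul (1 / 2)).sub (h3.const_mul (1 / 2)))
  rw [h4, familyDeriv_line, ← secondVariation_eq_familyDeriv] at h5
  simp only [zero_smul, add_zero] at h5
  have h6 : pairing n (0 : M → ℝ) ρ = 0 := by simp [pairing]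
  have h7 : pairing n (secondVariation n F ρ k) (wassersteinVector n ρ (firstVariation n F ρ)) =
      pairing n (secondVariation n F ρ (wassersteinVector n ρ (firstVariation n F ρ))) k :=
    hF.integral_secondVariation_mul_comm hρ hk hV
  rw [h6, h7] at h5
  change pairing n _ k = pairing n _ k
  rw [pairing_add_smul_left hSS hgq hk, pairing_add_smul_left hgg hq hk]
  refine h5.trans ?_
  ring

/-- Compactness makes positivity stable uniformly in `x`, and mean zero preserves the mass.
Homogeneity, assumed on probability densities only, can thus be differentiated in these directions.
-/
theorem eventually_mem_positiveDensities {ρ h : M → ℝ} (hρ : ρ ∈ positiveDensities n M)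
    (hh : IsSmooth n h) (h0 : ∫ x, h x ∂(riemannianVolume n M) = 0) :
    ∀ᶠ ε : ℝ in nhds 0, ρ + ε • h ∈ positiveDensities n M := by
  have h1 : ∀ᶠ ε : ℝ in nhds 0, ∀ x ∈ (univ : Set M), 0 < ρ x + ε * h x := by
    refine isCompact_univ.eventually_forall_of_forall_eventually fun x _ => ?_
    have hc : Continuous fun z : ℝ × M => ρ z.2 + z.1 * h z.2 :=
      (hρ.1.continuous.comp continuous_snd).add
        (continuous_fst.mul (hh.continuous.comp continuous_snd))
    refine hc.continuousAt.eventually (lt_mem_nhds ?_)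
    simpa using hρ.2.1 x
  filter_upwards [h1] with ε hε
  refine ⟨hρ.1.add (hh.smul ε), fun x => hε x (mem_univ x), ?_⟩
  simp only [Pi.add_apply, Pi.smul_apply, smul_eq_mul]
  rw [integral_add hρ.1.integrable (hh.integrable.const_mul ε), integral_const_mul, h0, hρ.2.2]
  ring

theorem pairing_secondVariation_density (hF : IsSmoothFunctional n F D)
    (hD : positiveDensities n M ⊆ D) {a b : ℝ} (hhom : IsHomogeneousFunctional n F a b)
    {ρ h : M → ℝ} (hρ : ρ ∈ positiveDensities n M) (hh : IsSmooth n h)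
    (h0 : ∫ x, h x ∂(riemannianVolume n M) = 0) :
    pairing n (secondVariation n F ρ h) ρ = (a - 1) * pairing n (firstVariation n F ρ) h := by
  have hρD := hD hρ
  obtain ⟨hU, h0', hfam⟩ := hF.isOpen_line hρD hh
  have h1 : HasDerivAt (fun ε : ℝ => F (ρ + ε • h)) (pairing n (firstVariation n F ρ) h) 0 :=
    (hF.hasFirstVariationAt hρD).2 h hh
  have hl := (isSmoothFamily_line hρ.1 hh).mono (subset_univ {ε : ℝ | ρ + ε • h ∈ D})
  have h2 := ((hasDerivAt_pairing hU hfam hl h0').const_mul a⁻¹).add_const b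
  -- Two derivatives of `F` in direction `h`: by the first variation, and through the homogeneity
  -- relation. Equating them gives `a ∫ g h = ∫ (δ²F(ρ) h) ρ + ∫ g h`, where `g = δF(ρ)`.
  have h3 := h1.unique (h2.congr_of_eventuallyEq (by
    filter_upwards [eventually_mem_positiveDensities hρ hh h0] with ε hε
    exact hhom.2 _ hε))
  rw [familyDeriv_line, ← secondVariation_eq_familyDeriv] at h3
  simp only [zero_smul, add_zero] at h3
  have ha := hhom.1.ne'
  field_simp at h3
  linarith

/-- After `hessian_gradient_gradient`, every integrand has the form `⟪∇ψ, ∇Φ⟫ ρ`, and integration by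
parts turns it into a pairing of `ψ` with `V_Φ`. -/
theorem wassersteinHessian_wassersteinVector (hF : IsSmoothFunctional n F D) {ρ f : M → ℝ}
    (hρ : ρ ∈ D) (hpos : ∀ x, 0 < ρ x) (hf : IsSmooth n f) :
    wassersteinHessian n F ρ (wassersteinVector n ρ f) (wassersteinVector n ρ f) =
      pairing n (secondVariation n F ρ (wassersteinVector n ρ f)) (wassersteinVector n ρ f)
      + pairing n (gradInner n (firstVariation n F ρ) f) (wassersteinVector n ρ f)
      - (1 / 2) * pairing n (gradInner n f f) (wassersteinVector n ρ (firstVariation n F ρ)) := by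
  have hρs := hF.isSmooth hρ
  have hg := hF.isSmooth_firstVariation hρ
  have hV := hρs.wassersteinVector hf
  have hex : ∃ Φ : M → ℝ, IsSmooth n Φ ∧ wassersteinVector n ρ Φ = wassersteinVector n ρ f :=
    ⟨f, hf, rfl⟩
  obtain ⟨hΦ, hΦV⟩ : IsSmooth n (wassersteinPotential n ρ (wassersteinVector n ρ f)) ∧
      wassersteinVector n ρ (wassersteinPotential n ρ (wassersteinVector n ρ f)) =
        wassersteinVector n ρ f := by
    unfold wassersteinPotential
    rw [dif_pos hex]
    exact hex.choose_spec
  have hgrad := gradient_eq_of_wassersteinVector_eq hρs hpos hΦ hf hΦV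
  unfold wassersteinHessian
  simp only [hΦV, hgrad, hessian_gradient_gradient hg hf]
  have h1 := pairing_gradInner (hF.isSmooth_secondVariation hρ hV) hρs hf
  have h2 := pairing_gradInner (hg.gradInner hf) hρs hf
  have h3 := pairing_gradInner (hf.gradInner hf) hρs hg
  have h4 := pairing_add_smul_left ((hg.gradInner hf).gradInner hf)
    ((hf.gradInner hf).gradInner hg) hρs 1 (-(1 / 2))
  rw [h2, h3] at h4
  rw [add_sub_assoc, ← h1]
  congr 1
  calc _ = pairing n ((1 : ℝ) • gradInner n (gradInner n (firstVariation n F ρ) f) f +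
      (-(1 / 2) : ℝ) • gradInner n (gradInner n f f) (firstVariation n F ρ)) ρ := by
        unfold pairing
        refine integral_congr_ae (Filter.Eventually.of_forall fun x => ?_)
        simp only [Pi.add_apply, Pi.smul_apply, smul_eq_mul]
        ring
    _ = _ := by
      rw [h4]
      ring

end Flow

/-! ### Derivatives of the split energies along the flow. -/

section SplitEnergy

variable {n : ℕ} {M : Type*} [TopologicalSpace M]
  [ChartedSpace (EuclideanSpace ℝ (Fin n)) M] [IsManifold (𝓡 n) ∞ M]
  [RiemannianBundle (fun x : M => TangentSpace (𝓡 n) x)]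
  [MeasurableSpace M]
  [IsContMDiffRiemannianBundle (𝓡 n) ∞ (EuclideanSpace ℝ (Fin n))
      (fun x : M => TangentSpace (𝓡 n) x)]
  [BorelSpace M] [CompactSpace M] [T2Space M]
  {F : (M → ℝ) → ℝ} {D : Set (M → ℝ)} {J : Set ℝ} {ρ S : ℝ → M → ℝ}

theorem IsHamiltonianFlow.familyDeriv_density (hflow : IsHamiltonianFlow n F J ρ S) {t : ℝ}
    (ht : t ∈ J) : familyDeriv ρ t = wassersteinVector n (ρ t) (S t) :=
  eq_wassersteinVector_of_hasFirstVariationAt (hflow.density t ht).1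
    (hflow.smooth_potential.isSmooth ht) (hflow.density_eq t ht)

theorem IsHamiltonianFlow.familyDeriv_potential (hflow : IsHamiltonianFlow n F J ρ S)
    (hF : IsSmoothFunctional n F D) (hD : positiveDensities n M ⊆ D) {t : ℝ} (ht : t ∈ J) :
    familyDeriv S t = (-(1 / 2) : ℝ) • gradInner n (S t) (S t) + (1 : ℝ) • ((1 / 2 : ℝ) •
      gradInner n (firstVariation n F (ρ t)) (firstVariation n F (ρ t)) + (1 : ℝ) •
      secondVariation n F (ρ t) (wassersteinVector n (ρ t) (firstVariation n F (ρ t)))) := by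
  have h := eq_of_hasFirstVariationAt_density hF (hD (hflow.density t ht))
    (hflow.smooth_potential.isSmooth ht) (hflow.potential_eq t ht)
  ext x
  have hx := congrFun h x
  simp only [Pi.add_apply, Pi.smul_apply, smul_eq_mul] at hx ⊢
  unfold familyDeriv
  linarith

theorem IsHamiltonianFlow.isSmoothFamily_firstVariation (hflow : IsHamiltonianFlow n F J ρ S)
    (hF : IsSmoothFunctional n F D) (hD : positiveDensities n M ⊆ D) (hJ : IsOpen J) :
    IsSmoothFamily n J (fun s => firstVariation n F (ρ s)) :=
  hF.smooth_firstVariation ℝ J ρ hJ hflow.smooth_density fun s hs => hD (hflow.density s hs)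

/-- The first derivative of the split energies along the flow. -/
theorem IsHamiltonianFlow.hasDerivAt_pairing_density (hflow : IsHamiltonianFlow n F J ρ S)
    (hF : IsSmoothFunctional n F D) (hD : positiveDensities n M ⊆ D) {a b : ℝ}
    (hhom : IsHomogeneousFunctional n F a b) (hJ : IsOpen J) (σ : ℝ) {t : ℝ} (ht : t ∈ J) :
    HasDerivAt (fun s => a⁻¹ * pairing n (ρ s)
        ((1 / 2 : ℝ) • firstVariation n F (ρ s) + (σ / 2) • S s) + b / 2)
      ((1 / 2) * pairing n (gradInner n (firstVariation n F (ρ t)) (S t)) (ρ t)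
        + σ / 2 * pairing n
          (gradInner n (firstVariation n F (ρ t)) (firstVariation n F (ρ t))) (ρ t)
        + σ / (4 * a) * (pairing n (gradInner n (S t) (S t)) (ρ t) - pairing n
          (gradInner n (firstVariation n F (ρ t)) (firstVariation n F (ρ t))) (ρ t))) t := by
  have hg := hflow.isSmoothFamily_firstVariation hF hD hJ
  have hfam : IsSmoothFamily n J
      (fun s => (1 / 2 : ℝ) • firstVariation n F (ρ s) + (σ / 2) • S s) :=
    (hg.smul contDiffOn_const).add (hflow.smooth_potential.smul contDiffOn_const)
  have hρt := hflow.density t ht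
  have hρs := hρt.1
  have hSs := hflow.smooth_potential.isSmooth ht
  have hgs := hF.isSmooth_firstVariation (hD hρt)
  have hVS := hρs.wassersteinVector hSs
  have hVg := hρs.wassersteinVector hgs
  have hq := hF.isSmooth_secondVariation (hD hρt) hVg
  have hp := hF.isSmooth_secondVariation (hD hρt) hVS
  have hgg := hgs.gradInner hgs
  have hSS := hSs.gradInner hSs
  have hr := (hgg.smul (1 / 2)).add (hq.smul 1)
  have hSd := (hSS.smul (-(1 / 2))).add (hr.smul 1)
  have h1 := ((hasDerivAt_pairing hJ hflow.smooth_density hfam ht).const_mul a⁻¹).add_const (b / 2)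
  have hd : familyDeriv (fun s => (1 / 2 : ℝ) • firstVariation n F (ρ s) + (σ / 2) • S s) t =
      (1 / 2 : ℝ) • familyDeriv (fun s => firstVariation n F (ρ s)) t +
        (σ / 2) • familyDeriv S t := by
    ext x
    exact (((hg.hasDerivAt hJ ht x).const_mul (1 / 2)).add
      ((hflow.smooth_potential.hasDerivAt hJ ht x).const_mul (σ / 2))).deriv
  have hġ := hF.familyDeriv_firstVariation hJ hflow.smooth_density
    (fun s hs => hD (hflow.density s hs)) ht
  have eρ := hflow.familyDeriv_density ht
  rw [hd, hġ, eρ, hflow.familyDeriv_potential hF hD ht, pairing_add_smul_right hgs hSs hVS,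
    pairing_add_smul_right hp hSd hρs, pairing_add_smul_right hSS hr hρs,
    pairing_add_smul_right hgg hq hρs] at h1
  -- Homogeneity applies since divergences have mean zero. It removes the second variation from the
  -- first derivative of the energy.
  have a1 := pairing_secondVariation_density hF hD hhom hρt hVS
    (integral_wassersteinVector hρs hSs)
  have a2 := pairing_secondVariation_density hF hD hhom hρt hVg
    (integral_wassersteinVector hρs hgs)
  rw [← pairing_gradInner hgs hρs hSs, pairing_comm] at a1
  rw [← pairing_gradInner hgs hρs hgs, pairing_comm] at a2
  have a3 : pairing n (wassersteinVector n (ρ t) (S t)) (firstVariation n F (ρ t)) =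
      pairing n (gradInner n (firstVariation n F (ρ t)) (S t)) (ρ t) := by
    rw [pairing_comm, pairing_gradInner hgs hρs hSs]
  have a4 : pairing n (wassersteinVector n (ρ t) (S t)) (S t) =
      pairing n (gradInner n (S t) (S t)) (ρ t) := by
    rw [pairing_comm, pairing_gradInner hSs hρs hSs]
  rw [a1, a2, a3, a4, pairing_comm (ρ t), pairing_comm (ρ t)] at h1
  refine h1.congr_deriv ?_
  have ha := hhom.1.ne'
  field_simp
  ring

/-- The second derivative of the split energies along the flow. -/
theorem IsHamiltonianFlow.hasDerivAt_energy_deriv_formula (hflow : IsHamiltonianFlow n F J ρ S)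
    (hF : IsSmoothFunctional n F D) (hD : positiveDensities n M ⊆ D) (hJ : IsOpen J) {σ : ℝ}
    (hσ : σ * σ = 1) (a : ℝ) {t : ℝ} (ht : t ∈ J) {f : M → ℝ}
    (hf : f = (1 / 2 : ℝ) • firstVariation n F (ρ t) + (σ / 2) • S t) :
    HasDerivAt (fun s => (1 / 2) * pairing n (gradInner n (firstVariation n F (ρ s)) (S s)) (ρ s)
        + σ / 2 * pairing n
          (gradInner n (firstVariation n F (ρ s)) (firstVariation n F (ρ s))) (ρ s)
        + σ / (4 * a) * (pairing n (gradInner n (S s) (S s)) (ρ s) - pairing n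
          (gradInner n (firstVariation n F (ρ s)) (firstVariation n F (ρ s))) (ρ s)))
      (2 * wassersteinHessian n F (ρ t) (wassersteinVector n (ρ t) f)
        (wassersteinVector n (ρ t) f)) t := by
  have hg := hflow.isSmoothFamily_firstVariation hF hD hJ
  have hS := hflow.smooth_potential
  have hρ := hflow.smooth_density
  have hA := hasDerivAt_pairing_gradInner hJ hg hg hρ ht
  have hB := hasDerivAt_pairing_gradInner hJ hg hS hρ ht
  have hC := hasDerivAt_pairing_gradInner hJ hS hS hρ ht
  refine (((hB.const_mul (1 / 2)).add (hA.const_mul (σ / 2))).add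
    ((hC.sub hA).const_mul (σ / (4 * a)))).congr_deriv ?_
  have hρt := hflow.density t ht
  have hρs := hρt.1
  have hSs := hS.isSmooth ht
  have hgs := hF.isSmooth_firstVariation (hD hρt)
  have hfs : IsSmooth n f := hf ▸ (hgs.smul (1 / 2)).add (hSs.smul (σ / 2))
  have hVS := hρs.wassersteinVector hSs
  have hVg := hρs.wassersteinVector hgs
  have hq := hF.isSmooth_secondVariation (hD hρt) hVg
  have hp := hF.isSmooth_secondVariation (hD hρt) hVS
  have hgg := hgs.gradInner hgs
  have hgS := hgs.gradInner hSs
  have hSS := hSs.gradInner hSs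
  have hr := (hgg.smul (1 / 2)).add (hq.smul 1)
  have hsym : pairing n (secondVariation n F (ρ t) (wassersteinVector n (ρ t) (S t)))
        (wassersteinVector n (ρ t) (firstVariation n F (ρ t))) =
      pairing n (secondVariation n F (ρ t)
        (wassersteinVector n (ρ t) (firstVariation n F (ρ t))))
        (wassersteinVector n (ρ t) (S t)) :=
    hF.integral_secondVariation_mul_comm (hD hρt) hVS hVg
  have hġ := hF.familyDeriv_firstVariation hJ hρ (fun s hs => hD (hflow.density s hs)) ht
  have eρ := hflow.familyDeriv_density ht
  have eV : wassersteinVector n (ρ t) f =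
      (1 / 2 : ℝ) • wassersteinVector n (ρ t) (firstVariation n F (ρ t)) +
        (σ / 2) • wassersteinVector n (ρ t) (S t) := by
    rw [hf, wassersteinVector_add_smul hρs hgs hSs]
  have egf : gradInner n (firstVariation n F (ρ t)) f =
      (1 / 2 : ℝ) • gradInner n (firstVariation n F (ρ t)) (firstVariation n F (ρ t)) +
        (σ / 2) • gradInner n (firstVariation n F (ρ t)) (S t) := by
    rw [hf, gradInner_add_right (hgs.smul _) (hSs.smul _), gradInner_smul_right hgs,
      gradInner_smul_right hSs]
  have eSf : gradInner n (S t) f =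
      (1 / 2 : ℝ) • gradInner n (firstVariation n F (ρ t)) (S t) +
        (σ / 2) • gradInner n (S t) (S t) := by
    rw [hf, gradInner_add_right (hgs.smul _) (hSs.smul _), gradInner_smul_right hgs,
      gradInner_smul_right hSs, gradInner_comm (S t) (firstVariation n F (ρ t))]
  have eff : gradInner n f f = (1 / 2 : ℝ) • gradInner n (firstVariation n F (ρ t)) f +
      (σ / 2) • gradInner n (S t) f := by
    conv_lhs => enter [2]; rw [hf]
    rw [gradInner_add_left (hgs.smul _) (hSs.smul _), gradInner_smul_left hgs,
      gradInner_smul_left hSs]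
  rw [wassersteinHessian_wassersteinVector hF (hD hρt) hρt.2.1 hfs, eff, eSf, egf, eV,
    hF.secondVariation_add_smul (hD hρt) hVg hVS, hġ, eρ, hflow.familyDeriv_potential hF hD ht]
  have hgf := (hgg.smul (1 / 2)).add (hgS.smul (σ / 2))
  have hSf := (hgS.smul (1 / 2)).add (hSS.smul (σ / 2))
  have hqp := (hq.smul (1 / 2)).add (hp.smul (σ / 2))
  rw [pairing_add_smul_right hVg hVS hqp, pairing_add_smul_left hq hp hVg,
    pairing_add_smul_left hq hp hVS, pairing_add_smul_right hVg hVS hgf,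
    pairing_add_smul_left hgf hSf hVg, pairing_add_smul_left hgg hgS hVg,
    pairing_add_smul_left hgg hgS hVS, pairing_add_smul_left hgS hSS hVg,
    pairing_add_smul_left hSS hr hVg, pairing_add_smul_left hgg hq hVg,
    pairing_add_smul_left hSS hr hVS, pairing_add_smul_left hgg hq hVS, hsym]
  -- The terms with coefficient `σ / (4 * a)` cancel once `hsym` has been used, which is
  -- conservation of the Hamiltonian, so any real `a` is allowed. The terms of the Hessian quadratic
  -- in `S` come with `σ²`; replacing it by `1` accounts for the whole remainder.
  linear_combination (-(1 / 2) * (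
    pairing n (secondVariation n F (ρ t) (wassersteinVector n (ρ t) (S t)))
      (wassersteinVector n (ρ t) (S t)) +
    pairing n (gradInner n (firstVariation n F (ρ t)) (S t)) (wassersteinVector n (ρ t) (S t)) -
    (1 / 2) * pairing n (gradInner n (S t) (S t))
      (wassersteinVector n (ρ t) (firstVariation n F (ρ t))))) * hσ

/-- Along the flow, `a⁻¹ ∫ ρ (δF(ρ) ± S) / 2 + b / 2` has the second derivative
`2 Hess_W F(ρ)(V_f, V_f)` with `f = (δF(ρ) ± S) / 2`. -/
theorem IsHamiltonianFlow.hasDerivAt_deriv_energy (hflow : IsHamiltonianFlow n F J ρ S)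
    (hF : IsSmoothFunctional n F D) (hD : positiveDensities n M ⊆ D) {a b : ℝ}
    (hhom : IsHomogeneousFunctional n F a b) (hJ : IsOpen J) {σ : ℝ} (hσ : σ * σ = 1)
    {f : ℝ → M → ℝ}
    (hf : ∀ s ∈ J, f s = (1 / 2 : ℝ) • firstVariation n F (ρ s) + (σ / 2) • S s)
    {E : ℝ → ℝ} (hE : ∀ s ∈ J, E s = a⁻¹ * pairing n (ρ s) (f s) + b / 2) {t : ℝ} (ht : t ∈ J) :
    DifferentiableAt ℝ E t ∧ HasDerivAt (deriv E)
      (2 * wassersteinHessian n F (ρ t) (wassersteinVector n (ρ t) (f t))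
        (wassersteinVector n (ρ t) (f t))) t := by
  have h1 : ∀ s ∈ J, HasDerivAt E _ s := fun s hs =>
    (hflow.hasDerivAt_pairing_density hF hD hhom hJ σ hs).congr_of_eventuallyEq (by
      filter_upwards [hJ.mem_nhds hs] with r hr
      rw [hE r hr, hf r hr])
  refine ⟨(h1 t ht).differentiableAt,
    (hflow.hasDerivAt_energy_deriv_formula hF hD hJ hσ a ht (hf t ht)).congr_of_eventuallyEq ?_⟩
  filter_upwards [hJ.mem_nhds ht] with s hs
  exact (h1 s hs).deriv

/-- The argument of the inverse is `δF(ρ)` with `ρ ∈ D`, and injectivity on `D` makes `ρ` the only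
preimage that the inverse can select. -/
theorem IsHopfCole.hopfColeDensity_eq {η η' ρ S : M → ℝ} (h : IsHopfCole n F η η' ρ S)
    (hinv : Set.InjOn (firstVariation n F) D) (hρ : ρ ∈ D) : hopfColeDensity n F D η η' = ρ := by
  unfold hopfColeDensity
  rw [← h.1]
  exact hinv.leftInvOn_invFunOn hρ

theorem IsHopfCole.firstVariation_eq {η η' ρ S : M → ℝ} (h : IsHopfCole n F η η' ρ S) :
    firstVariation n F η = (1 / 2 : ℝ) • firstVariation n F ρ + ((1 : ℝ) / 2) • S := by
  rw [h.1, h.2]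
  ext x
  simp only [Pi.add_apply, Pi.sub_apply, Pi.smul_apply, smul_eq_mul]
  ring

theorem IsHopfCole.firstVariation_star_eq {η η' ρ S : M → ℝ} (h : IsHopfCole n F η η' ρ S) :
    firstVariation n F η' = (1 / 2 : ℝ) • firstVariation n F ρ + ((-1 : ℝ) / 2) • S := by
  rw [h.1, h.2]
  ext x
  simp only [Pi.add_apply, Pi.sub_apply, Pi.smul_apply, smul_eq_mul]
  ring

end SplitEnergy

end HopfCole

end

theorem mainTheorem5 {n : ℕ} {M : Type*} [TopologicalSpace M] [T2Space M] [CompactSpace M]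
    [MeasurableSpace M] [BorelSpace M]
    [ChartedSpace (EuclideanSpace ℝ (Fin n)) M] [IsManifold (𝓡 n) ∞ M]
    [RiemannianBundle (fun x : M => TangentSpace (𝓡 n) x)]
    [IsContMDiffRiemannianBundle (𝓡 n) ∞ (EuclideanSpace ℝ (Fin n))
      (fun x : M => TangentSpace (𝓡 n) x)]
    {F : (M → ℝ) → ℝ} {D : Set (M → ℝ)} {a b : ℝ}
    (hF : IsSmoothFunctional n F D)
    (hD : positiveDensities n M ⊆ D)
    (hinv : Set.InjOn (firstVariation n F) D)
    (hhom : IsHomogeneousFunctional n F a b)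
    {J : Set ℝ} (hJ : IsOpen J) {ρ S η η' : ℝ → M → ℝ}
    (hflow : IsHamiltonianFlow n F J ρ S)
    (hη : ∀ t ∈ J, η t ∈ D) (hη' : ∀ t ∈ J, η' t ∈ D)
    (hHC : ∀ t ∈ J, IsHopfCole n F (η t) (η' t) (ρ t) (S t)) :
    ∀ t ∈ J,
      (DifferentiableAt ℝ (fun s => splitEnergy n F D a b (η s) (η' s)) t ∧
        HasDerivAt (deriv fun s => splitEnergy n F D a b (η s) (η' s))
          (2 * wassersteinHessian n F (ρ t)
            (wassersteinVector n (ρ t) (firstVariation n F (η t)))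
            (wassersteinVector n (ρ t) (firstVariation n F (η t)))) t) ∧
      (DifferentiableAt ℝ (fun s => splitEnergyStar n F D a b (η s) (η' s)) t ∧
        HasDerivAt (deriv fun s => splitEnergyStar n F D a b (η s) (η' s))
          (2 * wassersteinHessian n F (ρ t)
            (wassersteinVector n (ρ t) (firstVariation n F (η' t)))
            (wassersteinVector n (ρ t) (firstVariation n F (η' t)))) t) := by
  intro t ht
  constructor
  -- The sign `σ = 1` corresponds to `δF(η) = (δF(ρ) + S)/2`; below, `σ = -1` corresponds to `δF(η')
  -- = (δF(ρ) - S)/2`.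
  · exact hflow.hasDerivAt_deriv_energy hF hD hhom hJ (σ := 1) (one_mul 1)
      (f := fun s => firstVariation n F (η s)) (fun s hs => (hHC s hs).firstVariation_eq)
      (fun s hs => by
        unfold splitEnergy pairing
        rw [(hHC s hs).hopfColeDensity_eq hinv (hD (hflow.density s hs))]) ht
  · exact hflow.hasDerivAt_deriv_energy hF hD hhom hJ (σ := -1) (by norm_num)
      (f := fun s => firstVariation n F (η' s)) (fun s hs => (hHC s hs).firstVariation_star_eq)
      (fun s hs => by
        unfold splitEnergyStar pairing
        rw [(hHC s hs).hopfColeDensity_eq hinv (hD (hflow.density s hs))]) ht
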